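/- Let $m, s, n$ be integers with $m \ge 1$, $s \ge 2$ and $n \ge 3$, and let $r \in \mathbb{Z}_n^*$ be such that $r^{ms} = 1$ or $r^{ms} = -1$ in $\mathbb{Z}_n$. Let $\overline{\mathrm{CPM}}(m,s,n;r)$ be the graph whose vertices are the pairs $\langle i; \mathbf{v}\rangle$ with $i \in \mathbb{Z}_{ms}$ and $\mathbf{v} = (v_0, \ldots, v_{s-1}) \in \mathbb{Z}_n^s$, and whose adjacency is given by $$\langle i; \mathbf{v}\rangle \sim \langle i+1; \mathbf{v} \pm r^i \mathbf{e}_\ell\rangle, \qquad \ell = i \bmod s,$$ where $\mathbf{e}_\ell$ is the $\ell$-th standard vector. Let $\Gamma = \mathrm{CPM}(m,s,n;r)$ be its connected component containing $\langle 0; \mathbf{0}\rangle$. Let $\bar{G} = \langle \bar\sigma, \bar\rho_0, \bar\tau_0\rangle$ be the group of permutations of the vertices of $\overline{\mathrm{CPM}}(m,s,n;r)$ generated by $$\bar\sigma : \langle i; \mathbf{v}\rangle \mapsto \langle i+1; (r v_{s-1}, r v_0, r v_1, \ldots, r v_{s-2})\rangle, \quad \bar\rho_0 : \langle i; \mathbf{v}\rangle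 \mapsto \langle i; \mathbf{v} + \mathbf{e}_0\rangle, \quad \bar\tau_0 : \langle i; \mathbf{v}\rangle \mapsto \langle i; (-v_0, v_1, \ldots, v_{s-1})\rangle,$$ and let $G$ be the group of permutations of $V(\Gamma)$ obtained by restricting to $V(\Gamma)$ the setwise stabilizer of $V(\Gamma)$ in $\bar{G}$. A graph is half-arc-transitive if its automorphism group acts transitively on its vertices and on its edges, but not on its arcs (ordered pairs of adjacent vertices). Then $\Gamma$ is half-arc-transitive if and only if $2(r^{2s}+1) \neq 0$ and $2(r^{2s}-1) \neq 0$ in $\mathbb{Z}_n$. Moreover, in this case $\mathrm{Aut}(\Gamma) = G$, and the stabilizer in $\mathrm{Aut}(\Gamma)$ of each vertex of $\Gamma$ is isomorphic to the elementary abelian $2$-group $\mathbb{Z}_2^s$. -/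

import Mathlib

/-- A graph is half-arc-transitive if its full automorphism group acts transitively on the
vertices and on the edges, but not on the arcs (ordered pairs of adjacent vertices). -/
def SimpleGraph.IsHalfArcTransitive {V : Type*} (Γ : SimpleGraph V) : Prop :=
  (∀ u v : V, ∃ φ : Γ ≃g Γ, φ u = v) ∧
  (∀ e ∈ Γ.edgeSet, ∀ f ∈ Γ.edgeSet, ∃ φ : Γ ≃g Γ, Sym2.map φ e = f) ∧
  ¬ (∀ u v u' v' : V, Γ.Adj u v → Γ.Adj u' v' → ∃ φ : Γ ≃g Γ, φ u = u' ∧ φ v = v')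

namespace CPM

/-- The vertices `⟨i; v⟩` with `i ∈ ℤ_{ms}` and `v = (v_0, …, v_{s-1}) ∈ ℤ_n^s`.
The coordinates of `v` are indexed by the residues `0, …, s-1` modulo `s`. -/
abbrev Vert (m s n : ℕ) : Type := ZMod (m * s) × (ZMod s → ZMod n)

/-- The vector `r^i e_ℓ`, where `ℓ` is `i mod s` and the exponent is the representative of `i`
in `{0, …, ms-1}`. -/
def step (m s n : ℕ) (r : (ZMod n)ˣ) (i : ZMod (m * s)) : ZMod s → ZMod n :=
  Pi.single (i.val : ZMod s) ((r : ZMod n) ^ i.val)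

/-- The whole graph: `⟨i; v⟩ ∼ ⟨i + 1; v ± r^i e_ℓ⟩` with `ℓ = i mod s`. -/
def fullGraph (m s n : ℕ) (r : (ZMod n)ˣ) : SimpleGraph (Vert m s n) :=
  SimpleGraph.fromRel fun x y =>
    y.1 = x.1 + 1 ∧ (y.2 = x.2 + step m s n r x.1 ∨ y.2 = x.2 - step m s n r x.1)

/-- The vertex set of `CPM(m,s,n;r)`: the component of the whole graph containing `⟨0; 0⟩`. -/
def vertexSet (m s n : ℕ) (r : (ZMod n)ˣ) : Set (Vert m s n) :=
  ((fullGraph m s n r).connectedComponentMk (0, 0)).supp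

/-- The graph `CPM(m,s,n;r)`. -/
def graph (m s n : ℕ) (r : (ZMod n)ˣ) : SimpleGraph (vertexSet m s n r) :=
  (fullGraph m s n r).induce (vertexSet m s n r)

/-- `⟨i; v⟩ ↦ ⟨i + 1; (r v_{s-1}, r v_0, …, r v_{s-2})⟩`. -/
def sigma (m s n : ℕ) (r : (ZMod n)ˣ) : Equiv.Perm (Vert m s n) where
  toFun x := (x.1 + 1, fun j => (r : ZMod n) * x.2 (j - 1))
  invFun x := (x.1 - 1, fun j => ((r⁻¹ : (ZMod n)ˣ) : ZMod n) * x.2 (j + 1))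
  left_inv x := by ext <;> simp
  right_inv x := by ext <;> simp

/-- `⟨i; v⟩ ↦ ⟨i; v + e_0⟩`. -/
def rho (m s n : ℕ) : Equiv.Perm (Vert m s n) where
  toFun x := (x.1, x.2 + Pi.single 0 1)
  invFun x := (x.1, x.2 - Pi.single 0 1)
  left_inv x := by simp
  right_inv x := by simp

/-- `⟨i; v⟩ ↦ ⟨i; (-v_0, v_1, …, v_{s-1})⟩`. -/
def tau (m s n : ℕ) : Equiv.Perm (Vert m s n) where
  toFun x := (x.1, Function.update x.2 0 (-x.2 0))
  invFun x := (x.1, Function.update x.2 0 (-x.2 0))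
  left_inv x := by simp
  right_inv x := by simp

/-- The permutation group generated by `sigma`, `rho` and `tau` on the vertices of the
whole graph. -/
def fullGroup (m s n : ℕ) (r : (ZMod n)ˣ) : Subgroup (Equiv.Perm (Vert m s n)) :=
  Subgroup.closure {sigma m s n r, rho m s n, tau m s n}

open scoped Pointwise in
/-- The permutation group induced on the vertex set of `CPM(m,s,n;r)` by its setwise stabilizer
in `fullGroup`. -/
def group (m s n : ℕ) (r : (ZMod n)ˣ) : Subgroup (Equiv.Perm (vertexSet m s n r)) where
  carrier := {π | ∃ g ∈ fullGroup m s n r, g • vertexSet m s n r = vertexSet m s n r ∧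
    ∀ x : vertexSet m s n r, (π x : Vert m s n) = g x}
  mul_mem' := by
    rintro π π' ⟨g, hg, hs, h⟩ ⟨g', hg', hs', h'⟩
    exact ⟨g * g', mul_mem hg hg', by rw [mul_smul, hs', hs], fun x => by simp [h, h']⟩
  one_mem' := ⟨1, one_mem _, one_smul _ _, fun x => rfl⟩
  inv_mem' := by
    rintro π ⟨g, hg, hs, h⟩
    refine ⟨g⁻¹, inv_mem hg, by rw [inv_smul_eq_iff, hs], fun x => ?_⟩
    rw [Equiv.Perm.eq_inv_iff_eq, ← h]
    simp

end CPM

/-!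
Call the level of `⟨i; v⟩` the residue `i`, and orient every edge so that it raises the level by
one. Every vertex then has two out-neighbours and two in-neighbours, and the three generating
permutations preserve the orientation. Together they produce all translations and all sign changes
of the coordinates, so the group they generate is transitive on vertices and on oriented edges
(`fullGroup_arc_transitive`). The component `Γ` is therefore vertex- and edge-transitive, and the
question is which automorphisms it has beyond these.

If `2 r^{2s} = ±2`, then `r^{2s} = ε + a` with a sign `ε` and `2 a = 0`. The map
`⟨i; v⟩ ↦ ⟨-i; w⟩` with `w_{-ℓ-1} = r^{-2ℓ-1} v_ℓ`, corrected by multiples of `a` that depend on the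
level, reverses the orientation (`fwd_reverse`), so `Γ` is arc-transitive.

In the other case there are two steps.

* No automorphism sends the two arcs out of a vertex to a directed path (`noMixing`). Call such a
  pair of arcs a fork. Closed walks without backtracking of length `8` tell forks and directed paths
  apart: the commutator walks pass through every upward extension of a fork, whereas the possible
  directions and signs of a closed walk that begins with three steps up are so restricted
  (`relation_of_up_up_up`) that some upward extension of a directed path lies on no such walk. The
  exceptions have `s = 2`. They are the congruences `4 r^2 = ±2` and `2 r^2 = ±4`, under which
  alternating paths lie on closed walks of length `8` as well, and relations
  `±1 ± r^2 ± r^4 (± r^6) = 0` for `m = 3` and `m = 4`, which come from directed closed walks around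
  the cycle of levels. For `m = 3` forks and directed paths are told apart by walks of length `6`.
  For `m = 4` an automorphism that maps a fork to a directed path would map a whole closed
  alternating path to a directed one, whose signs satisfy a recursion that is incompatible with its
  being closed (`noMixing_of_four`).
* Hence every automorphism keeps or reverses all arcs of a component. Along a directed path of
  length `s` every coordinate is used once, and moving the path by `2 r^L e_ℓ` at its start moves
  its end by the same vector, which is a multiple of `2 r^{L+s} e_ℓ`. Comparing the signs with which
  an automorphism changes the steps at both ends shows that reversal forces `2 r^{2s} = ±2`
  (`MapsSteps.torsion_of_neg`), and that an orientation-preserving automorphism changes all steps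
  in the direction of one coordinate by the same sign (`MapsSteps.exists_followsSigns`). So the
  stabilizer of a vertex consists of the `2^s` sign changes relative to it
  (`exists_signs_of_fixed`), and these belong to the given group.
-/

namespace CPM

variable {m s n : ℕ} {r : (ZMod n)ˣ}

/-! ### Integer levels -/

/-- The vector `r^L e_ℓ` with `ℓ = L mod s`, for an arbitrary integer level `L`. -/
def E (s n : ℕ) (r : (ZMod n)ˣ) (L : ℤ) : ZMod s → ZMod n :=
  Pi.single (L : ZMod s) ((r ^ L : (ZMod n)ˣ) : ZMod n)

/-- The vertex `⟨L; v⟩` for an integer representative `L` of its level. -/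
abbrev pt (m s : ℕ) {n : ℕ} (L : ℤ) (v : ZMod s → ZMod n) : Vert m s n :=
  ((L : ZMod (m * s)), v)

/-- `Fwd x y` says that `(x, y)` is an arc that raises the level by one. -/
def Fwd (m s n : ℕ) (r : (ZMod n)ˣ) (x y : Vert m s n) : Prop :=
  y.1 = x.1 + 1 ∧ (y.2 = x.2 + step m s n r x.1 ∨ y.2 = x.2 - step m s n r x.1)

/-- The coordinate `ℓ` of `E`, up to the power of `r` belonging to a level over `ℓ`:
it is `r^k` if `s ∣ k` and `0` otherwise. -/
def e (s n : ℕ) (r : (ZMod n)ˣ) (k : ℤ) : ZMod n :=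
  if (s : ℤ) ∣ k then ((r ^ k : (ZMod n)ˣ) : ZMod n) else 0


theorem E_apply (M N : ℤ) :
    E s n r M (N : ZMod s) = ((r ^ N : (ZMod n)ˣ) : ZMod n) * e s n r (M - N) := by
  have key : ((N : ZMod s) = (M : ZMod s)) ↔ (s : ℤ) ∣ M - N :=
    ZMod.intCast_eq_intCast_iff_dvd_sub N M s
  unfold E e
  by_cases h : (s : ℤ) ∣ M - N
  · rw [if_pos h, ← Units.val_mul, ← zpow_add, key.2 h, Pi.single_eq_same]
    congr 2; ring
  · rw [if_neg h, mul_zero, Pi.single_eq_of_ne]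
    exact fun h' => h (key.1 h')

theorem E_apply_self (M : ℤ) :
    E s n r M (M : ZMod s) = ((r ^ M : (ZMod n)ˣ) : ZMod n) := by
  simp [E]

theorem E_apply_of_ne {M : ℤ} {l : ZMod s} (h : l ≠ (M : ZMod s)) : E s n r M l = 0 := by
  simp [E, h]

/-- The levels are cyclic of order `m s`, and `r^{m s} = ±1`: another representative of a level
multiplies the powers of `r` by a sign. -/
theorem unit_zpow_period (hr : (r : ZMod n) ^ (m * s) = 1 ∨ (r : ZMod n) ^ (m * s) = -1) (k : ℤ) :
    ∃ a : ℤˣ, ∀ z : ZMod n, ((r ^ ((m * s : ℕ) * k : ℤ) : (ZMod n)ˣ) : ZMod n) * z = a • z := by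
  have hr' : r ^ (m * s) = 1 ∨ r ^ (m * s) = -1 := by
    rcases hr with h | h
    · left; ext; simpa using h
    · right; ext; simpa using h
  rw [zpow_mul, zpow_natCast]
  rcases hr' with h | h <;> rw [h]
  · exact ⟨1, by simp⟩
  · rcases Int.even_or_odd k with hk | hk
    · exact ⟨1, by simp [hk.neg_one_zpow]⟩
    · exact ⟨-1, by simp [hk.neg_one_zpow]⟩

/-- Representatives of the same level give the same vector up to sign. -/
theorem E_congr (hr : (r : ZMod n) ^ (m * s) = 1 ∨ (r : ZMod n) ^ (m * s) = -1) {L M : ℤ}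
    (h : (L : ZMod (m * s)) = (M : ZMod (m * s))) : ∃ a : ℤˣ, E s n r L = a • E s n r M := by
  rw [eq_comm, ZMod.intCast_eq_intCast_iff_dvd_sub] at h
  obtain ⟨k, hk⟩ := h
  obtain rfl : L = M + (m * s : ℕ) * k := by omega
  obtain ⟨a, ha⟩ := unit_zpow_period hr k
  refine ⟨a, ?_⟩
  unfold E
  rw [← Pi.single_smul, zpow_add, Units.val_mul, mul_comm ((r ^ M : (ZMod n)ˣ) : ZMod n), ha]
  congr 1
  push_cast
  simp

theorem step_eq (i : ZMod (m * s)) : step m s n r i = E s n r (i.val : ℤ) := by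
  rw [step, E, zpow_natCast, Units.val_pow_eq_pow_val, Int.cast_natCast]

theorem eq_add_or_sub_iff {A : Type*} [AddCommGroup A] (x y z : A) :
    (y = x + z ∨ y = x - z) ↔ ∃ a : ℤˣ, y = x + a • z := by
  constructor
  · rintro (h | h)
    · exact ⟨1, by simpa using h⟩
    · exact ⟨-1, by simpa [sub_eq_add_neg] using h⟩
  · rintro ⟨a, h⟩
    rcases Int.units_eq_one_or a with rfl | rfl
    · left; simpa using h
    · right; simpa [sub_eq_add_neg] using h

theorem step_cast [NeZero (m * s)]
    (hr : (r : ZMod n) ^ (m * s) = 1 ∨ (r : ZMod n) ^ (m * s) = -1) (L : ℤ) :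
    ∃ a : ℤˣ, step m s n r (L : ZMod (m * s)) = a • E s n r L := by
  rw [step_eq]
  apply E_congr hr
  simp

/-- The arcs out of `⟨L; v⟩` for an integer `L`; the sign absorbs the choice of the
representative. -/
theorem fwd_pt_iff [NeZero (m * s)]
    (hr : (r : ZMod n) ^ (m * s) = 1 ∨ (r : ZMod n) ^ (m * s) = -1) {L : ℤ}
    {v : ZMod s → ZMod n} {y : Vert m s n} :
    Fwd m s n r (pt m s L v) y ↔ ∃ a : ℤˣ, y = pt m s (L + 1) (v + a • E s n r L) := by
  obtain ⟨b, hb⟩ := step_cast (s := s) hr L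
  unfold Fwd
  rw [eq_add_or_sub_iff, hb]
  constructor
  · rintro ⟨h1, a, h2⟩
    exact ⟨a * b, Prod.ext (by simpa using h1) (by simpa [mul_smul] using h2)⟩
  · rintro ⟨a, rfl⟩
    exact ⟨by simp, a * b, by simp [smul_smul, mul_assoc]⟩

theorem fwd_pt_iff' [NeZero (m * s)]
    (hr : (r : ZMod n) ^ (m * s) = 1 ∨ (r : ZMod n) ^ (m * s) = -1) {L : ℤ}
    {v : ZMod s → ZMod n} {y : Vert m s n} :
    Fwd m s n r y (pt m s L v) ↔
      ∃ a : ℤˣ, y = pt m s (L - 1) (v + a • E s n r (L - 1)) := by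
  constructor
  · intro h
    have hy : y = pt m s (L - 1) y.2 := by
      refine Prod.ext ?_ rfl
      have := h.1
      simp only at this ⊢
      push_cast
      rw [this]; ring
    rw [hy, fwd_pt_iff hr] at h
    obtain ⟨a, ha⟩ := h
    refine ⟨-a, ?_⟩
    rw [hy]
    have h2 := congrArg Prod.snd ha
    simp only at h2
    rw [h2]
    simp
  · rintro ⟨a, rfl⟩
    rw [fwd_pt_iff hr]
    exact ⟨-a, by simp⟩

theorem exists_pt [NeZero (m * s)] (x : Vert m s n) : ∃ L v, x = pt m s L v :=
  ⟨x.1.val, x.2, by simp [pt]⟩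

theorem fwd_asymm (h3 : 3 ≤ m * s) {x y : Vert m s n} (h : Fwd m s n r x y) :
    ¬ Fwd m s n r y x := by
  intro h'
  have h1 := h.1
  rw [h'.1] at h1
  have h2 : ((2 : ℕ) : ZMod (m * s)) = 0 := by
    push_cast
    linear_combination -h1
  rw [ZMod.natCast_eq_zero_iff] at h2
  exact absurd (Nat.le_of_dvd (by norm_num) h2) (by omega)

theorem fwd_ne (h2 : 2 ≤ m * s) {x y : Vert m s n} (h : Fwd m s n r x y) : x ≠ y := by
  rintro rfl
  have h1 := h.1
  have h2 : ((1 : ℕ) : ZMod (m * s)) = 0 := by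
    push_cast
    linear_combination -h1
  rw [ZMod.natCast_eq_zero_iff] at h2
  exact absurd (Nat.le_of_dvd (by norm_num) h2) (by omega)

theorem adj_iff (h2 : 2 ≤ m * s) {x y : Vert m s n} :
    (fullGraph m s n r).Adj x y ↔ Fwd m s n r x y ∨ Fwd m s n r y x := by
  unfold fullGraph
  rw [SimpleGraph.fromRel_adj]
  constructor
  · exact fun h => h.2
  · intro h
    refine ⟨?_, h⟩
    rcases h with h | h
    · exact fwd_ne h2 h
    · exact (fwd_ne h2 h).symm

theorem two_ne_zero' (hn : 3 ≤ n) : (2 : ZMod n) ≠ 0 := by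
  intro h
  have : ((2 : ℕ) : ZMod n) = 0 := by exact_mod_cast h
  rw [ZMod.natCast_eq_zero_iff] at this
  exact absurd (Nat.le_of_dvd (by norm_num) this) (by omega)

/-- A sign is determined by its effect on `E`. -/
theorem smul_E_inj (hn : 3 ≤ n) {a b : ℤˣ} {L : ℤ} (h : a • E s n r L = b • E s n r L) : a = b := by
  have h1 := congrFun h (L : ZMod s)
  simp only [Pi.smul_apply, E_apply_self] at h1
  have h2 := two_ne_zero' hn
  rcases Int.units_eq_one_or a with rfl | rfl <;> rcases Int.units_eq_one_or b with rfl | rfl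
  · rfl
  · exfalso
    apply h2
    rw [one_smul, Units.smul_def] at h1
    have : (2 : ZMod n) * ((r ^ L : (ZMod n)ˣ) : ZMod n) = 0 := by
      simp at h1
      linear_combination h1
    simpa using this
  · exfalso
    apply h2
    rw [one_smul, Units.smul_def] at h1
    have : (2 : ZMod n) * ((r ^ L : (ZMod n)ˣ) : ZMod n) = 0 := by
      simp at h1
      linear_combination -h1
    simpa using this
  · rfl

theorem pt_smul_inj (hn : 3 ≤ n) {a b : ℤˣ} {L M M' : ℤ} {v : ZMod s → ZMod n}
    (h : pt m s M (v + a • E s n r L) = pt m s M' (v + b • E s n r L)) : a = b :=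
  smul_E_inj hn (add_left_cancel (congrArg Prod.snd h))

/-- A vertex has only two out-neighbours. -/
theorem fwd_out_cases [NeZero (m * s)]
    (hr : (r : ZMod n) ^ (m * s) = 1 ∨ (r : ZMod n) ^ (m * s) = -1) {x y y' z : Vert m s n}
    (h : Fwd m s n r x y) (h' : Fwd m s n r x y') (hz : Fwd m s n r x z) (hne : y ≠ y') :
    z = y ∨ z = y' := by
  obtain ⟨L, v, rfl⟩ := exists_pt x
  rw [fwd_pt_iff hr] at h h' hz
  obtain ⟨a, rfl⟩ := h
  obtain ⟨b, rfl⟩ := h'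
  obtain ⟨c, rfl⟩ := hz
  rcases Int.units_eq_one_or a with rfl | rfl <;> rcases Int.units_eq_one_or b with rfl | rfl <;>
    rcases Int.units_eq_one_or c with rfl | rfl <;> first | exact absurd rfl hne | simp

theorem fwd_in_cases [NeZero (m * s)]
    (hr : (r : ZMod n) ^ (m * s) = 1 ∨ (r : ZMod n) ^ (m * s) = -1) {x y y' z : Vert m s n}
    (h : Fwd m s n r y x) (h' : Fwd m s n r y' x) (hz : Fwd m s n r z x) (hne : y ≠ y') :
    z = y ∨ z = y' := by
  obtain ⟨L, v, rfl⟩ := exists_pt x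
  rw [fwd_pt_iff' hr] at h h' hz
  obtain ⟨a, rfl⟩ := h
  obtain ⟨b, rfl⟩ := h'
  obtain ⟨c, rfl⟩ := hz
  rcases Int.units_eq_one_or a with rfl | rfl <;> rcases Int.units_eq_one_or b with rfl | rfl <;>
    rcases Int.units_eq_one_or c with rfl | rfl <;> first | exact absurd rfl hne | simp

theorem exists_out [NeZero (m * s)] (hn : 3 ≤ n)
    (hr : (r : ZMod n) ^ (m * s) = 1 ∨ (r : ZMod n) ^ (m * s) = -1) (x : Vert m s n) :
    ∃ y y', y ≠ y' ∧ Fwd m s n r x y ∧ Fwd m s n r x y' := by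
  obtain ⟨L, v, rfl⟩ := exists_pt x
  refine ⟨_, _, ?_, (fwd_pt_iff hr).2 ⟨1, rfl⟩, (fwd_pt_iff hr).2 ⟨-1, rfl⟩⟩
  intro h
  exact absurd (pt_smul_inj hn h) (by decide)

/-! ### The group generated by `sigma`, `rho` and `tau` -/

/-- The translation `⟨i; v⟩ ↦ ⟨i; v + t⟩`. -/
def transl (m s n : ℕ) (t : ZMod s → ZMod n) : Equiv.Perm (Vert m s n) where
  toFun x := (x.1, x.2 + t)
  invFun x := (x.1, x.2 - t)
  left_inv x := by simp
  right_inv x := by simp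

/-- The sign change `⟨i; v⟩ ↦ ⟨i; (η_ℓ v_ℓ)_ℓ⟩`. -/
def signs (m s n : ℕ) (η : ZMod s → ℤˣ) : Equiv.Perm (Vert m s n) where
  toFun x := (x.1, fun l => η l • x.2 l)
  invFun x := (x.1, fun l => η l • x.2 l)
  left_inv x := by ext <;> simp [smul_smul]
  right_inv x := by ext <;> simp [smul_smul]

theorem transl_apply (t : ZMod s → ZMod n) (x : Vert m s n) :
    transl m s n t x = (x.1, x.2 + t) := rfl

theorem signs_apply (η : ZMod s → ℤˣ) (x : Vert m s n) :
    signs m s n η x = (x.1, fun l => η l • x.2 l) := rfl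

theorem sigma_apply (x : Vert m s n) :
    sigma m s n r x = (x.1 + 1, fun j => (r : ZMod n) * x.2 (j - 1)) := rfl

theorem rho_apply (x : Vert m s n) : rho m s n x = (x.1, x.2 + Pi.single 0 1) := rfl

theorem tau_apply (x : Vert m s n) : tau m s n x = (x.1, Function.update x.2 0 (-x.2 0)) := rfl

theorem sigma_mem : sigma m s n r ∈ fullGroup m s n r :=
  Subgroup.subset_closure (by simp)

theorem rho_mem : rho m s n ∈ fullGroup m s n r :=
  Subgroup.subset_closure (by simp)

theorem tau_mem : tau m s n ∈ fullGroup m s n r :=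
  Subgroup.subset_closure (by simp)

theorem transl_single_zero_mem (k : ℤ) :
    transl m s n (Pi.single 0 (k : ZMod n)) ∈ fullGroup m s n r := by
  have h : transl m s n (Pi.single 0 (k : ZMod n)) = rho m s n ^ k := by
    induction k using Int.induction_on with
    | zero => ext x <;> simp [transl_apply]
    | succ i ih =>
      rw [zpow_add, zpow_one, ← ih]
      ext x j
      · simp [transl_apply, rho_apply]
      · simp only [Equiv.Perm.mul_apply, transl_apply, rho_apply, Pi.add_apply, Int.cast_add,
          Int.cast_one, Pi.single_add]
        ring
    | pred i ih =>
      rw [zpow_sub, zpow_one, ← ih, eq_mul_inv_iff_mul_eq]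
      ext x j
      · simp [transl_apply, rho_apply]
      · simp only [Equiv.Perm.mul_apply, transl_apply, rho_apply, Pi.add_apply, Int.cast_sub,
          Int.cast_one, Pi.single_sub, Pi.sub_apply]
        ring
  rw [h]
  exact zpow_mem rho_mem k

/-- Conjugation with `sigma` turns translations of one coordinate into translations of the next. -/
theorem transl_single_mem (k : ℕ) (z : ZMod n) :
    transl m s n (Pi.single (k : ZMod s) z) ∈ fullGroup m s n r := by
  induction k generalizing z with
  | zero =>
    obtain ⟨k, rfl⟩ := ZMod.intCast_surjective z
    simpa using transl_single_zero_mem (m := m) (s := s) k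
  | succ k ih =>
    have h : transl m s n (Pi.single ((k + 1 : ℕ) : ZMod s) z) =
        sigma m s n r * transl m s n (Pi.single (k : ZMod s) (((r⁻¹ : (ZMod n)ˣ) : ZMod n) * z)) *
          (sigma m s n r)⁻¹ := by
      rw [eq_mul_inv_iff_mul_eq]
      ext x j
      · simp [transl_apply, sigma_apply]
      · simp only [Equiv.Perm.mul_apply, transl_apply, sigma_apply, Pi.add_apply, mul_add]
        congr 1
        by_cases hj : j = k + 1
        · subst hj; simp
        · rw [Pi.single_eq_of_ne (by simpa using hj), Pi.single_eq_of_ne, mul_zero]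
          intro h
          exact hj (by rw [← h]; ring)
    rw [h]
    exact mul_mem (mul_mem sigma_mem (ih _)) (inv_mem sigma_mem)

theorem transl_mem [NeZero s] (t : ZMod s → ZMod n) :
    transl m s n t ∈ fullGroup m s n r := by
  rw [← Finset.univ_sum_single t]
  refine Finset.sum_induction _ (fun t => transl m s n t ∈ fullGroup m s n r) ?_ ?_ ?_
  · intro a b ha hb
    have : transl m s n (a + b) = transl m s n b * transl m s n a := by
      ext x <;> simp [transl_apply, add_assoc]
    rw [this]
    exact mul_mem hb ha
  · have : transl m s n 0 = 1 := by
      ext x <;> simp [transl_apply]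
    rw [this]
    exact one_mem _
  · intro l _
    have := transl_single_mem (m := m) (s := s) (r := r) l.val (t l)
    simpa using this

theorem signs_mulSingle_mem (k : ℕ) :
    signs m s n (Pi.mulSingle (k : ZMod s) (-1)) ∈ fullGroup m s n r := by
  induction k with
  | zero =>
    have h : signs m s n (Pi.mulSingle ((0 : ℕ) : ZMod s) (-1)) = tau m s n := by
      ext x j
      · simp [signs_apply, tau_apply]
      · simp only [signs_apply, tau_apply, Nat.cast_zero]
        by_cases hj : j = 0
        · subst hj; simp
        · simp [hj]
    rw [h]
    exact tau_mem
  | succ k ih =>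
    have h : signs m s n (Pi.mulSingle ((k + 1 : ℕ) : ZMod s) (-1)) =
        sigma m s n r * signs m s n (Pi.mulSingle (k : ZMod s) (-1)) * (sigma m s n r)⁻¹ := by
      rw [eq_mul_inv_iff_mul_eq]
      ext x j
      · simp [signs_apply, sigma_apply]
      · simp only [Equiv.Perm.mul_apply, signs_apply, sigma_apply]
        by_cases hj : j = k + 1
        · subst hj; simp
        · have hj' : j - 1 ≠ k := fun h => hj (by rw [← h]; ring)
          rw [Pi.mulSingle_eq_of_ne (by simpa using hj), Pi.mulSingle_eq_of_ne hj']
          simp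
    rw [h]
    exact mul_mem (mul_mem sigma_mem ih) (inv_mem sigma_mem)

theorem signs_mul (η θ : ZMod s → ℤˣ) :
    signs m s n (η * θ) = signs m s n η * signs m s n θ := by
  ext x <;> simp [signs_apply, mul_smul]

theorem signs_one : signs m s n 1 = 1 := by
  ext x <;> simp [signs_apply]

theorem signs_mem [NeZero s] (η : ZMod s → ℤˣ) : signs m s n η ∈ fullGroup m s n r := by
  rw [← Finset.univ_prod_mulSingle η]
  refine Finset.prod_induction _ (fun η => signs m s n η ∈ fullGroup m s n r) ?_ ?_ ?_
  · intro a b ha hb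
    rw [signs_mul]
    exact mul_mem ha hb
  · rw [signs_one]
    exact one_mem _
  · intro l _
    rcases Int.units_eq_one_or (η l) with h | h <;> rw [h]
    · rw [Pi.mulSingle_one, signs_one]
      exact one_mem _
    · have := signs_mulSingle_mem (m := m) (s := s) (r := r) l.val
      simpa using this

theorem sigma_pow_fst (k : ℕ) (x : Vert m s n) : ((sigma m s n r ^ k) x).1 = x.1 + k := by
  induction k with
  | zero => simp
  | succ k ih =>
    rw [pow_succ', Equiv.Perm.mul_apply, sigma_apply, ih]
    push_cast
    ring

theorem fullGroup_transitive [NeZero s] [NeZero (m * s)] (x y : Vert m s n) :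
    ∃ g ∈ fullGroup m s n r, g x = y := by
  refine ⟨transl m s n (y.2 - ((sigma m s n r ^ (y.1 - x.1).val) x).2) *
    sigma m s n r ^ (y.1 - x.1).val, mul_mem (transl_mem _) (pow_mem sigma_mem _), ?_⟩
  rw [Equiv.Perm.mul_apply, transl_apply]
  refine Prod.ext ?_ (by simp)
  simp only [sigma_pow_fst]
  simp

theorem smul_single (η : ZMod s → ℤˣ) (L : ℤ) :
    (fun l => η l • E s n r L l) = η (L : ZMod s) • E s n r L := by
  ext l
  by_cases h : l = (L : ZMod s)
  · subst h; rfl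
  · simp [E_apply_of_ne h]

/-- The group preserves the orientation of the edges. -/
theorem fwd_of_mem_fullGroup [NeZero (m * s)]
    (hr : (r : ZMod n) ^ (m * s) = 1 ∨ (r : ZMod n) ^ (m * s) = -1)
    {g : Equiv.Perm (Vert m s n)} (hg : g ∈ fullGroup m s n r) :
    ∀ x y, Fwd m s n r (g x) (g y) ↔ Fwd m s n r x y := by
  induction hg using Subgroup.closure_induction with
  | one => simp
  | mul a b _ _ ha hb => exact fun x y => by simp [ha, hb]
  | inv a _ ha => exact fun x y => by rw [← ha]; simp
  | mem g hg =>
    simp only [Set.mem_insert_iff, Set.mem_singleton_iff] at hg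
    intro x y
    obtain ⟨L, v, rfl⟩ := exists_pt x
    rw [fwd_pt_iff hr]
    rcases hg with rfl | rfl | rfl
    · have h1 : sigma m s n r (pt m s L v) = pt m s (L + 1) (sigma m s n r (pt m s L v)).2 :=
        Prod.ext (by simp [sigma_apply]) rfl
      have h2 : ∀ a : ℤˣ, sigma m s n r (pt m s (L + 1) (v + a • E s n r L)) =
          pt m s (L + 1 + 1) ((sigma m s n r (pt m s L v)).2 + a • E s n r (L + 1)) := by
        intro a
        refine Prod.ext (by simp [sigma_apply]) ?_
        ext j
        simp only [sigma_apply, Pi.add_apply, mul_add, Pi.smul_apply]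
        congr 1
        rw [mul_smul_comm]
        congr 1
        by_cases hj : j = ((L + 1 : ℤ) : ZMod s)
        · subst hj
          have : (((L + 1 : ℤ) : ZMod s) - 1) = (L : ZMod s) := by push_cast; ring
          rw [this, E_apply_self, E_apply_self, ← Units.val_mul, zpow_add, zpow_one, mul_comm]
        · rw [E_apply_of_ne hj, E_apply_of_ne, mul_zero]
          intro h
          apply hj
          push_cast
          rw [← h]; ring
      rw [h1, fwd_pt_iff hr]
      exact exists_congr fun a => by rw [← h2, EmbeddingLike.apply_eq_iff_eq]
    · have h1 : rho m s n (pt m s L v) = pt m s L (rho m s n (pt m s L v)).2 := rfl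
      have h2 : ∀ a : ℤˣ, rho m s n (pt m s (L + 1) (v + a • E s n r L)) =
          pt m s (L + 1) ((rho m s n (pt m s L v)).2 + a • E s n r L) := by
        intro a
        refine Prod.ext rfl ?_
        simp only [rho_apply]
        abel
      rw [h1, fwd_pt_iff hr]
      exact exists_congr fun a => by rw [← h2, EmbeddingLike.apply_eq_iff_eq]
    · have h0 : tau m s n = signs m s n (Pi.mulSingle (0 : ZMod s) (-1)) := by
        ext x j
        · simp [signs_apply, tau_apply]
        · simp only [signs_apply, tau_apply]
          by_cases hj : j = 0
          · subst hj; simp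
          · simp [hj]
      generalize (Pi.mulSingle (0 : ZMod s) (-1) : ZMod s → ℤˣ) = η at h0
      rw [h0]
      have h1 : signs m s n η (pt m s L v) = pt m s L (signs m s n η (pt m s L v)).2 := rfl
      have h2 : ∀ a : ℤˣ, signs m s n η (pt m s (L + 1) (v + a • E s n r L)) =
          pt m s (L + 1) ((signs m s n η (pt m s L v)).2 +
            (η (L : ZMod s) * a) • E s n r L) := by
        intro a
        refine Prod.ext rfl ?_
        rw [mul_comm (η _) a, mul_smul, ← smul_single]
        ext j
        simp [signs_apply, smul_comm a]
      rw [h1, fwd_pt_iff hr]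
      constructor
      · rintro ⟨a, ha⟩
        refine ⟨η (L : ZMod s) * a, ?_⟩
        rw [← (signs m s n η).apply_eq_iff_eq, h2, ← mul_assoc, Int.units_mul_self, one_mul, ha]
      · rintro ⟨a, rfl⟩
        exact ⟨_, h2 a⟩

/-- The group is transitive on the arcs that raise the level. -/
theorem fullGroup_arc_transitive [NeZero s] [NeZero (m * s)]
    (hr : (r : ZMod n) ^ (m * s) = 1 ∨ (r : ZMod n) ^ (m * s) = -1)
    {x y x' y' : Vert m s n} (h : Fwd m s n r x y) (h' : Fwd m s n r x' y') :
    ∃ g ∈ fullGroup m s n r, g x = x' ∧ g y = y' := by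
  obtain ⟨g, hg, rfl⟩ := fullGroup_transitive (r := r) x x'
  have h1 := (fwd_of_mem_fullGroup hr hg _ _).2 h
  by_cases hy : g y = y'
  · exact ⟨g, hg, rfl, hy⟩
  -- the point reflection at `g x` interchanges its two out-neighbours
  refine ⟨transl m s n (g x).2 * signs m s n (-1) * transl m s n (-(g x).2) * g,
    mul_mem (mul_mem (mul_mem (transl_mem _) (signs_mem _)) (transl_mem _)) hg, ?_, ?_⟩
  · refine Prod.ext rfl ?_
    ext j
    simp [transl_apply, signs_apply]
  · generalize g x = x' at *
    generalize hgy : g y = z at *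
    obtain ⟨L, v, rfl⟩ := exists_pt x'
    rw [fwd_pt_iff hr] at h1 h'
    obtain ⟨a, rfl⟩ := h1
    obtain ⟨b, rfl⟩ := h'
    have hab : b = -a := by
      rcases Int.units_eq_one_or a with rfl | rfl <;> rcases Int.units_eq_one_or b with rfl | rfl
      · exact absurd rfl hy
      · rfl
      · simp
      · exact absurd rfl hy
    subst hab
    refine Prod.ext (by simp [transl_apply, signs_apply, hgy]) ?_
    ext j
    simp [transl_apply, signs_apply, hgy, add_comm]

/-- An element of the group, as an automorphism of the whole graph. -/
def isoOfMem [NeZero (m * s)] (h2 : 2 ≤ m * s)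
    (hr : (r : ZMod n) ^ (m * s) = 1 ∨ (r : ZMod n) ^ (m * s) = -1)
    {g : Equiv.Perm (Vert m s n)} (hg : g ∈ fullGroup m s n r) :
    fullGraph m s n r ≃g fullGraph m s n r where
  toEquiv := g
  map_rel_iff' := by
    intro x y
    rw [adj_iff h2, adj_iff h2, fwd_of_mem_fullGroup hr hg, fwd_of_mem_fullGroup hr hg]

theorem isoOfMem_apply [NeZero (m * s)] (h2 : 2 ≤ m * s)
    (hr : (r : ZMod n) ^ (m * s) = 1 ∨ (r : ZMod n) ^ (m * s) = -1)
    {g : Equiv.Perm (Vert m s n)} (hg : g ∈ fullGroup m s n r) (x : Vert m s n) :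
    isoOfMem h2 hr hg x = g x := rfl

/-! ### Automorphisms of a component and of the whole graph -/

theorem mem_vertexSet {x : Vert m s n} :
    x ∈ vertexSet m s n r ↔ (fullGraph m s n r).Reachable x (0, 0) := by
  simp [vertexSet, SimpleGraph.ConnectedComponent.eq]

theorem mem_vertexSet_of_adj {x y : Vert m s n} (h : (fullGraph m s n r).Adj x y) :
    x ∈ vertexSet m s n r ↔ y ∈ vertexSet m s n r := by
  rw [mem_vertexSet, mem_vertexSet]
  exact ⟨fun hx => h.symm.reachable.trans hx, fun hx => h.reachable.trans hx⟩

theorem mem_vertexSet_of_iso (Φ : fullGraph m s n r ≃g fullGraph m s n r) {x : Vert m s n}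
    (hx : x ∈ vertexSet m s n r) (hΦ : Φ x ∈ vertexSet m s n r) (y : Vert m s n) :
    Φ y ∈ vertexSet m s n r ↔ y ∈ vertexSet m s n r := by
  rw [mem_vertexSet] at *
  rw [mem_vertexSet]
  constructor
  · intro h
    have := h.trans hΦ.symm
    rw [SimpleGraph.Iso.reachable_iff] at this
    exact this.trans hx
  · intro h
    have := h.trans hx.symm
    rw [← Φ.reachable_iff] at this
    exact this.trans hΦ

/-- Restriction of an automorphism of the whole graph that maps some vertex of the component
into the component. -/
def restrictIso (Φ : fullGraph m s n r ≃g fullGraph m s n r) {x : Vert m s n}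
    (hx : x ∈ vertexSet m s n r) (hΦ : Φ x ∈ vertexSet m s n r) :
    graph m s n r ≃g graph m s n r where
  toEquiv := Φ.toEquiv.subtypeEquiv fun y => (mem_vertexSet_of_iso Φ hx hΦ y).symm
  map_rel_iff' := by
    intro a b
    exact Φ.map_rel_iff

open Classical in
/-- Extension of an automorphism of the component by the identity outside the component. -/
theorem exists_extension (φ : graph m s n r ≃g graph m s n r) :
    ∃ Φ : fullGraph m s n r ≃g fullGraph m s n r,
      ∀ x : vertexSet m s n r, Φ x = φ x := by
  let f : Equiv.Perm (Vert m s n) := Equiv.Perm.ofSubtype φ.toEquiv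
  have hin : ∀ x (hx : x ∈ vertexSet m s n r), f x = φ ⟨x, hx⟩ := fun x hx =>
    Equiv.Perm.ofSubtype_apply_of_mem φ.toEquiv hx
  have hout : ∀ x, x ∉ vertexSet m s n r → f x = x := fun x hx =>
    Equiv.Perm.ofSubtype_apply_of_not_mem φ.toEquiv hx
  refine ⟨⟨f, ?_⟩, fun x => hin x x.2⟩
  intro x y
  by_cases hx : x ∈ vertexSet m s n r <;> by_cases hy : y ∈ vertexSet m s n r
  · rw [hin x hx, hin y hy]
    exact φ.map_rel_iff (a := ⟨x, hx⟩) (b := ⟨y, hy⟩)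
  · rw [hin x hx, hout y hy]
    exact ⟨fun h => absurd ((mem_vertexSet_of_adj h).1 (φ ⟨x, hx⟩).2) hy,
      fun h => absurd ((mem_vertexSet_of_adj h).1 hx) hy⟩
  · rw [hin y hy, hout x hx]
    exact ⟨fun h => absurd ((mem_vertexSet_of_adj h).2 (φ ⟨y, hy⟩).2) hx,
      fun h => absurd ((mem_vertexSet_of_adj h).2 hy) hx⟩
  · rw [hout x hx, hout y hy]

/-! ### Reversing automorphisms -/

/-- An element killed by `2` is fixed by multiplication with units, because units modulo an even
number are odd. -/
theorem mul_unit_of_two_mul_eq_zero [NeZero n] {a : ZMod n} (ha : 2 * a = 0) (z : (ZMod n)ˣ) :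
    a * z = a := by
  rcases Nat.even_or_odd n with hn | hn
  · have hz : Nat.Coprime (z : ZMod n).val n := ZMod.val_coe_unit_coprime z
    have hodd : Odd (z : ZMod n).val := by
      rw [← Nat.not_even_iff_odd]
      intro he
      have := Nat.dvd_gcd he.two_dvd hn.two_dvd
      rw [hz] at this
      omega
    obtain ⟨q, hq⟩ := hodd
    have : (z : ZMod n) = 2 * q + 1 := by
      rw [← ZMod.natCast_zmod_val (z : ZMod n), hq]
      push_cast
      ring
    rw [this]
    linear_combination (q : ZMod n) * ha
  · have h2 : IsUnit (2 : ZMod n) := by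
      have := (ZMod.isUnit_iff_coprime 2 n).2 (Nat.coprime_two_left.2 hn)
      exact_mod_cast this
    have : a = 0 := by
      rcases h2 with ⟨w, hw⟩
      rw [← hw] at ha
      simpa using ha
    simp [this]

/-- If `2 r^{2s} = ±2` then `r^{2s} = ε + a` with a sign `ε` and a number `a` killed by `2`, and
`a` can be taken to be `0` unless `4 ∣ m`. -/
theorem exists_sign_add_torsion [NeZero n]
    (hr : (r : ZMod n) ^ (m * s) = 1 ∨ (r : ZMod n) ^ (m * s) = -1)
    (h : 2 * ((r : ZMod n) ^ (2 * s) + 1) = 0 ∨ 2 * ((r : ZMod n) ^ (2 * s) - 1) = 0) :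
    ∃ (ε : ℤˣ) (a : ZMod n), (r : ZMod n) ^ (2 * s) = ((ε : ℤ) : ZMod n) + a ∧ 2 * a = 0 ∧
      ((r : ZMod n) ^ (2 * s)) ^ 2 = 1 ∧ (4 ∣ m ∨ a = 0) := by
  obtain ⟨ε, a, h1, h2⟩ : ∃ (ε : ℤˣ) (a : ZMod n),
      (r : ZMod n) ^ (2 * s) = ((ε : ℤ) : ZMod n) + a ∧ 2 * a = 0 := by
    rcases h with h | h
    · exact ⟨-1, (r : ZMod n) ^ (2 * s) + 1, by simp, h⟩
    · exact ⟨1, (r : ZMod n) ^ (2 * s) - 1, by simp, h⟩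
  have hε : (((ε : ℤ) : ZMod n)) ^ 2 = 1 := by
    rcases Int.units_eq_one_or ε with rfl | rfl <;> simp
  have haε : a * ((ε : ℤ) : ZMod n) = a := by
    rcases Int.units_eq_one_or ε with rfl | rfl
    · simp
    · simp
      linear_combination -h2
  have hau : a * (r : ZMod n) ^ (2 * s) = a := by
    have := mul_unit_of_two_mul_eq_zero h2 (r ^ (2 * s))
    simpa using this
  have hsq : ((r : ZMod n) ^ (2 * s)) ^ 2 = 1 := by
    rw [h1] at hau ⊢
    linear_combination hau + hε + haε + h2
  have hm2 : ((r : ZMod n) ^ (2 * s)) ^ m = 1 := by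
    have : ((r : ZMod n) ^ (2 * s)) ^ m = ((r : ZMod n) ^ (m * s)) ^ 2 := by
      rw [← pow_mul, ← pow_mul]; congr 1; ring
    rw [this]
    rcases hr with h | h <;> rw [h] <;> simp
  have hmod : m % 4 < 4 := Nat.mod_lt _ (by norm_num)
  have hm : m = 4 * (m / 4) + m % 4 := by omega
  generalize m % 4 = k at hm hmod
  generalize m / 4 = q at hm
  have hodd : ∀ q, m = 2 * q + 1 → (r : ZMod n) ^ (2 * s) = 1 := by
    rintro q hq
    rw [hq, pow_succ, pow_mul, hsq, one_pow, one_mul] at hm2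
    exact hm2
  -- for odd `m` the power `r^{2s}` is `1`, and for `m = 4 q + 2` it equals `r^{m s}`
  interval_cases k
  · exact ⟨ε, a, h1, h2, hsq, Or.inl ⟨q, by omega⟩⟩
  · exact ⟨1, 0, by simpa using hodd (2 * q) (by omega), by simp, hsq, Or.inr rfl⟩
  · have h3 : (r : ZMod n) ^ (m * s) = (r : ZMod n) ^ (2 * s) := by
      have : (r : ZMod n) ^ (m * s) =
          (((r : ZMod n) ^ (2 * s)) ^ 2) ^ q * (r : ZMod n) ^ (2 * s) := by
        rw [← pow_mul, ← pow_mul, ← pow_add, hm]; congr 1; ring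
      rw [this, hsq]; simp
    rw [h3] at hr
    rcases hr with h | h
    · exact ⟨1, 0, by simpa using h, by simp, hsq, Or.inr rfl⟩
    · exact ⟨-1, 0, by simpa using h, by simp, hsq, Or.inr rfl⟩
  · exact ⟨1, 0, by simpa using hodd (2 * q + 1) (by omega), by simp, hsq, Or.inr rfl⟩

/-- The number of levels `i` with `0 ≤ i < L` and `i ≡ ℓ mod s` (counted with sign if `L < 0`). -/
def visits (s : ℕ) (L : ℤ) (l : ZMod s) : ℤ := (L - l.val - 1) / s + 1

/-- The summand that corrects the parity defect of the reversing map: it changes by `a` at every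
second step in the direction of the coordinate `ℓ`. -/
def offset {s n : ℕ} (a : ZMod n) (L : ℤ) (l : ZMod s) : ZMod n :=
  ((visits s L l / 2 : ℤ) : ZMod n) * a

theorem offset_congr [NeZero s] {a : ZMod n} (ha : 2 * a = 0) (hm : 4 ∣ m ∨ a = 0) {L M : ℤ}
    (h : (L : ZMod (m * s)) = (M : ZMod (m * s))) (l : ZMod s) : offset a L l = offset a M l := by
  rcases hm with ⟨q, rfl⟩ | rfl
  · rw [eq_comm, ZMod.intCast_eq_intCast_iff_dvd_sub] at h
    obtain ⟨k, hk⟩ := h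
    obtain rfl : L = M + s * (4 * q * k) := by push_cast at hk; linarith
    have hs : (s : ℤ) ≠ 0 := by exact_mod_cast NeZero.ne s
    have : visits s (M + s * (4 * q * k)) l = visits s M l + 2 * (2 * q * k) := by
      unfold visits
      rw [show M + s * (4 * q * k) - l.val - 1 = (M - l.val - 1) + s * (4 * q * k) by ring,
        Int.add_mul_ediv_left _ _ hs]
      ring
    unfold offset
    rw [this, Int.add_mul_ediv_left _ _ two_ne_zero]
    push_cast
    linear_combination ((q : ZMod n) * k) * ha
  · simp [offset]

theorem visits_succ_of_ne [NeZero s] {L : ℤ} {l : ZMod s} (h : l ≠ (L : ZMod s)) :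
    visits s (L + 1) l = visits s L l := by
  have hs : 0 < (s : ℤ) := by exact_mod_cast Nat.pos_of_ne_zero (NeZero.ne s)
  have h1 : ¬ (s : ℤ) ∣ L - l.val := by
    rw [← ZMod.intCast_eq_intCast_iff_dvd_sub]
    simpa using h
  unfold visits
  congr 1
  rw [show L + 1 - (l.val : ℤ) - 1 = L - l.val by ring]
  generalize L - (l.val : ℤ) = t at *
  have h2 := Int.emod_nonneg t hs.ne'
  have h3 := Int.emod_lt_of_pos t hs
  have h4 : t % s ≠ 0 := fun h0 => h1 (Int.dvd_of_emod_eq_zero h0)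
  have h5 : t - 1 = (t % s - 1) + s * (t / s) := by
    have := Int.emod_add_mul_ediv t s
    linarith
  have h6 : (t % s - 1) / s = 0 := Int.ediv_eq_zero_of_lt (by omega) (by omega)
  rw [h5, Int.add_mul_ediv_left _ _ hs.ne', h6, zero_add]

theorem visits_self [NeZero s] (L : ℤ) : visits s L (L : ZMod s) = L / s := by
  have hs : 0 < (s : ℤ) := by exact_mod_cast Nat.pos_of_ne_zero (NeZero.ne s)
  unfold visits
  rw [ZMod.val_intCast]
  have h5 : L - L % s - 1 = (s - 1) + s * (L / s - 1) := by
    have := Int.emod_add_mul_ediv L s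
    linarith
  rw [h5, Int.add_mul_ediv_left _ _ hs.ne', Int.ediv_eq_zero_of_lt (by omega) (by omega)]
  ring

theorem visits_succ_self [NeZero s] (L : ℤ) : visits s (L + 1) (L : ZMod s) = L / s + 1 := by
  have hs : 0 < (s : ℤ) := by exact_mod_cast Nat.pos_of_ne_zero (NeZero.ne s)
  unfold visits
  rw [ZMod.val_intCast]
  have h5 : L + 1 - L % s - 1 = s * (L / s) := by
    have := Int.emod_add_mul_ediv L s
    linarith
  rw [h5, Int.mul_ediv_cancel_left _ hs.ne']

/-- The coefficient by which the reversing map scales the coordinate `ℓ`. -/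
def revCoeff {n : ℕ} (s : ℕ) (r : (ZMod n)ˣ) (l : ZMod s) : (ZMod n)ˣ :=
  r ^ (-2 * (l.val : ℤ) - 1)

/-- The map `⟨i; v⟩ ↦ ⟨-i; w⟩` with `w_{-ℓ-1} = r^{-2ℓ-1} v_ℓ` up to an offset. -/
def reverse (m s n : ℕ) (r : (ZMod n)ˣ) (a : ZMod n) : Equiv.Perm (Vert m s n) where
  toFun x := (-x.1, fun k => revCoeff s r (-k - 1) * x.2 (-k - 1) + offset a x.1.val (-k - 1))
  invFun x := (-x.1, fun l =>
    ((revCoeff s r l)⁻¹ : (ZMod n)ˣ) * (x.2 (-l - 1) - offset a (-x.1).val l))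
  left_inv x := by
    refine Prod.ext (by simp) ?_
    ext l
    simp
  right_inv x := by
    refine Prod.ext (by simp) ?_
    ext l
    simp

/-- The scaled step differs from the step of the image level by the sign `ε`, up to a change of the
offset at every second passage. -/
theorem revCoeff_mul_zpow [NeZero s] [NeZero n] {ε : ℤˣ} {a : ZMod n}
    (hu : (r : ZMod n) ^ (2 * s) = ((ε : ℤ) : ZMod n) + a) (ha : 2 * a = 0)
    (hu2 : ((r : ZMod n) ^ (2 * s)) ^ 2 = 1) (L : ℤ) (b : ℤˣ) :
    ∃ b' : ℤˣ, (revCoeff s r (L : ZMod s) : ZMod n) * (b • ((r ^ L : (ZMod n)ˣ) : ZMod n)) +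
        offset a (L + 1) (L : ZMod s) =
      offset a L (L : ZMod s) + b' • ((r ^ (-L - 1) : (ZMod n)ˣ) : ZMod n) := by
  have h1 : revCoeff s r (L : ZMod s) * r ^ L = r ^ (-L - 1) * (r ^ (2 * s)) ^ (L / s) := by
    unfold revCoeff
    rw [ZMod.val_intCast, ← zpow_natCast, ← zpow_mul, ← zpow_add, ← zpow_add]
    congr 1
    have := Int.emod_add_mul_ediv L s
    push_cast
    linarith
  have h1' : (revCoeff s r (L : ZMod s) : ZMod n) * ((r ^ L : (ZMod n)ˣ) : ZMod n) =
      ((r ^ (-L - 1) : (ZMod n)ˣ) : ZMod n) *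
        ((((r ^ (2 * s)) ^ (L / s : ℤ) : (ZMod n)ˣ)) : ZMod n) := by
    rw [← Units.val_mul, h1, Units.val_mul]
  have hU2 : (r ^ (2 * s)) ^ (2 : ℤ) = 1 := by
    ext
    rw [show (2 : ℤ) = ((2 : ℕ) : ℤ) by rfl, zpow_natCast]
    simpa using hu2
  have haz := mul_unit_of_two_mul_eq_zero ha (r ^ (-L - 1))
  generalize ((r ^ (-L - 1) : (ZMod n)ˣ) : ZMod n) = z at *
  rw [mul_smul_comm, h1']
  unfold offset
  rw [visits_self, visits_succ_self]
  rcases Int.even_or_odd' (L / s) with ⟨q, hq | hq⟩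
  · rw [hq, zpow_mul, hU2, one_zpow, Units.val_one, mul_one,
      show (2 * q + 1) / 2 = 2 * q / 2 by omega]
    exact ⟨b, add_comm _ _⟩
  · have hU : (r ^ (2 * s)) ^ (2 * q + 1) = r ^ (2 * s) := by
      rw [zpow_add, zpow_mul, hU2, one_zpow, one_mul, zpow_one]
    rw [hq, hU, show (2 * q + 1 + 1) / 2 = (2 * q + 1) / 2 + 1 by omega, Units.val_pow_eq_pow_val,
      hu]
    refine ⟨b * ε, ?_⟩
    have hsm : ∀ (c : ℤˣ) (z : ZMod n), c • z = ((c : ℤ) : ZMod n) * z := fun c z => by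
      rw [Units.smul_def, zsmul_eq_mul]
    rw [hsm, hsm]
    push_cast
    rcases Int.units_eq_one_or b with rfl | rfl
    · push_cast
      linear_combination haz + ha
    · push_cast
      linear_combination -haz

/-- The map `reverse` is well defined on levels and reverses all arcs. -/
theorem fwd_reverse [NeZero (m * s)] [NeZero s] [NeZero n]
    (hr : (r : ZMod n) ^ (m * s) = 1 ∨ (r : ZMod n) ^ (m * s) = -1) {ε : ℤˣ} {a : ZMod n}
    (hu : (r : ZMod n) ^ (2 * s) = ((ε : ℤ) : ZMod n) + a) (ha : 2 * a = 0)
    (hu2 : ((r : ZMod n) ^ (2 * s)) ^ 2 = 1) (hm : 4 ∣ m ∨ a = 0) {x y : Vert m s n}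
    (h : Fwd m s n r x y) : Fwd m s n r (reverse m s n r a y) (reverse m s n r a x) := by
  obtain ⟨L, v, rfl⟩ := exists_pt x
  rw [fwd_pt_iff hr] at h
  obtain ⟨b, rfl⟩ := h
  have hrev : ∀ (L : ℤ) (v : ZMod s → ZMod n), reverse m s n r a (pt m s L v) =
      pt m s (-L) (fun k => (revCoeff s r (-k - 1) : ZMod n) * v (-k - 1) +
        offset a L (-k - 1)) := by
    intro L v
    refine Prod.ext (by simp [reverse]) ?_
    ext k
    simp only [reverse, Equiv.coe_fn_mk]
    rw [offset_congr (m := m) ha hm (M := L)]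
    simp
  rw [hrev, hrev, fwd_pt_iff' hr]
  obtain ⟨b', hb'⟩ := revCoeff_mul_zpow hu ha hu2 L b
  refine ⟨b', ?_⟩
  rw [show -(L + 1) = -L - 1 by ring]
  refine Prod.ext rfl ?_
  ext k
  simp only [Pi.add_apply, Pi.smul_apply, mul_add]
  by_cases hk : k = ((-L - 1 : ℤ) : ZMod s)
  · subst hk
    have : (-((-L - 1 : ℤ) : ZMod s) - 1) = (L : ZMod s) := by push_cast; ring
    rw [this, E_apply_self, E_apply_self]
    linear_combination hb'
  · have hk' : -k - 1 ≠ (L : ZMod s) := by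
      intro h
      apply hk
      push_cast
      rw [← h]; ring
    rw [E_apply_of_ne hk, E_apply_of_ne hk', offset, offset, visits_succ_of_ne hk']
    simp

/-- A bijection that reverses all arcs is an automorphism, because it maps the two arcs out of a
vertex onto the two arcs into its image. -/
def isoOfReversing [NeZero (m * s)] (hn : 3 ≤ n) (h2 : 2 ≤ m * s)
    (hr : (r : ZMod n) ^ (m * s) = 1 ∨ (r : ZMod n) ^ (m * s) = -1)
    (g : Equiv.Perm (Vert m s n))
    (hg : ∀ x y, Fwd m s n r x y → Fwd m s n r (g y) (g x)) :
    fullGraph m s n r ≃g fullGraph m s n r where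
  toEquiv := g
  map_rel_iff' := by
    have key : ∀ x y, Fwd m s n r (g y) (g x) → Fwd m s n r x y := by
      intro x y h
      obtain ⟨z, z', hne, hz, hz'⟩ := exists_out hn hr x
      rcases fwd_in_cases hr (hg _ _ hz) (hg _ _ hz') h (g.injective.ne hne) with h' | h' <;>
        rw [g.injective h'] <;> assumption
    intro x y
    rw [adj_iff h2, adj_iff h2]
    constructor
    · rintro (h | h)
      · exact Or.inr (key _ _ h)
      · exact Or.inl (key _ _ h)
    · rintro (h | h)
      · exact Or.inr (hg _ _ h)
      · exact Or.inl (hg _ _ h)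

/-- If `2 r^{2s} = ±2`, then the component is arc-transitive. -/
theorem arc_transitive_of_torsion [NeZero (m * s)] [NeZero s] (hn : 3 ≤ n) (h2 : 2 ≤ m * s)
    (hr : (r : ZMod n) ^ (m * s) = 1 ∨ (r : ZMod n) ^ (m * s) = -1)
    (h : 2 * ((r : ZMod n) ^ (2 * s) + 1) = 0 ∨ 2 * ((r : ZMod n) ^ (2 * s) - 1) = 0)
    (u v u' v' : vertexSet m s n r) (huv : (graph m s n r).Adj u v)
    (huv' : (graph m s n r).Adj u' v') :
    ∃ φ : graph m s n r ≃g graph m s n r, φ u = u' ∧ φ v = v' := by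
  have : NeZero n := ⟨by omega⟩
  suffices ∃ Φ : fullGraph m s n r ≃g fullGraph m s n r, Φ u = u' ∧ Φ v = v' by
    obtain ⟨Φ, h1, h2⟩ := this
    exact ⟨restrictIso Φ u.2 (by rw [h1]; exact u'.2), Subtype.ext h1, Subtype.ext h2⟩
  obtain ⟨ε, a, hu, ha, hu2, hm⟩ := exists_sign_add_torsion hr h
  let Ψ := isoOfReversing hn h2 hr (reverse m s n r a) fun x y => fwd_reverse hr hu ha hu2 hm
  have hΨ : ∀ x y, Fwd m s n r x y → Fwd m s n r (Ψ y) (Ψ x) := fun x y =>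
    fwd_reverse hr hu ha hu2 hm
  have huv : (fullGraph m s n r).Adj u v := huv
  have huv' : (fullGraph m s n r).Adj u' v' := huv'
  rw [adj_iff h2] at huv huv'
  rcases huv with huv | huv <;> rcases huv' with huv' | huv'
  · obtain ⟨g, hg, h3, h4⟩ := fullGroup_arc_transitive hr huv huv'
    exact ⟨isoOfMem h2 hr hg, h3, h4⟩
  · obtain ⟨g, hg, h3, h4⟩ := fullGroup_arc_transitive hr (hΨ _ _ huv) huv'
    exact ⟨Ψ.trans (isoOfMem h2 hr hg), h4, h3⟩
  · obtain ⟨g, hg, h3, h4⟩ := fullGroup_arc_transitive hr (hΨ _ _ huv) huv'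
    exact ⟨Ψ.trans (isoOfMem h2 hr hg), h3, h4⟩
  · obtain ⟨g, hg, h3, h4⟩ := fullGroup_arc_transitive hr huv huv'
    exact ⟨isoOfMem h2 hr hg, h4, h3⟩

/-! ### Transport of signs along directed paths -/

/-- The end of the directed path of length `j` that starts in `v` at level `L` and whose steps have
the signs `a 0, a 1, …`. -/
def path (r : (ZMod n)ˣ) (L : ℤ) (v : ZMod s → ZMod n) (a : ℕ → ℤˣ) (j : ℕ) : ZMod s → ZMod n :=
  v + ∑ i ∈ Finset.range j, a i • E s n r (L + i)

/-- `f` describes, on the lifted vertices satisfying `C`, the vector part of a map which sends arcs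
between the levels `L` and `L + 1` to edges in the direction of `E (κ * L + c)`. -/
structure MapsSteps (r : (ZMod n)ˣ) (C : ℤ → (ZMod s → ZMod n) → Prop)
    (f : ℤ → (ZMod s → ZMod n) → ZMod s → ZMod n) (κ c : ℤ) : Prop where
  succ : ∀ L v (a : ℤˣ), C L v → C (L + 1) (v + a • E s n r L)
  pred : ∀ L v (a : ℤˣ), C (L + 1) (v + a • E s n r L) → C L v
  step : ∀ L v, C L v → ∃ δ : ℤˣ, ∀ a : ℤˣ,
    f (L + 1) (v + a • E s n r L) = f L v + (a * δ) • E s n r (κ * L + c)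
  inj : ∀ L v, C L v → f L (v + (2 : ℕ) • E s n r L) ≠ f L v

open Classical in
/-- The sign by which the map described by `f` changes the steps that leave `v` at level `L`. -/
noncomputable def sgn (r : (ZMod n)ˣ) (f : ℤ → (ZMod s → ZMod n) → ZMod s → ZMod n)
    (κ c : ℤ) (L : ℤ) (v : ZMod s → ZMod n) : ℤˣ :=
  if f (L + 1) (v + E s n r L) = f L v + E s n r (κ * L + c) then 1 else -1

theorem path_zero (L : ℤ) (v : ZMod s → ZMod n) (a : ℕ → ℤˣ) : path r L v a 0 = v := by
  simp [path]

theorem path_succ (L : ℤ) (v : ZMod s → ZMod n) (a : ℕ → ℤˣ) (j : ℕ) :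
    path r L v a (j + 1) = path r L v a j + a j • E s n r (L + j) := by
  simp [path, Finset.sum_range_succ, add_assoc]

theorem path_add (L : ℤ) (v : ZMod s → ZMod n) (a : ℕ → ℤˣ) (j k : ℕ) :
    path r L v a (j + k) = path r (L + j) (path r L v a j) (fun i => a (j + i)) k := by
  simp [path, Finset.sum_range_add, add_assoc]

theorem path_translate (L : ℤ) (v t : ZMod s → ZMod n) (a : ℕ → ℤˣ) (j : ℕ) :
    path r L (v + t) a j = path r L v a j + t := by
  simp [path, add_right_comm]

theorem E_add_period (L : ℤ) : E s n r (L + s) = ((r : ZMod n) ^ s) • E s n r L := by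
  unfold E
  rw [← Pi.single_smul, zpow_add, Units.val_mul, smul_eq_mul, mul_comm, zpow_natCast,
    Units.val_pow_eq_pow_val]
  simp

theorem nsmul_E_period {k k' : ℕ} (h : (k : ZMod n) = k' * (r : ZMod n) ^ s) (L : ℤ) :
    k • E s n r L = k' • E s n r (L + s) := by
  rw [E_add_period]
  ext l
  simp only [Pi.smul_apply, nsmul_eq_mul, smul_eq_mul]
  rw [h, mul_assoc]

theorem e_of_dvd {k : ℤ} (h : (s : ℤ) ∣ k) : e s n r k = ((r ^ k : (ZMod n)ˣ) : ZMod n) := if_pos h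

theorem e_of_not_dvd {k : ℤ} (h : ¬ (s : ℤ) ∣ k) : e s n r k = 0 := if_neg h

theorem units_smul_eq (c : ℤˣ) (z : ZMod n) : c • z = ((c : ℤ) : ZMod n) * z := by
  rw [Units.smul_def, zsmul_eq_mul]

variable {C : ℤ → (ZMod s → ZMod n) → Prop} {f : ℤ → (ZMod s → ZMod n) → ZMod s → ZMod n} {κ c : ℤ}

namespace MapsSteps

theorem step_sgn (hn : 3 ≤ n) (h : MapsSteps r C f κ c) {L : ℤ} {v : ZMod s → ZMod n} (hC : C L v)
    (a : ℤˣ) : f (L + 1) (v + a • E s n r L) =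
      f L v + (a * sgn r f κ c L v) • E s n r (κ * L + c) := by
  obtain ⟨δ, hδ⟩ := h.step L v hC
  rw [hδ]
  congr 3
  have h1 := hδ 1
  rw [one_smul, one_mul] at h1
  unfold sgn
  split_ifs with hif
  · rw [h1] at hif
    apply smul_E_inj hn (r := r) (L := κ * L + c)
    rw [one_smul]
    exact add_left_cancel hif
  · rcases Int.units_eq_one_or δ with rfl | rfl
    · exact absurd (by simpa using h1) hif
    · rfl

theorem mem_of_add_two (h : MapsSteps r C f κ c) {L : ℤ} {v : ZMod s → ZMod n} (hC : C L v) :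
    C L (v + (2 : ℕ) • E s n r L) := by
  apply h.pred L _ (-1)
  have := h.succ L v 1 hC
  convert this using 1
  rw [two_nsmul, Units.neg_smul, one_smul]
  abel

theorem sgn_add_two (hn : 3 ≤ n) (h : MapsSteps r C f κ c) {L : ℤ} {v : ZMod s → ZMod n}
    (hC : C L v) : sgn r f κ c L (v + (2 : ℕ) • E s n r L) = sgn r f κ c L v ∧
      f L (v + (2 : ℕ) • E s n r L) = f L v + (2 : ℕ) • sgn r f κ c L v • E s n r (κ * L + c) := by
  have h1 := h.step_sgn hn hC 1
  have h2 := h.step_sgn hn (h.mem_of_add_two hC) (-1)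
  have h3 : v + (2 : ℕ) • E s n r L + (-1 : ℤˣ) • E s n r L = v + (1 : ℤˣ) • E s n r L := by
    rw [two_nsmul, Units.neg_smul, one_smul]
    abel
  rw [h3, h1] at h2
  have hinj := h.inj L v hC
  generalize sgn r f κ c L (v + (2 : ℕ) • E s n r L) = δ' at *
  generalize sgn r f κ c L v = δ at *
  have key : f L (v + (2 : ℕ) • E s n r L) =
      f L v + (δ • E s n r (κ * L + c) + δ' • E s n r (κ * L + c)) := by
    rw [one_mul, neg_one_mul, Units.neg_smul] at h2
    rw [← add_assoc, h2]
    abel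
  have hδ : δ' = δ := by
    rcases Int.units_eq_one_or δ with rfl | rfl <;> rcases Int.units_eq_one_or δ' with rfl | rfl
    · rfl
    · exact absurd (by rw [key]; simp) hinj
    · exact absurd (by rw [key]; simp) hinj
    · rfl
  refine ⟨hδ, ?_⟩
  rw [key, hδ, two_nsmul]

theorem sgn_add_two_mul (hn : 3 ≤ n) (h : MapsSteps r C f κ c) {L : ℤ} {v : ZMod s → ZMod n}
    (hC : C L v) (k : ℕ) : C L (v + (2 * k) • E s n r L) ∧
      sgn r f κ c L (v + (2 * k) • E s n r L) = sgn r f κ c L v ∧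
      f L (v + (2 * k) • E s n r L) =
        f L v + (2 * k) • sgn r f κ c L v • E s n r (κ * L + c) := by
  induction k with
  | zero => simpa using hC
  | succ k ih =>
    obtain ⟨h1, h2, h3⟩ := ih
    have h4 := h.sgn_add_two hn h1
    have h5 := h.mem_of_add_two h1
    rw [mul_add, mul_one, add_nsmul, ← add_assoc, add_nsmul, ← add_assoc, ← h3, ← h2]
    exact ⟨h5, h4⟩

theorem map_path (hn : 3 ≤ n) (h : MapsSteps r C f κ c) {L : ℤ} {v : ZMod s → ZMod n} (hC : C L v)
    (a : ℕ → ℤˣ) (j : ℕ) : C (L + j) (path r L v a j) ∧ f (L + j) (path r L v a j) =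
      f L v + ∑ i ∈ Finset.range j,
        (a i * sgn r f κ c (L + i) (path r L v a i)) • E s n r (κ * (L + i) + c) := by
  induction j with
  | zero => simpa [path_zero] using hC
  | succ j ih =>
    rw [Finset.sum_range_succ, ← add_assoc, ← ih.2, path_succ, Nat.cast_succ, ← add_assoc]
    exact ⟨h.succ _ _ _ ih.1, h.step_sgn hn ih.1 _⟩

theorem e_kappa_mul (hκ : κ = 1 ∨ κ = -1) {i : ℤ} (h0 : i ≠ 0) (hi : |i| < s) :
    e s n r (κ * i) = 0 := by
  apply e_of_not_dvd
  intro hd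
  have : (s : ℤ) ∣ i := by
    rcases hκ with rfl | rfl
    · simpa using hd
    · simpa using hd
  exact h0 (Int.eq_zero_of_abs_lt_dvd this hi)

/-- Only the first step of a directed path of length `s` changes the first coordinate. -/
theorem map_path_coord (hs : 1 ≤ s) (hn : 3 ≤ n) (hκ : κ = 1 ∨ κ = -1) (h : MapsSteps r C f κ c)
    {L : ℤ} {v : ZMod s → ZMod n} (hC : C L v) (a : ℕ → ℤˣ) :
    f (L + s) (path r L v a s) ((κ * L + c : ℤ) : ZMod s) = f L v ((κ * L + c : ℤ) : ZMod s) +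
      (a 0 * sgn r f κ c L v) • ((r ^ (κ * L + c) : (ZMod n)ˣ) : ZMod n) := by
  rw [(h.map_path hn hC a s).2, Pi.add_apply, Finset.sum_apply]
  congr 1
  rw [Finset.sum_eq_single 0]
  · rw [path_zero, Pi.smul_apply, Nat.cast_zero, add_zero, E_apply_self]
  · intro i hi hi0
    rw [Pi.smul_apply, E_apply, show κ * (L + i) + c - (κ * L + c) = κ * i by ring,
      e_kappa_mul hκ (by exact_mod_cast hi0), mul_zero, smul_zero]
    rw [Finset.mem_range] at hi
    simpa using hi
  · intro h0
    simp at h0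
    omega

/-- The displacement by `2 • E (L + s)` at the end of a directed path of length `s` is a multiple of
the displacement `2 • E L` at its beginning; comparing images relates the two signs. -/
theorem two_mul_sgn (hs : 1 ≤ s) (hn : 3 ≤ n) (hκ : κ = 1 ∨ κ = -1) (h : MapsSteps r C f κ c)
    {L : ℤ} {v : ZMod s → ZMod n} (hC : C L v) (a : ℕ → ℤˣ) :
    2 * (((sgn r f κ c L v : ℤˣ) : ℤ) : ZMod n) * ((r ^ (s : ℤ) : (ZMod n)ˣ) : ZMod n) =
      2 * (((sgn r f κ c (L + s) (path r L v a s) : ℤˣ) : ℤ) : ZMod n) *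
        ((r ^ (κ * s) : (ZMod n)ˣ) : ZMod n) := by
  have : NeZero n := ⟨by omega⟩
  obtain ⟨h1, h2, h3⟩ := h.sgn_add_two_mul hn hC ((r : ZMod n) ^ s).val
  have hE : (2 * ((r : ZMod n) ^ s).val) • E s n r L = 2 • E s n r (L + s) :=
    nsmul_E_period (by push_cast; rw [ZMod.natCast_zmod_val]) L
  have h4 := h.map_path_coord hs hn hκ h1 a
  rw [h2, h3] at h4
  have h5 := (h.sgn_add_two hn (h.map_path hn hC a s).1).2
  rw [hE, path_translate, h5, Pi.add_apply, h.map_path_coord hs hn hκ hC a] at h4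
  have h6 : E s n r (κ * (L + s) + c) ((κ * L + c : ℤ) : ZMod s) =
      ((r ^ (κ * L + c) : (ZMod n)ˣ) : ZMod n) * ((r ^ (κ * s) : (ZMod n)ˣ) : ZMod n) := by
    rw [E_apply, show κ * (L + s) + c - (κ * L + c) = κ * s by ring,
      e_of_dvd (Dvd.intro_left κ rfl)]
  simp only [Pi.add_apply, Pi.smul_apply, h6, E_apply_self] at h4
  simp only [units_smul_eq, nsmul_eq_mul] at h4
  push_cast [ZMod.natCast_zmod_val] at h4
  rw [zpow_natCast, Units.val_pow_eq_pow_val]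
  generalize hR : r ^ (κ * L + c) = R at *
  apply R.isUnit.mul_left_cancel
  linear_combination -h4

/-- A map that reverses all arcs forces `2 r^{2s} = ±2`. -/
theorem torsion_of_neg (hs : 1 ≤ s) (hn : 3 ≤ n) (h : MapsSteps r C f (-1) c)
    {L : ℤ} {v : ZMod s → ZMod n} (hC : C L v) :
    2 * ((r : ZMod n) ^ (2 * s) + 1) = 0 ∨ 2 * ((r : ZMod n) ^ (2 * s) - 1) = 0 := by
  have h1 := h.two_mul_sgn hs hn (Or.inr rfl) hC 1
  rw [neg_one_mul, zpow_neg, zpow_natCast] at h1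
  have h2 : ((r ^ s : (ZMod n)ˣ) : ZMod n) * (((r ^ s)⁻¹ : (ZMod n)ˣ) : ZMod n) = 1 := by
    rw [← Units.val_mul, mul_inv_cancel, Units.val_one]
  have h3 : (r : ZMod n) ^ (2 * s) = ((r ^ s : (ZMod n)ˣ) : ZMod n) ^ 2 := by
    rw [Units.val_pow_eq_pow_val, ← pow_mul, mul_comm]
  rw [h3]
  generalize ((r ^ s : (ZMod n)ˣ) : ZMod n) = x at *
  generalize (((r ^ s)⁻¹ : (ZMod n)ˣ) : ZMod n) = y at *
  generalize sgn r f (-1) c L v = δ at *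
  generalize sgn r f (-1) c (L + s) _ = δ' at *
  rcases Int.units_eq_one_or δ with rfl | rfl <;> rcases Int.units_eq_one_or δ' with rfl | rfl <;>
    push_cast at h1
  · right; linear_combination x * h1 + 2 * h2
  · left; linear_combination x * h1 - 2 * h2
  · left; linear_combination -x * h1 - 2 * h2
  · right; linear_combination -x * h1 + 2 * h2

variable (h4 : (4 : ZMod n) ≠ 0)
include h4

/-- Signs do not change along a directed path of length `s`. -/
theorem sgn_period (hs : 1 ≤ s) (hn : 3 ≤ n) (h : MapsSteps r C f 1 c)
    {L : ℤ} {v : ZMod s → ZMod n} (hC : C L v) (a : ℕ → ℤˣ) :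
    sgn r f 1 c (L + s) (path r L v a s) = sgn r f 1 c L v := by
  have h1 := h.two_mul_sgn hs hn (Or.inl rfl) hC a
  rw [one_mul] at h1
  have h2 := (r ^ (s : ℤ)).isUnit.mul_right_cancel h1
  generalize sgn r f 1 c L v = δ at *
  generalize sgn r f 1 c (L + s) _ = δ' at *
  rcases Int.units_eq_one_or δ with rfl | rfl <;> rcases Int.units_eq_one_or δ' with rfl | rfl <;>
    push_cast at h2
  · rfl
  · exact absurd (by linear_combination h2) h4
  · exact absurd (by linear_combination -h2) h4
  · rfl

/-- Parallel directed paths shorter than `s` carry the same signs. -/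
theorem sgn_parallel (hs : 1 ≤ s) (hn : 3 ≤ n) (h : MapsSteps r C f 1 c)
    {L : ℤ} {v : ZMod s → ZMod n} (hC : C L v) (a : ℕ → ℤˣ) (k : ℕ) {i : ℕ} (hi : i < s) :
    sgn r f 1 c (L + i) (path r L v a i + (2 * k) • E s n r L) =
      sgn r f 1 c (L + i) (path r L v a i) := by
  have : NeZero n := ⟨by omega⟩
  obtain ⟨h1, h2, h3⟩ := h.sgn_add_two_mul hn hC k
  have hk : ((2 * k : ℕ) : ZMod n) =
      ((2 * ((k : ZMod n) * ((r ^ s)⁻¹ : (ZMod n)ˣ)).val : ℕ) : ZMod n) * (r : ZMod n) ^ s := by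
    rw [Nat.cast_mul, Nat.cast_mul, ZMod.natCast_zmod_val, ← Units.val_pow_eq_pow_val, mul_assoc,
      mul_assoc, ← Units.val_mul, inv_mul_cancel, Units.val_one, mul_one]
  set k' := ((k : ZMod n) * ((r ^ s)⁻¹ : (ZMod n)ˣ)).val
  have h5 := (h.map_path hn h1 a s).2
  have h6 := (h.sgn_add_two_mul hn (h.map_path hn hC a s).1 k').2.2
  rw [path_translate, nsmul_E_period hk, h6, h.sgn_period h4 hs hn hC, (h.map_path hn hC a s).2,
    ← nsmul_E_period hk, h3] at h5
  have h7 : (2 * k) • E s n r (1 * L + c) = (2 * k') • E s n r (1 * (L + s) + c) := by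
    rw [nsmul_E_period hk]
    congr 2
    ring
  rw [smul_comm, ← h7, smul_comm, add_right_comm] at h5
  have h8 := congrFun (add_left_cancel h5) ((L + i + c : ℤ) : ZMod s)
  have hsum : ∀ δ : ℕ → ℤˣ, (∑ j ∈ Finset.range s, δ j • E s n r (1 * (L + j) + c))
      ((L + i + c : ℤ) : ZMod s) = δ i • E s n r (L + i + c) ((L + i + c : ℤ) : ZMod s) := by
    intro δ
    rw [Finset.sum_apply, Finset.sum_eq_single i]
    · simp
    · intro j hj hji
      rw [Finset.mem_range] at hj
      rw [Pi.smul_apply, E_apply,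
        show 1 * (L + j) + c - (L + i + c) = 1 * ((j : ℤ) - i) by ring,
        e_kappa_mul (Or.inl rfl) (by omega) (by rw [abs_lt]; omega), mul_zero, smul_zero]
    · intro hi'
      exact absurd (Finset.mem_range.2 hi) hi'
  rw [hsum, hsum] at h8
  have h9 : ∀ δ δ' : ℤˣ, δ • E s n r (L + i + c) ((L + i + c : ℤ) : ZMod s) =
      δ' • E s n r (L + i + c) ((L + i + c : ℤ) : ZMod s) → δ = δ' := by
    intro δ δ' hδ
    apply smul_E_inj hn (r := r) (L := L + i + c)
    ext l
    by_cases hl : l = ((L + i + c : ℤ) : ZMod s)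
    · rw [hl]; exact hδ
    · simp [E_apply_of_ne hl]
  have h10 := mul_left_cancel (h9 _ _ h8)
  rw [path_translate] at h10
  exact h10.symm

/-- The sign at the end of a directed path depends only on its start and its length. -/
theorem sgn_path_eq (hs : 1 ≤ s) (hn : 3 ≤ n) (h : MapsSteps r C f 1 c) (j : ℕ) :
    ∀ {L : ℤ} {v : ZMod s → ZMod n} (_ : C L v) (a b : ℕ → ℤˣ),
      sgn r f 1 c (L + j) (path r L v a j) = sgn r f 1 c (L + j) (path r L v b j) := by
  induction j using Nat.strong_induction_on with
  | _ j ih =>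
  intro L v hC a b
  by_cases hj : j < s
  · rcases j with _ | j
    · simp [path_zero]
    · have key : ∀ a b : ℕ → ℤˣ, a 0 = b 0 →
          sgn r f 1 c (L + (j + 1 : ℕ)) (path r L v a (j + 1)) =
          sgn r f 1 c (L + (j + 1 : ℕ)) (path r L v b (j + 1)) := by
        intro a b hab
        have h1 : ∀ a : ℕ → ℤˣ, path r L v a 1 = v + a 0 • E s n r L := fun a => by
          simp [path]
        have := ih j (by omega) (h.succ L v (b 0) hC) (fun i => a (1 + i)) (fun i => b (1 + i))
        rw [add_comm j 1, path_add, path_add, h1, h1, hab]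
        push_cast
        rw [← add_assoc]
        exact this
      by_cases hab : a 0 = b 0
      · exact key a b hab
      · rw [← key (Function.update a 0 (b 0)) b (by simp)]
        obtain ⟨k, hk⟩ : ∃ k : ℕ, (2 * k) • E s n r L = b 0 • E s n r L - a 0 • E s n r L := by
          rcases Int.units_eq_one_or (a 0) with ha | ha <;>
            rcases Int.units_eq_one_or (b 0) with hb | hb <;> rw [ha, hb] at hab <;> rw [ha, hb]
          · exact absurd rfl hab
          · refine ⟨n - 1, ?_⟩
            ext l
            have : (((2 * (n - 1) : ℕ)) : ZMod n) = -2 := by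
              push_cast [Nat.cast_sub (by omega : 1 ≤ n)]
              simp
            simp only [Pi.smul_apply, nsmul_eq_mul, this, Pi.sub_apply]
            simp
            ring
          · refine ⟨1, ?_⟩
            ext l
            simp
            ring
          · exact absurd rfl hab
        have h2 : path r L v (Function.update a 0 (b 0)) (j + 1) =
            path r L v a (j + 1) + (2 * k) • E s n r L := by
          rw [hk]
          unfold path
          rw [Finset.sum_range_succ', Finset.sum_range_succ']
          simp
          abel
        rw [h2, h.sgn_parallel h4 hs hn hC a k hj]
  · obtain ⟨i, rfl⟩ : ∃ i, j = i + s := ⟨j - s, by omega⟩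
    rw [path_add, path_add]
    push_cast
    rw [← add_assoc, h.sgn_period h4 hs hn (h.map_path hn hC a i).1,
      h.sgn_period h4 hs hn (h.map_path hn hC b i).1]
    exact ih i (by omega) hC a b

end MapsSteps

/-- All steps ahead of `v` at level `L` are changed by the sign which `η` prescribes for their
coordinate. -/
def FollowsSigns (r : (ZMod n)ˣ) (C : ℤ → (ZMod s → ZMod n) → Prop)
    (f : ℤ → (ZMod s → ZMod n) → ZMod s → ZMod n) (c : ℤ) (η : ZMod s → ℤˣ) (L : ℤ)
    (v : ZMod s → ZMod n) : Prop :=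
  C L v ∧ ∀ (j : ℕ) (a : ℕ → ℤˣ),
    sgn r f 1 c (L + j) (path r L v a j) = η ((L + j : ℤ) : ZMod s)

namespace MapsSteps

variable (h4 : (4 : ZMod n) ≠ 0)
include h4

/-- The signs along one directed path determine those along all others. -/
theorem exists_followsSigns [NeZero s] (hn : 3 ≤ n) (h : MapsSteps r C f 1 c)
    {L : ℤ} {v : ZMod s → ZMod n} (hC : C L v) : ∃ η, FollowsSigns r C f c η L v := by
  have hs : 1 ≤ s := Nat.pos_of_ne_zero (NeZero.ne s)
  refine ⟨fun l => sgn r f 1 c (L + (l - (L : ZMod s)).val)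
    (path r L v 1 (l - (L : ZMod s)).val), hC, fun j a => ?_⟩
  rw [h.sgn_path_eq h4 hs hn j hC a 1]
  have h1 : (((L + j : ℤ) : ZMod s) - (L : ZMod s)).val = j % s := by
    push_cast
    rw [add_sub_cancel_left, ZMod.val_natCast]
  simp only [h1]
  have key : ∀ q i : ℕ, sgn r f 1 c (L + (i + s * q : ℕ)) (path r L v 1 (i + s * q)) =
      sgn r f 1 c (L + i) (path r L v 1 i) := by
    intro q i
    induction q with
    | zero => simp
    | succ q ih =>
      rw [mul_add, mul_one, ← add_assoc, path_add, Nat.cast_add _ s, ← add_assoc,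
        h.sgn_period h4 hs hn (h.map_path hn hC 1 _).1, ih]
  rw [← key (j / s) (j % s), Nat.mod_add_div]

omit h4 in
theorem _root_.CPM.FollowsSigns.succ (h : MapsSteps r C f 1 c) {η : ZMod s → ℤˣ}
    {L : ℤ} {v : ZMod s → ZMod n} (hF : FollowsSigns r C f c η L v) (b : ℤˣ) :
    FollowsSigns r C f c η (L + 1) (v + b • E s n r L) := by
  refine ⟨h.succ _ _ _ hF.1, fun j a => ?_⟩
  have h1 := hF.2 (1 + j) (fun i => if i = 0 then b else a (i - 1))
  rw [path_add] at h1
  have h2 : path r L v (fun i => if i = 0 then b else a (i - 1)) 1 = v + b • E s n r L := by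
    simp [path]
  rw [h2] at h1
  push_cast at h1 ⊢
  simpa [add_assoc] using h1

theorem _root_.CPM.FollowsSigns.pred (hs : 1 ≤ s) (hn : 3 ≤ n) (h : MapsSteps r C f 1 c)
    {η : ZMod s → ℤˣ} {L : ℤ} {v : ZMod s → ZMod n} {b : ℤˣ}
    (hF : FollowsSigns r C f c η (L + 1) (v + b • E s n r L)) : FollowsSigns r C f c η L v := by
  have hC := h.pred _ _ _ hF.1
  have key : ∀ j : ℕ, ∀ a : ℕ → ℤˣ, sgn r f 1 c (L + (1 + j : ℕ)) (path r L v a (1 + j)) =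
      η ((L + (1 + j : ℕ) : ℤ) : ZMod s) := by
    intro j a
    rw [h.sgn_path_eq h4 hs hn _ hC a (fun _ => b), path_add]
    have h2 : path r L v (fun _ => b) 1 = v + b • E s n r L := by simp [path]
    rw [h2]
    have := hF.2 j (fun _ => b)
    push_cast at this ⊢
    simpa [add_assoc] using this
  refine ⟨hC, fun j a => ?_⟩
  rcases j with _ | j
  · have h1 := key (s - 1) a
    rw [show 1 + (s - 1) = s by omega, h.sgn_period h4 hs hn hC] at h1
    simpa [path_zero] using h1
  · have h1 := key j a
    rwa [add_comm 1 j] at h1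

end MapsSteps

/-! ### Automorphisms and orientations -/

/-- No automorphism of the whole graph maps the two arcs out of a vertex to arcs of which one
raises and one lowers the level. -/
def NoMixing (m s n : ℕ) (r : (ZMod n)ˣ) : Prop :=
  ∀ (Φ : fullGraph m s n r ≃g fullGraph m s n r) (x y y' : Vert m s n),
    Fwd m s n r x y → Fwd m s n r x y' → y ≠ y' →
      ¬ (Fwd m s n r (Φ x) (Φ y) ∧ Fwd m s n r (Φ y') (Φ x))

/-- `Φ` keeps the direction of all arcs at `x`. -/
def Keeps (Φ : fullGraph m s n r ≃g fullGraph m s n r) (x : Vert m s n) : Prop :=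
  ∀ y, (Fwd m s n r x y → Fwd m s n r (Φ x) (Φ y)) ∧ (Fwd m s n r y x → Fwd m s n r (Φ y) (Φ x))

/-- `Φ` reverses the direction of all arcs at `x`. -/
def Reverses (Φ : fullGraph m s n r ≃g fullGraph m s n r) (x : Vert m s n) : Prop :=
  ∀ y, (Fwd m s n r x y → Fwd m s n r (Φ y) (Φ x)) ∧ (Fwd m s n r y x → Fwd m s n r (Φ x) (Φ y))

/-- If no automorphism mixes directions at the two arcs out of a vertex, then at each vertex an
automorphism keeps all directions or reverses all of them. -/
theorem keeps_or_reverses [NeZero (m * s)] (hn : 3 ≤ n) (h3 : 3 ≤ m * s)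
    (hr : (r : ZMod n) ^ (m * s) = 1 ∨ (r : ZMod n) ^ (m * s) = -1) (hmix : NoMixing m s n r)
    (Φ : fullGraph m s n r ≃g fullGraph m s n r) (x : Vert m s n) : Keeps Φ x ∨ Reverses Φ x := by
  have hadj : ∀ {y z}, Fwd m s n r y z → Fwd m s n r (Φ y) (Φ z) ∨ Fwd m s n r (Φ z) (Φ y) := by
    intro y z h
    rw [← adj_iff (by omega)]
    exact Φ.map_adj_iff.2 ((adj_iff (by omega)).2 (Or.inl h))
  obtain ⟨y, y', hne, hy, hy'⟩ := exists_out hn hr x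
  have hne' := Φ.injective.ne hne
  -- an in-neighbour of `x` cannot be mapped to the image of an out-neighbour
  have hin : ∀ z, Fwd m s n r z x → ¬ (Φ z = Φ y ∨ Φ z = Φ y') := by
    rintro z hz (h | h) <;> rw [Φ.injective h] at hz
    · exact fwd_asymm h3 hy hz
    · exact fwd_asymm h3 hy' hz
  rcases hadj hy with h | h <;> rcases hadj hy' with h' | h'
  · left
    refine fun z => ⟨fun hz => ?_, fun hz => ?_⟩
    · rcases fwd_out_cases hr hy hy' hz hne with rfl | rfl <;> assumption
    · exact (hadj hz).resolve_right fun hz' => hin z hz (fwd_out_cases hr h h' hz' hne')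
  · exact absurd ⟨h, h'⟩ (hmix Φ x y y' hy hy' hne)
  · exact absurd ⟨h', h⟩ (hmix Φ x y' y hy' hy hne.symm)
  · right
    refine fun z => ⟨fun hz => ?_, fun hz => ?_⟩
    · rcases fwd_out_cases hr hy hy' hz hne with rfl | rfl <;> assumption
    · exact (hadj hz).resolve_left fun hz' => hin z hz (fwd_in_cases hr h h' hz' hne')

theorem not_keeps_and_reverses (h3 : 3 ≤ m * s) {Φ : fullGraph m s n r ≃g fullGraph m s n r}
    {x y : Vert m s n} (hxy : (fullGraph m s n r).Adj x y) (hx : Keeps Φ x) (hy : Reverses Φ y) :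
    False := by
  rw [adj_iff (by omega)] at hxy
  rcases hxy with h | h
  · exact fwd_asymm h3 ((hx y).1 h) ((hy x).2 h)
  · exact fwd_asymm h3 ((hx y).2 h) ((hy x).1 h)

theorem keeps_iff_of_reachable [NeZero (m * s)] (hn : 3 ≤ n) (h3 : 3 ≤ m * s)
    (hr : (r : ZMod n) ^ (m * s) = 1 ∨ (r : ZMod n) ^ (m * s) = -1) (hmix : NoMixing m s n r)
    (Φ : fullGraph m s n r ≃g fullGraph m s n r) {x y : Vert m s n}
    (h : (fullGraph m s n r).Reachable x y) : (Keeps Φ x → Keeps Φ y) ∧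
      (Reverses Φ x → Reverses Φ y) := by
  rw [SimpleGraph.reachable_iff_reflTransGen] at h
  induction h with
  | refl => exact ⟨id, id⟩
  | tail _ hbc ih =>
    rename_i b c _
    refine ⟨fun hx => ?_, fun hx => ?_⟩
    · exact (keeps_or_reverses hn h3 hr hmix Φ c).resolve_right
        (not_keeps_and_reverses h3 hbc (ih.1 hx))
    · exact (keeps_or_reverses hn h3 hr hmix Φ c).resolve_left
        fun hk => not_keeps_and_reverses h3 hbc.symm hk (ih.2 hx)

theorem level_of_keeps (h3 : 3 ≤ m * s)
    {Φ : fullGraph m s n r ≃g fullGraph m s n r} {x y : Vert m s n}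
    (hΦ : ∀ y, (fullGraph m s n r).Reachable x y → Keeps Φ y)
    (h : (fullGraph m s n r).Reachable x y) : (Φ y).1 = y.1 + ((Φ x).1 - x.1) := by
  have h' := h
  rw [SimpleGraph.reachable_iff_reflTransGen] at h
  induction h with
  | refl => ring
  | tail hab hbc ih =>
    rename_i b c
    have hab' := (SimpleGraph.reachable_iff_reflTransGen _ _).2 hab
    have hb := hΦ b hab'
    have := ih hab'
    rcases (adj_iff (by omega)).1 hbc with h | h
    · rw [((hb c).1 h).1, this, h.1]; ring
    · have h1 := ((hb c).2 h).1
      rw [this, h.1] at h1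
      linear_combination -h1

theorem level_of_reverses (h3 : 3 ≤ m * s)
    {Φ : fullGraph m s n r ≃g fullGraph m s n r} {x y : Vert m s n}
    (hΦ : ∀ y, (fullGraph m s n r).Reachable x y → Reverses Φ y)
    (h : (fullGraph m s n r).Reachable x y) : (Φ y).1 = -y.1 + ((Φ x).1 + x.1) := by
  have h' := h
  rw [SimpleGraph.reachable_iff_reflTransGen] at h
  induction h with
  | refl => ring
  | tail hab hbc ih =>
    rename_i b c
    have hab' := (SimpleGraph.reachable_iff_reflTransGen _ _).2 hab
    have hb := hΦ b hab'
    have := ih hab'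
    rcases (adj_iff (by omega)).1 hbc with h | h
    · have h1 := ((hb c).1 h).1
      rw [this] at h1
      rw [h.1]
      linear_combination -h1
    · rw [((hb c).2 h).1, this, h.1]; ring

/-- An automorphism that acts on levels through `g` and maps steps to multiples of `E (κ * L + c)`
has the properties of `MapsSteps` on the component of `x`. -/
theorem mapsSteps_of_iso [NeZero (m * s)] (hn : 3 ≤ n) (h2 : 2 ≤ m * s)
    (hr : (r : ZMod n) ^ (m * s) = 1 ∨ (r : ZMod n) ^ (m * s) = -1)
    (Φ : fullGraph m s n r ≃g fullGraph m s n r) (x : Vert m s n) (g : ℤ → ZMod (m * s)) (κ c : ℤ)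
    (hg : ∀ L v, (fullGraph m s n r).Reachable x (pt m s L v) → (Φ (pt m s L v)).1 = g L)
    (hstep : ∀ L v (a : ℤˣ), (fullGraph m s n r).Reachable x (pt m s L v) →
      ∃ b : ℤˣ, (Φ (pt m s (L + 1) (v + a • E s n r L))).2 =
        (Φ (pt m s L v)).2 + b • E s n r (κ * L + c)) :
    MapsSteps r (fun L v => (fullGraph m s n r).Reachable x (pt m s L v))
      (fun L v => (Φ (pt m s L v)).2) κ c := by
  have hadj : ∀ L v (a : ℤˣ),
      (fullGraph m s n r).Adj (pt m s L v) (pt m s (L + 1) (v + a • E s n r L)) := fun L v a =>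
    (adj_iff h2).2 (Or.inl ((fwd_pt_iff hr).2 ⟨a, rfl⟩))
  have hsucc : ∀ L v (a : ℤˣ), (fullGraph m s n r).Reachable x (pt m s L v) →
      (fullGraph m s n r).Reachable x (pt m s (L + 1) (v + a • E s n r L)) :=
    fun L v a h => h.trans (hadj L v a).reachable
  have hpred : ∀ L v (a : ℤˣ),
      (fullGraph m s n r).Reachable x (pt m s (L + 1) (v + a • E s n r L)) →
      (fullGraph m s n r).Reachable x (pt m s L v) :=
    fun L v a h => h.trans (hadj L v a).symm.reachable
  refine ⟨hsucc, hpred, ?_, ?_⟩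
  · intro L v hC
    obtain ⟨b, hb⟩ := hstep L v 1 hC
    obtain ⟨b', hb'⟩ := hstep L v (-1) hC
    have hne : b' ≠ b := by
      rintro rfl
      have h1 : Φ (pt m s (L + 1) (v + (1 : ℤˣ) • E s n r L)) =
          Φ (pt m s (L + 1) (v + (-1 : ℤˣ) • E s n r L)) :=
        Prod.ext (by rw [hg _ _ (hsucc _ _ _ hC), hg _ _ (hsucc _ _ _ hC)]) (by rw [hb, hb'])
      exact absurd (pt_smul_inj hn (Φ.injective h1)) (by decide)
    have hb'b : b' = -b := by
      rcases Int.units_eq_one_or b with rfl | rfl <;> rcases Int.units_eq_one_or b' with rfl | rfl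
      · exact absurd rfl hne
      · rfl
      · simp
      · exact absurd rfl hne
    refine ⟨b, fun a => ?_⟩
    rcases Int.units_eq_one_or a with rfl | rfl
    · simpa using hb
    · simpa [hb'b] using hb'
  · intro L v hC h
    have hC' : (fullGraph m s n r).Reachable x (pt m s L (v + (2 : ℕ) • E s n r L)) := by
      apply hpred L _ (-1)
      convert hsucc L v 1 hC using 2
      rw [two_nsmul, Units.neg_smul, one_smul]
      abel
    have h1 := Φ.injective (Prod.ext (by rw [hg _ _ hC, hg _ _ hC']) h)
    have h2 : v + (2 : ℕ) • E s n r L = v := congrArg Prod.snd h1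
    have h3 : (1 : ℤˣ) • E s n r L = (-1 : ℤˣ) • E s n r L := by
      rw [Units.neg_smul, one_smul, eq_neg_iff_add_eq_zero, ← two_nsmul]
      simpa using h2
    exact absurd (smul_E_inj hn h3) (by decide)

/-- If no automorphism mixes directions and `2 r^{2s} ≠ ±2`, every automorphism keeps the direction
of all arcs. -/
theorem keeps_of_noMixing [NeZero (m * s)] (hs : 1 ≤ s) (hn : 3 ≤ n) (h3 : 3 ≤ m * s)
    (hr : (r : ZMod n) ^ (m * s) = 1 ∨ (r : ZMod n) ^ (m * s) = -1) (hmix : NoMixing m s n r)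
    (hc1 : 2 * ((r : ZMod n) ^ (2 * s) + 1) ≠ 0) (hc2 : 2 * ((r : ZMod n) ^ (2 * s) - 1) ≠ 0)
    (Φ : fullGraph m s n r ≃g fullGraph m s n r) (x : Vert m s n) : Keeps Φ x := by
  refine (keeps_or_reverses hn h3 hr hmix Φ x).resolve_right fun hrev => ?_
  have hrev' : ∀ y, (fullGraph m s n r).Reachable x y → Reverses Φ y := fun y hy =>
    (keeps_iff_of_reachable hn h3 hr hmix Φ hy).2 hrev
  obtain ⟨c, hc⟩ := ZMod.intCast_surjective ((Φ x).1 + x.1)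
  have hg : ∀ L v, (fullGraph m s n r).Reachable x (pt m s L v) →
      (Φ (pt m s L v)).1 = ((-L + c : ℤ) : ZMod (m * s)) := by
    intro L v h
    rw [level_of_reverses h3 hrev' h, ← hc]
    push_cast
    ring
  have hmaps := mapsSteps_of_iso hn (by omega) hr Φ x (fun L => ((-L + c : ℤ) : ZMod (m * s)))
    (-1) (c - 1) hg (by
      intro L v a hC
      have h1 := (hrev' _ hC _).1 ((fwd_pt_iff hr).2 ⟨a, rfl⟩)
      have h2 : Φ (pt m s L v) = pt m s (-L + c) (Φ (pt m s L v)).2 :=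
        Prod.ext (hg L v hC) rfl
      rw [h2, fwd_pt_iff' hr] at h1
      obtain ⟨b, hb⟩ := h1
      refine ⟨b, ?_⟩
      rw [hb, show -1 * L + (c - 1) = -L + c - 1 by ring])
  obtain ⟨L, v, hx⟩ := exists_pt x
  rcases hmaps.torsion_of_neg hs hn (L := L) (v := v) (by rw [hx]) with h | h
  · exact hc1 h
  · exact hc2 h

/-- An automorphism that fixes `x` acts on the component of `x` by changing the signs of the
coordinates relative to `x`. -/
theorem exists_signs_of_fixed [NeZero (m * s)] [NeZero s] (hn : 3 ≤ n) (h3 : 3 ≤ m * s)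
    (hr : (r : ZMod n) ^ (m * s) = 1 ∨ (r : ZMod n) ^ (m * s) = -1) (h4 : (4 : ZMod n) ≠ 0)
    (Φ : fullGraph m s n r ≃g fullGraph m s n r) (hΦ : ∀ y, Keeps Φ y) {x : Vert m s n}
    (hx : Φ x = x) : ∃ η : ZMod s → ℤˣ, ∀ y, (fullGraph m s n r).Reachable x y →
      Φ y = (y.1, fun l => x.2 l + η l • (y.2 l - x.2 l)) := by
  have hlev : ∀ y, (fullGraph m s n r).Reachable x y → (Φ y).1 = y.1 := by
    intro y hy
    rw [level_of_keeps h3 (fun y _ => hΦ y) hy, hx]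
    ring
  have hmaps := mapsSteps_of_iso hn (by omega) hr Φ x (fun L => (L : ZMod (m * s))) 1 0
    (fun L v h => hlev _ h) (by
      intro L v a hC
      have h1 := (hΦ (pt m s L v) _).1 ((fwd_pt_iff hr).2 ⟨a, rfl⟩)
      have h2 : Φ (pt m s L v) = pt m s L (Φ (pt m s L v)).2 := Prod.ext (hlev _ hC) rfl
      rw [h2, fwd_pt_iff hr] at h1
      obtain ⟨b, hb⟩ := h1
      refine ⟨b, ?_⟩
      rw [hb, show 1 * L + 0 = L by ring])
  obtain ⟨L, v, hLv⟩ := exists_pt x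
  obtain ⟨η, hη⟩ := hmaps.exists_followsSigns h4 hn (L := L) (v := v) (by rw [hLv])
  refine ⟨η, fun y hy => ?_⟩
  suffices ∃ L v, y = pt m s L v ∧ FollowsSigns r
      (fun L v => (fullGraph m s n r).Reachable x (pt m s L v))
      (fun L v => (Φ (pt m s L v)).2) 0 η L v ∧
      (Φ y).2 = fun l => x.2 l + η l • (y.2 l - x.2 l) by
    obtain ⟨_, _, _, _, h⟩ := this
    exact Prod.ext (hlev y hy) h
  rw [SimpleGraph.reachable_iff_reflTransGen] at hy
  induction hy with
  | refl => exact ⟨L, v, hLv, hη, by rw [hx]; simp⟩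
  | tail hab hbc ih =>
    rename_i b c
    obtain ⟨M, w, rfl, hF, hval⟩ := ih
    rcases (adj_iff (by omega)).1 hbc with h | h
    · rw [fwd_pt_iff hr] at h
      obtain ⟨a, rfl⟩ := h
      refine ⟨_, _, rfl, hF.succ hmaps a, ?_⟩
      have h1 := hmaps.step_sgn hn hF.1 a
      have h2 := hF.2 0 1
      rw [path_zero, Nat.cast_zero, add_zero] at h2
      rw [h2, show 1 * M + 0 = M by ring, mul_smul, ← smul_single] at h1
      rw [h1, hval]
      ext l
      simp only [Pi.add_apply, Pi.smul_apply]
      rw [smul_comm a, add_sub_right_comm, smul_add, add_assoc]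
    · rw [fwd_pt_iff' hr] at h
      obtain ⟨a, rfl⟩ := h
      have hback : (pt m s M w : Vert m s n) = pt m s (M - 1 + 1)
          ((w + a • E s n r (M - 1)) + (-a) • E s n r (M - 1)) := by
        simp [pt]
      have hF' : FollowsSigns r (fun L v => (fullGraph m s n r).Reachable x (pt m s L v))
          (fun L v => (Φ (pt m s L v)).2) 0 η (M - 1) (w + a • E s n r (M - 1)) := by
        apply FollowsSigns.pred h4 (Nat.pos_of_ne_zero (NeZero.ne s)) hn hmaps (b := -a)
        convert hF using 1
        · ring
        · simp
      refine ⟨_, _, rfl, hF', ?_⟩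
      have h1 := hmaps.step_sgn hn hF'.1 (-a)
      have h2 := hF'.2 0 1
      rw [path_zero, Nat.cast_zero, add_zero] at h2
      simp only [← hback] at h1
      rw [h2, show 1 * (M - 1) + 0 = M - 1 by ring, mul_smul, ← smul_single, hval,
        Units.neg_smul, ← sub_eq_add_neg, eq_sub_iff_add_eq] at h1
      rw [← h1]
      ext l
      simp only [Pi.add_apply, Pi.smul_apply]
      rw [smul_comm a, add_sub_right_comm, smul_add, add_assoc]

/-! ### Half-arc-transitivity, the automorphism group and its stabilizers -/

theorem graph_vertex_transitive [NeZero (m * s)] [NeZero s] (h2 : 2 ≤ m * s)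
    (hr : (r : ZMod n) ^ (m * s) = 1 ∨ (r : ZMod n) ^ (m * s) = -1) (u v : vertexSet m s n r) :
    ∃ φ : graph m s n r ≃g graph m s n r, φ u = v := by
  obtain ⟨g, hg, h⟩ := fullGroup_transitive (r := r) (u : Vert m s n) v
  exact ⟨restrictIso (isoOfMem h2 hr hg) u.2 (by rw [isoOfMem_apply, h]; exact v.2), Subtype.ext h⟩

theorem graph_edge_transitive [NeZero (m * s)] [NeZero s] (h2 : 2 ≤ m * s)
    (hr : (r : ZMod n) ^ (m * s) = 1 ∨ (r : ZMod n) ^ (m * s) = -1) :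
    ∀ e ∈ (graph m s n r).edgeSet, ∀ f ∈ (graph m s n r).edgeSet,
      ∃ φ : graph m s n r ≃g graph m s n r, Sym2.map φ e = f := by
  have key : ∀ u v u' v' : vertexSet m s n r, Fwd m s n r u v → Fwd m s n r u' v' →
      ∃ φ : graph m s n r ≃g graph m s n r, φ u = u' ∧ φ v = v' := by
    intro u v u' v' h h'
    obtain ⟨g, hg, h3, h4⟩ := fullGroup_arc_transitive hr h h'
    exact ⟨restrictIso (isoOfMem h2 hr hg) u.2 (by rw [isoOfMem_apply, h3]; exact u'.2),
      Subtype.ext h3, Subtype.ext h4⟩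
  intro e he f hf
  induction e with | _ u v
  induction f with | _ u' v'
  have huv : (fullGraph m s n r).Adj u v := he
  have huv' : (fullGraph m s n r).Adj u' v' := hf
  rw [adj_iff h2] at huv huv'
  rcases huv with huv | huv <;> rcases huv' with huv' | huv'
  · obtain ⟨φ, h3, h4⟩ := key _ _ _ _ huv huv'
    exact ⟨φ, by rw [Sym2.map_mk, h3, h4]⟩
  · obtain ⟨φ, h3, h4⟩ := key _ _ _ _ huv huv'
    exact ⟨φ, by rw [Sym2.map_mk, h3, h4, Sym2.eq_swap]⟩
  · obtain ⟨φ, h3, h4⟩ := key _ _ _ _ huv huv'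
    exact ⟨φ, by rw [Sym2.map_mk, h3, h4, Sym2.eq_swap]⟩
  · obtain ⟨φ, h3, h4⟩ := key _ _ _ _ huv huv'
    exact ⟨φ, by rw [Sym2.map_mk, h3, h4]⟩

theorem not_arc_transitive_of_keeps [NeZero (m * s)] (h3 : 3 ≤ m * s)
    (hr : (r : ZMod n) ^ (m * s) = 1 ∨ (r : ZMod n) ^ (m * s) = -1)
    (hkeep : ∀ (Φ : fullGraph m s n r ≃g fullGraph m s n r) (x : Vert m s n), Keeps Φ x) :
    ¬ (∀ u v u' v' : vertexSet m s n r, (graph m s n r).Adj u v → (graph m s n r).Adj u' v' →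
      ∃ φ : graph m s n r ≃g graph m s n r, φ u = u' ∧ φ v = v') := by
  intro h
  have h0 : ((0, 0) : Vert m s n) ∈ vertexSet m s n r :=
    mem_vertexSet.2 (SimpleGraph.Reachable.refl _)
  have hf : Fwd m s n r (0, 0) (pt m s (0 + 1) (0 + (1 : ℤˣ) • E s n r 0)) := by
    have := (fwd_pt_iff hr (L := 0) (v := 0)).2 ⟨1, rfl⟩
    simpa [pt] using this
  have hadj := (adj_iff (r := r) (by omega : 2 ≤ m * s)).2 (Or.inl hf)
  let u : vertexSet m s n r := ⟨(0, 0), h0⟩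
  let v : vertexSet m s n r := ⟨_, (mem_vertexSet_of_adj hadj).1 h0⟩
  obtain ⟨φ, h4, h5⟩ := h u v v u hadj hadj.symm
  obtain ⟨Φ, hΦ⟩ := exists_extension φ
  have h6 := ((hkeep Φ u) v).1 hf
  rw [hΦ, hΦ, h4, h5] at h6
  exact fwd_asymm h3 hf h6

/-- The sign change relative to the vertex `x`. -/
def signsAt (x : Vert m s n) (η : ZMod s → ℤˣ) : Equiv.Perm (Vert m s n) :=
  transl m s n x.2 * signs m s n η * (transl m s n x.2)⁻¹

theorem signsAt_apply (x : Vert m s n) (η : ZMod s → ℤˣ) (y : Vert m s n) :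
    signsAt x η y = (y.1, fun l => x.2 l + η l • (y.2 l - x.2 l)) := by
  refine Prod.ext rfl ?_
  ext l
  change η l • (y.2 l - x.2 l) + x.2 l = _
  rw [add_comm]

theorem signsAt_mem [NeZero s] (x : Vert m s n) (η : ZMod s → ℤˣ) :
    signsAt x η ∈ fullGroup m s n r :=
  mul_mem (mul_mem (transl_mem _) (signs_mem _)) (inv_mem (transl_mem _))

theorem signsAt_self (x : Vert m s n) (η : ZMod s → ℤˣ) : signsAt x η x = x := by
  rw [signsAt_apply]
  simp

theorem signsAt_mul (x : Vert m s n) (η θ : ZMod s → ℤˣ) :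
    signsAt x (η * θ) = signsAt x η * signsAt x θ := by
  simp [signsAt, signs_mul, mul_assoc]

theorem mem_vertexSet_iff_reachable {x y : Vert m s n} (hx : x ∈ vertexSet m s n r) :
    y ∈ vertexSet m s n r ↔ (fullGraph m s n r).Reachable x y := by
  rw [mem_vertexSet] at *
  exact ⟨fun h => hx.trans h.symm, fun h => h.symm.trans hx⟩

theorem mem_group_iff [NeZero (m * s)] [NeZero s] (hn : 3 ≤ n) (h3 : 3 ≤ m * s)
    (hr : (r : ZMod n) ^ (m * s) = 1 ∨ (r : ZMod n) ^ (m * s) = -1) (h4 : (4 : ZMod n) ≠ 0)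
    (hkeep : ∀ (Φ : fullGraph m s n r ≃g fullGraph m s n r) (x : Vert m s n), Keeps Φ x)
    (π : Equiv.Perm (vertexSet m s n r)) :
    π ∈ group m s n r ↔ ∃ φ : graph m s n r ≃g graph m s n r, φ.toEquiv = π := by
  have h0 : ((0, 0) : Vert m s n) ∈ vertexSet m s n r :=
    mem_vertexSet.2 (SimpleGraph.Reachable.refl _)
  constructor
  · rintro ⟨g, hg, -, h⟩
    refine ⟨restrictIso (isoOfMem (by omega) hr hg) h0 ?_, ?_⟩
    · rw [isoOfMem_apply, ← h ⟨(0, 0), h0⟩]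
      exact (π _).2
    · ext x : 2
      exact (h x).symm
  · rintro ⟨φ, rfl⟩
    obtain ⟨Φ, hΦ⟩ := exists_extension φ
    obtain ⟨g, hg, hgx⟩ := fullGroup_transitive (r := r) (Φ (0, 0)) (0, 0)
    obtain ⟨η, hη⟩ := exists_signs_of_fixed hn h3 hr h4 (Φ.trans (isoOfMem (by omega) hr hg))
      (hkeep _) (x := (0, 0)) hgx
    obtain ⟨γ, hγ⟩ : ∃ γ : Equiv.Perm (Vert m s n), γ = g⁻¹ * signsAt (0, 0) η := ⟨_, rfl⟩
    have hmem : γ ∈ fullGroup m s n r := hγ ▸ mul_mem (inv_mem hg) (signsAt_mem _ _)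
    have hval : ∀ x : vertexSet m s n r, ((φ x : vertexSet m s n r) : Vert m s n) = γ x := by
      intro x
      rw [← hΦ, hγ, Equiv.Perm.mul_apply, Equiv.Perm.eq_inv_iff_eq, signsAt_apply]
      exact hη x ((mem_vertexSet_iff_reachable h0).1 x.2)
    refine ⟨γ, hmem, ?_, hval⟩
    ext y
    have hiff := mem_vertexSet_of_iso (isoOfMem (by omega) hr hmem) h0
      (by rw [isoOfMem_apply, ← hval ⟨(0, 0), h0⟩]; exact (φ _).2)
    rw [Set.mem_smul_set]
    constructor
    · rintro ⟨z, hz, rfl⟩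
      exact (hiff z).2 hz
    · intro hy
      refine ⟨γ.symm y, ?_, γ.apply_symm_apply y⟩
      rw [← hiff, isoOfMem_apply, γ.apply_symm_apply]
      exact hy

/-- The sign change relative to the vertex `x` of the component, as an automorphism. -/
def signsIso [NeZero (m * s)] [NeZero s] (h2 : 2 ≤ m * s)
    (hr : (r : ZMod n) ^ (m * s) = 1 ∨ (r : ZMod n) ^ (m * s) = -1) (x : vertexSet m s n r)
    (η : ZMod s → ℤˣ) : graph m s n r ≃g graph m s n r :=
  restrictIso (isoOfMem h2 hr (signsAt_mem x η)) x.2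
    (by rw [isoOfMem_apply, signsAt_self]; exact x.2)

theorem signsIso_apply [NeZero (m * s)] [NeZero s] (h2 : 2 ≤ m * s)
    (hr : (r : ZMod n) ^ (m * s) = 1 ∨ (r : ZMod n) ^ (m * s) = -1) (x y : vertexSet m s n r)
    (η : ZMod s → ℤˣ) : (signsIso h2 hr x η y : Vert m s n) = signsAt (x : Vert m s n) η y := rfl

/-- The sign changes relative to `x`, as a homomorphism to the stabilizer of `x`. -/
def signsHom [NeZero (m * s)] [NeZero s] (h2 : 2 ≤ m * s)
    (hr : (r : ZMod n) ^ (m * s) = 1 ∨ (r : ZMod n) ^ (m * s) = -1) (x : vertexSet m s n r) :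
    (ZMod s → ℤˣ) →* MulAction.stabilizer (graph m s n r ≃g graph m s n r) x where
  toFun η := ⟨signsIso h2 hr x η, by
    rw [MulAction.mem_stabilizer_iff, RelIso.smul_def]
    exact Subtype.ext (by rw [signsIso_apply, signsAt_self])⟩
  map_one' := by
    refine Subtype.ext (RelIso.ext fun y => Subtype.ext ?_)
    rw [signsIso_apply, signsAt_apply]
    simp
  map_mul' η θ := by
    refine Subtype.ext (RelIso.ext fun y => Subtype.ext ?_)
    rw [Subgroup.coe_mul, RelIso.mul_apply, signsIso_apply, signsIso_apply, signsIso_apply,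
      signsAt_mul, Equiv.Perm.mul_apply]

theorem signsHom_apply [NeZero (m * s)] [NeZero s] (h2 : 2 ≤ m * s)
    (hr : (r : ZMod n) ^ (m * s) = 1 ∨ (r : ZMod n) ^ (m * s) = -1) (x : vertexSet m s n r)
    (η : ZMod s → ℤˣ) : (signsHom h2 hr x η : graph m s n r ≃g graph m s n r) =
      signsIso h2 hr x η := rfl

theorem reachable_path [NeZero (m * s)] (h2 : 2 ≤ m * s)
    (hr : (r : ZMod n) ^ (m * s) = 1 ∨ (r : ZMod n) ^ (m * s) = -1) (L : ℤ) (v : ZMod s → ZMod n)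
    (a : ℕ → ℤˣ) (j : ℕ) :
    (fullGraph m s n r).Reachable (pt m s L v) (pt m s (L + j) (path r L v a j)) := by
  induction j with
  | zero => simp [path_zero]
  | succ j ih =>
    refine ih.trans (SimpleGraph.Adj.reachable ((adj_iff h2).2 (Or.inl ?_)))
    rw [fwd_pt_iff hr, path_succ, Nat.cast_succ, ← add_assoc]
    exact ⟨_, rfl⟩

theorem signsHom_injective [NeZero (m * s)] [NeZero s] (hn : 3 ≤ n) (h2 : 2 ≤ m * s)
    (hr : (r : ZMod n) ^ (m * s) = 1 ∨ (r : ZMod n) ^ (m * s) = -1) (x : vertexSet m s n r) :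
    Function.Injective (signsHom h2 hr x) := by
  rw [injective_iff_map_eq_one]
  intro η hη
  have hfix : ∀ y, (fullGraph m s n r).Reachable x y → signsAt (x : Vert m s n) η y = y := by
    intro y hy
    rw [← mem_vertexSet_iff_reachable x.2] at hy
    rw [← signsIso_apply h2 hr x ⟨y, hy⟩ η, ← signsHom_apply, hη]
    rfl
  obtain ⟨L, v, hx⟩ := exists_pt (x : Vert m s n)
  rw [hx] at hfix
  ext1 l
  -- the directed path from `x` uses the coordinate `l` at its step number `(l - L).val`
  obtain ⟨j, hj⟩ : ∃ j : ℕ, ((L + j : ℤ) : ZMod s) = l := ⟨(l - L).val, by simp⟩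
  have h3 := congrArg Prod.snd (hfix _ (reachable_path h2 hr L v 1 j))
  have h4 := congrArg Prod.snd (hfix _ (reachable_path h2 hr L v 1 (j + 1)))
  rw [signsAt_apply] at h3 h4
  rw [path_succ] at h4
  have h5 := congrFun h3 l
  have h6 := congrFun h4 l
  simp only [Pi.add_apply, Pi.one_apply, one_smul] at h5 h6
  rw [add_sub_right_comm, smul_add, ← add_assoc, h5, add_right_inj] at h6
  apply smul_E_inj hn (r := r) (L := L + j)
  ext k
  by_cases hk : k = l
  · rw [hk]; simpa using h6
  · simp [E_apply_of_ne (fun h => hk (h.trans hj))]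

theorem signsHom_surjective [NeZero (m * s)] [NeZero s] (hn : 3 ≤ n) (h3 : 3 ≤ m * s)
    (h2 : 2 ≤ m * s)
    (hr : (r : ZMod n) ^ (m * s) = 1 ∨ (r : ZMod n) ^ (m * s) = -1) (h4 : (4 : ZMod n) ≠ 0)
    (hkeep : ∀ (Φ : fullGraph m s n r ≃g fullGraph m s n r) (x : Vert m s n), Keeps Φ x)
    (x : vertexSet m s n r) : Function.Surjective (signsHom h2 hr x) := by
  rintro ⟨φ, hφ⟩
  obtain ⟨Φ, hΦ⟩ := exists_extension φ
  have hφ' : φ x = x := hφ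
  obtain ⟨η, hη⟩ := exists_signs_of_fixed hn h3 hr h4 Φ (hkeep Φ) (x := x) (by rw [hΦ, hφ'])
  refine ⟨η, ?_⟩
  refine Subtype.ext (RelIso.ext fun y => Subtype.ext ?_)
  rw [signsHom_apply, signsIso_apply, signsAt_apply]
  rw [← hη y ((mem_vertexSet_iff_reachable x.2).1 y.2), hΦ]

theorem nonempty_signs_mulEquiv [NeZero s] :
    Nonempty ((ZMod s → ℤˣ) ≃* Multiplicative (Fin s → ZMod 2)) := by
  have : Fact (Nat.Prime 2) := ⟨Nat.prime_two⟩
  let e₂ : ℤˣ ≃* Multiplicative (ZMod 2) :=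
    mulEquivOfPrimeCardEq (p := 2) (by simp) (by simp)
  let e₃ : (Fin s → Multiplicative (ZMod 2)) ≃* Multiplicative (Fin s → ZMod 2) :=
    { toFun := fun f => Multiplicative.ofAdd fun i => (f i).toAdd
      invFun := fun f i => Multiplicative.ofAdd (f.toAdd i)
      left_inv := fun _ => rfl
      right_inv := fun _ => rfl
      map_mul' := fun _ _ => rfl }
  let e₁ : (ZMod s → ℤˣ) ≃* (Fin s → Multiplicative (ZMod 2)) :=
    { toFun := fun f i => e₂ (f (ZMod.finEquiv s i))
      invFun := fun f i => e₂.symm (f ((ZMod.finEquiv s).symm i))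
      left_inv := fun f => by simp
      right_inv := fun f => by simp
      map_mul' := fun f g => by
        ext i
        simp }
  exact ⟨e₁.trans e₃⟩

/-- The group of units modulo a divisor of `8` has exponent at most `2`. -/
theorem pow_eq_one_of_eight_eq_zero (hn : 3 ≤ n) (r : (ZMod n)ˣ) (h : (8 : ZMod n) = 0) :
    (r : ZMod n) ^ 2 = 1 := by
  have h8 : ((8 : ℕ) : ZMod n) = 0 := by exact_mod_cast h
  rw [ZMod.natCast_eq_zero_iff] at h8
  have hle := Nat.le_of_dvd (by norm_num) h8
  have hinv : (r : ZMod n) * ((r⁻¹ : (ZMod n)ˣ) : ZMod n) = 1 := by simp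
  generalize (r : ZMod n) = x at *
  generalize ((r⁻¹ : (ZMod n)ˣ) : ZMod n) = y at *
  clear h
  interval_cases n
  any_goals omega
  all_goals revert x y; decide

theorem main_of_noMixing (hs : 2 ≤ s) (hm : 1 ≤ m) (hn : 3 ≤ n)
    (hr : (r : ZMod n) ^ (m * s) = 1 ∨ (r : ZMod n) ^ (m * s) = -1)
    (hmix : 2 * ((r : ZMod n) ^ (2 * s) + 1) ≠ 0 → 2 * ((r : ZMod n) ^ (2 * s) - 1) ≠ 0 →
      NoMixing m s n r) :
    ((graph m s n r).IsHalfArcTransitive ↔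
      (2 * ((r : ZMod n) ^ (2 * s) + 1) ≠ 0 ∧ 2 * ((r : ZMod n) ^ (2 * s) - 1) ≠ 0)) ∧
    ((graph m s n r).IsHalfArcTransitive →
      (∀ π : Equiv.Perm (vertexSet m s n r), π ∈ group m s n r ↔
        ∃ φ : graph m s n r ≃g graph m s n r, φ.toEquiv = π) ∧
      ∀ x : vertexSet m s n r,
        Nonempty (MulAction.stabilizer (graph m s n r ≃g graph m s n r) x ≃*
          Multiplicative (Fin s → ZMod 2))) := by
  have h2 : 2 ≤ m * s := by nlinarith
  have : NeZero (m * s) := ⟨by omega⟩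
  have : NeZero s := ⟨by omega⟩
  have hnec : (graph m s n r).IsHalfArcTransitive →
      (2 * ((r : ZMod n) ^ (2 * s) + 1) ≠ 0 ∧ 2 * ((r : ZMod n) ^ (2 * s) - 1) ≠ 0) := by
    intro h
    constructor
    · exact fun h' => h.2.2 (arc_transitive_of_torsion hn h2 hr (Or.inl h'))
    · exact fun h' => h.2.2 (arc_transitive_of_torsion hn h2 hr (Or.inr h'))
  have key : 2 * ((r : ZMod n) ^ (2 * s) + 1) ≠ 0 → 2 * ((r : ZMod n) ^ (2 * s) - 1) ≠ 0 →
      3 ≤ m * s ∧ (4 : ZMod n) ≠ 0 ∧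
      ∀ (Φ : fullGraph m s n r ≃g fullGraph m s n r) (x : Vert m s n), Keeps Φ x := by
    intro hc1 hc2
    have h3 : 3 ≤ m * s := by
      by_contra hlt
      have hs2 : s = 2 := by nlinarith
      have hm1 : m = 1 := by nlinarith
      subst hs2 hm1
      apply hc2
      have : (r : ZMod n) ^ (2 * 2) = ((r : ZMod n) ^ (1 * 2)) ^ 2 := by ring
      rw [this]
      rcases hr with h | h <;> rw [h] <;> ring
    refine ⟨h3, fun h4 => ?_, keeps_of_noMixing (by omega) hn h3 hr (hmix hc1 hc2) hc1 hc2⟩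
    apply hc2
    rw [pow_mul, pow_eq_one_of_eight_eq_zero hn r (by linear_combination 2 * h4)]
    simp
  refine ⟨⟨hnec, fun h => ?_⟩, fun h => ?_⟩
  · obtain ⟨h3, -, hkeep⟩ := key h.1 h.2
    exact ⟨graph_vertex_transitive h2 hr, graph_edge_transitive h2 hr,
      not_arc_transitive_of_keeps h3 hr hkeep⟩
  · obtain ⟨h3, h4, hkeep⟩ := key (hnec h).1 (hnec h).2
    refine ⟨mem_group_iff hn h3 hr h4 hkeep, fun x => ?_⟩
    obtain ⟨e₁⟩ := nonempty_signs_mulEquiv (s := s)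
    exact ⟨(MulEquiv.ofBijective (signsHom h2 hr x) ⟨signsHom_injective hn h2 hr x,
      signsHom_surjective hn h3 h2 hr h4 hkeep x⟩).symm.trans e₁⟩

/-! ### Closed walks without backtracking -/

/-- A `k`-periodic infinite walk that never turns back, that is, a closed walk of length `k`
without backtracking at any of its vertices. -/
structure IsClosedWalk {V : Type*} (Γ : SimpleGraph V) (k : ℕ) (w : ℕ → V) : Prop where
  adj : ∀ i, Γ.Adj (w i) (w (i + 1))
  nb : ∀ i, w (i + 2) ≠ w i
  periodic : ∀ i, w (i + k) = w i

theorem IsClosedWalk.map {V : Type*} {Γ : SimpleGraph V} {k : ℕ} {w : ℕ → V}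
    (h : IsClosedWalk Γ k w) (Φ : Γ ≃g Γ) : IsClosedWalk Γ k (fun i => Φ (w i)) :=
  ⟨fun i => Φ.map_adj_iff.2 (h.adj i), fun i => Φ.injective.ne (h.nb i),
    fun i => by rw [h.periodic]⟩

/-- The position of an edge relative to its initial vertex, if edges are numbered by their lower
level: an edge walked downwards lies one level below its initial vertex. -/
def edgeShift (d : ℤˣ) : ℤ := if d = 1 then 0 else -1

/-- The level of the `j`-th edge of a walk with directions `d`, relative to its initial vertex. -/
def edgeLevel (d : ℕ → ℤˣ) (j : ℕ) : ℤ := ∑ i ∈ Finset.range j, (d i : ℤ) + edgeShift (d j)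

/-- The `j`-th vertex of the walk that starts in `⟨L; v⟩` and has directions `d` and signs `a`. -/
def walk (m s n : ℕ) (r : (ZMod n)ˣ) (L : ℤ) (v : ZMod s → ZMod n) (d a : ℕ → ℤˣ) (j : ℕ) :
    Vert m s n :=
  pt m s (L + ∑ i ∈ Finset.range j, (d i : ℤ))
    (v + ∑ i ∈ Finset.range j, a i • E s n r (L + edgeLevel d i))

theorem adj_pt_iff [NeZero (m * s)] (h2 : 2 ≤ m * s)
    (hr : (r : ZMod n) ^ (m * s) = 1 ∨ (r : ZMod n) ^ (m * s) = -1) {L : ℤ}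
    {v : ZMod s → ZMod n} {y : Vert m s n} : (fullGraph m s n r).Adj (pt m s L v) y ↔
      ∃ d a : ℤˣ, y = pt m s (L + d) (v + a • E s n r (L + edgeShift d)) := by
  rw [adj_iff h2, fwd_pt_iff hr, fwd_pt_iff' hr]
  constructor
  · rintro (⟨a, h⟩ | ⟨a, h⟩)
    · exact ⟨1, a, by simpa [edgeShift] using h⟩
    · exact ⟨-1, a, by simpa [edgeShift, sub_eq_add_neg] using h⟩
  · rintro ⟨d, a, h⟩
    rcases Int.units_eq_one_or d with rfl | rfl
    · exact Or.inl ⟨a, by simpa [edgeShift] using h⟩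
    · exact Or.inr ⟨a, by simpa [edgeShift, sub_eq_add_neg] using h⟩

theorem two_ne_zero_level (h3 : 3 ≤ m * s) : ((2 : ℤ) : ZMod (m * s)) ≠ 0 := by
  intro h
  have h2 : ((2 : ℕ) : ZMod (m * s)) = 0 := by exact_mod_cast h
  rw [ZMod.natCast_eq_zero_iff] at h2
  exact absurd (Nat.le_of_dvd (by norm_num) h2) (by omega)

theorem step_unique (hn : 3 ≤ n) (h3 : 3 ≤ m * s) {L : ℤ} {v : ZMod s → ZMod n} {d d' a a' : ℤˣ}
    (h : pt m s (L + d) (v + a • E s n r (L + edgeShift d)) =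
      pt m s (L + d') (v + a' • E s n r (L + edgeShift d'))) : d = d' ∧ a = a' := by
  have h2 := two_ne_zero_level (m := m) (s := s) h3
  have h1 : d = d' := by
    have := congrArg Prod.fst h
    simp only [Int.cast_add, add_right_inj] at this
    rcases Int.units_eq_one_or d with rfl | rfl <;> rcases Int.units_eq_one_or d' with rfl | rfl
    · rfl
    · exfalso; apply h2; push_cast at this ⊢; linear_combination this
    · exfalso; apply h2; push_cast at this ⊢; linear_combination -this
    · rfl
  subst h1
  exact ⟨rfl, pt_smul_inj hn h⟩

theorem walk_zero (L : ℤ) (v : ZMod s → ZMod n) (d a : ℕ → ℤˣ) :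
    walk m s n r L v d a 0 = pt m s L v := by
  simp [walk]

theorem walk_succ (L : ℤ) (v : ZMod s → ZMod n) (d a : ℕ → ℤˣ) (j : ℕ) :
    walk m s n r L v d a (j + 1) = pt m s (L + ∑ i ∈ Finset.range j, (d i : ℤ) + d j)
      (v + ∑ i ∈ Finset.range j, a i • E s n r (L + edgeLevel d i) +
        a j • E s n r (L + ∑ i ∈ Finset.range j, (d i : ℤ) + edgeShift (d j))) := by
  simp only [walk, Finset.sum_range_succ, ← add_assoc]
  rw [edgeLevel, ← add_assoc L]

theorem walk_one (L : ℤ) (v : ZMod s → ZMod n) (d a : ℕ → ℤˣ) :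
    walk m s n r L v d a 1 = pt m s (L + d 0) (v + a 0 • E s n r (L + edgeShift (d 0))) := by
  simp [walk, edgeLevel]

theorem walk_adj [NeZero (m * s)] (h2 : 2 ≤ m * s)
    (hr : (r : ZMod n) ^ (m * s) = 1 ∨ (r : ZMod n) ^ (m * s) = -1) (L : ℤ)
    (v : ZMod s → ZMod n) (d a : ℕ → ℤˣ) (j : ℕ) :
    (fullGraph m s n r).Adj (walk m s n r L v d a j) (walk m s n r L v d a (j + 1)) :=
  (adj_pt_iff h2 hr).2 ⟨d j, a j, walk_succ L v d a j⟩

/-- Every walk is described by directions and signs. -/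
theorem exists_eq_walk [NeZero (m * s)] (h2 : 2 ≤ m * s)
    (hr : (r : ZMod n) ^ (m * s) = 1 ∨ (r : ZMod n) ^ (m * s) = -1) {L : ℤ}
    {v : ZMod s → ZMod n} {w : ℕ → Vert m s n}
    (hw : ∀ i, (fullGraph m s n r).Adj (w i) (w (i + 1))) (h0 : w 0 = pt m s L v) :
    ∃ d a : ℕ → ℤˣ, ∀ j, w j = walk m s n r L v d a j := by
  have h1 : ∀ (j : ℕ) (M : ℤ) (u : ZMod s → ZMod n), ∃ d a : ℤˣ, w j = pt m s M u →
      w (j + 1) = pt m s (M + d) (u + a • E s n r (M + edgeShift d)) := by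
    intro j M u
    by_cases h : w j = pt m s M u
    · have := hw j
      rw [h, adj_pt_iff h2 hr] at this
      obtain ⟨d, a, h'⟩ := this
      exact ⟨d, a, fun _ => h'⟩
    · exact ⟨1, 1, fun h' => absurd h' h⟩
  choose D A hDA using h1
  let st : ℕ → ℤ × (ZMod s → ZMod n) := fun j => Nat.rec (L, v) (fun j p =>
    (p.1 + D j p.1 p.2, p.2 + A j p.1 p.2 • E s n r (p.1 + edgeShift (D j p.1 p.2)))) j
  have hst : ∀ j, st (j + 1) = ((st j).1 + D j (st j).1 (st j).2,
      (st j).2 + A j (st j).1 (st j).2 • E s n r ((st j).1 + edgeShift (D j (st j).1 (st j).2))) :=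
    fun j => rfl
  refine ⟨fun j => D j (st j).1 (st j).2, fun j => A j (st j).1 (st j).2, fun j => ?_⟩
  have key : ∀ j, w j = pt m s (st j).1 (st j).2 ∧
      (st j).1 = L + ∑ i ∈ Finset.range j, ((D i (st i).1 (st i).2 : ℤˣ) : ℤ) ∧
      (st j).2 = v + ∑ i ∈ Finset.range j, A i (st i).1 (st i).2 •
        E s n r (L + edgeLevel (fun j => D j (st j).1 (st j).2) i) := by
    intro j
    induction j with
    | zero => exact ⟨h0, by simp [st], by simp [st]⟩
    | succ j ih =>
      refine ⟨by rw [hDA j _ _ ih.1, hst], ?_, ?_⟩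
      · rw [Finset.sum_range_succ, ← add_assoc, ← ih.2.1, hst]
      · rw [Finset.sum_range_succ, ← add_assoc, ← ih.2.2, edgeLevel, ← add_assoc, ← ih.2.1, hst]
  rw [walk, ← (key j).2.1, ← (key j).2.2]
  exact (key j).1

theorem walk_unique (hn : 3 ≤ n) (h3 : 3 ≤ m * s) {L : ℤ} {v : ZMod s → ZMod n}
    {d a d' a' : ℕ → ℤˣ} {l : ℕ}
    (h : ∀ j ≤ l, walk m s n r L v d a j = walk m s n r L v d' a' j) :
    ∀ j < l, d j = d' j ∧ a j = a' j := by
  intro j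
  induction j using Nat.strong_induction_on with
  | _ j ih =>
  intro hj
  have h1 := h (j + 1) hj
  rw [walk_succ, walk_succ] at h1
  have h2 : ∀ i ∈ Finset.range j, d i = d' i ∧ a i = a' i := fun i hi =>
    ih i (Finset.mem_range.1 hi) ((Finset.mem_range.1 hi).trans hj)
  have h4 : ∑ i ∈ Finset.range j, (d i : ℤ) = ∑ i ∈ Finset.range j, (d' i : ℤ) :=
    Finset.sum_congr rfl fun i hi => by rw [(h2 i hi).1]
  have h5 : ∑ i ∈ Finset.range j, a i • E s n r (L + edgeLevel d i) =
      ∑ i ∈ Finset.range j, a' i • E s n r (L + edgeLevel d' i) := by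
    refine Finset.sum_congr rfl fun i hi => ?_
    have h6 : ∑ k ∈ Finset.range i, (d k : ℤ) = ∑ k ∈ Finset.range i, (d' k : ℤ) :=
      Finset.sum_congr rfl fun k hk => by
        rw [(h2 k (Finset.mem_range.2 ((Finset.mem_range.1 hk).trans (Finset.mem_range.1 hi)))).1]
    rw [(h2 i hi).2, edgeLevel, edgeLevel, h6, (h2 i hi).1]
  rw [h4, h5] at h1
  exact step_unique hn h3 h1

/-- A walk with directions `d` and signs `a` turns back at its `(j + 1)`-st vertex exactly if it
changes direction there and the two signs differ. -/
theorem walk_nb_iff (hn : 3 ≤ n) (h3 : 3 ≤ m * s) (L : ℤ) (v : ZMod s → ZMod n) (d a : ℕ → ℤˣ)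
    (j : ℕ) : walk m s n r L v d a (j + 2) ≠ walk m s n r L v d a j ↔
      (d (j + 1) = -d j → a (j + 1) = a j) := by
  have h1 : walk m s n r L v d a (j + 2) =
      pt m s (L + ∑ i ∈ Finset.range j, (d i : ℤ) + d j + d (j + 1))
      (v + ∑ i ∈ Finset.range j, a i • E s n r (L + edgeLevel d i) +
        (a j • E s n r (L + ∑ i ∈ Finset.range j, (d i : ℤ) + edgeShift (d j)) +
        a (j + 1) •
          E s n r (L + ∑ i ∈ Finset.range j, (d i : ℤ) + d j + edgeShift (d (j + 1))))) := by
    rw [walk_succ, Finset.sum_range_succ, Finset.sum_range_succ, edgeLevel]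
    simp only [add_assoc]
  rw [h1, walk]
  generalize L + ∑ i ∈ Finset.range j, (d i : ℤ) = M
  generalize v + ∑ i ∈ Finset.range j, a i • E s n r (L + edgeLevel d i) = u
  generalize d (j + 1) = d'
  generalize a (j + 1) = a'
  generalize d j = d
  generalize a j = a
  have h2 := two_ne_zero_level (m := m) (s := s) h3
  have hdiff : ∀ d : ℤˣ, ((M + d + d : ℤ) : ZMod (m * s)) ≠ (M : ZMod (m * s)) := by
    intro d this
    rcases Int.units_eq_one_or d with rfl | rfl
    · exact h2 (by push_cast at this ⊢; linear_combination this)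
    · exact h2 (by push_cast at this ⊢; linear_combination -this)
  by_cases hd : d' = -d
  · subst hd
    have h5 : M + d + edgeShift (-d) = M + edgeShift d := by
      rcases Int.units_eq_one_or d with rfl | rfl
      · rw [show edgeShift (-1) = -1 from rfl, show edgeShift 1 = 0 from rfl]; push_cast; ring
      · rw [show edgeShift (- -1) = 0 from rfl, show edgeShift (-1) = -1 from rfl]; push_cast; ring
    rw [h5]
    constructor
    · intro h _
      by_contra hne
      apply h
      have : a' = -a := by
        rcases Int.units_eq_one_or a with rfl | rfl <;> rcases Int.units_eq_one_or a' with rfl | rfl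
        · exact absurd rfl hne
        · rfl
        · simp
        · exact absurd rfl hne
      subst this
      simp [pt]
    · intro h heq
      have h6 := congrArg Prod.snd heq
      rw [h rfl] at h6
      simp only [add_eq_left] at h6
      have h7 := smul_E_inj hn (eq_neg_of_add_eq_zero_left h6 |>.trans (Units.neg_smul _ _).symm)
      rcases Int.units_eq_one_or a with rfl | rfl <;> exact absurd h7 (by decide)
  · have hd' : d' = d := by
      rcases Int.units_eq_one_or d with rfl | rfl <;> rcases Int.units_eq_one_or d' with rfl | rfl
      · rfl
      · exact absurd rfl hd
      · exact absurd rfl hd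
      · rfl
    subst hd'
    exact iff_of_true (fun h => hdiff d' (congrArg Prod.fst h)) fun h => absurd h hd

theorem sum_smul_E_eq_zero_iff [NeZero s] (L : ℤ) (d a : ℕ → ℤˣ) (k : ℕ) :
    ∑ i ∈ Finset.range k, a i • E s n r (L + edgeLevel d i) = 0 ↔
      ∀ c : ℤ, ∑ i ∈ Finset.range k, ((a i : ℤ) : ZMod n) * e s n r (edgeLevel d i - c) = 0 := by
  have h1 : ∀ c : ℤ, (∑ i ∈ Finset.range k, a i • E s n r (L + edgeLevel d i))
      ((L + c : ℤ) : ZMod s) = ((r ^ (L + c) : (ZMod n)ˣ) : ZMod n) *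
        ∑ i ∈ Finset.range k, ((a i : ℤ) : ZMod n) * e s n r (edgeLevel d i - c) := by
    intro c
    rw [Finset.sum_apply, Finset.mul_sum]
    refine Finset.sum_congr rfl fun i _ => ?_
    rw [Pi.smul_apply, E_apply, units_smul_eq, add_sub_add_left_eq_sub]
    ring
  constructor
  · intro h c
    have h2 := h1 c
    rw [h] at h2
    simpa using h2.symm
  · intro h
    ext l
    obtain ⟨c, rfl⟩ : ∃ c : ℤ, ((L + c : ℤ) : ZMod s) = l := ⟨(l - L).val, by simp⟩
    rw [h1, h c]
    simp

/-- The data of a closed walk without backtracking, continuing given data of an initial segment. The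
last clause compares the first edge with its repetition; it needs total level change `0`, because
otherwise the repetition is described by another representative of the level. -/
theorem IsClosedWalk.exists_data [NeZero (m * s)] [NeZero s] (hn : 3 ≤ n) (h3 : 3 ≤ m * s)
    (hr : (r : ZMod n) ^ (m * s) = 1 ∨ (r : ZMod n) ^ (m * s) = -1) {L : ℤ}
    {v : ZMod s → ZMod n} {k l : ℕ} {w : ℕ → Vert m s n}
    (hw : IsClosedWalk (fullGraph m s n r) k w) (d' a' : ℕ → ℤˣ)
    (hpre : ∀ j ≤ l, w j = walk m s n r L v d' a' j) :
    ∃ d a : ℕ → ℤˣ, (∀ j < l, d j = d' j ∧ a j = a' j) ∧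
      (∀ j, d (j + 1) = -d j → a (j + 1) = a j) ∧
      ((m * s : ℕ) : ℤ) ∣ ∑ i ∈ Finset.range k, (d i : ℤ) ∧
      (∀ c : ℤ, ∑ i ∈ Finset.range k, ((a i : ℤ) : ZMod n) * e s n r (edgeLevel d i - c) = 0) ∧
      (∑ i ∈ Finset.range k, (d i : ℤ) = 0 → d k = d 0 ∧ a k = a 0) := by
  have h0 := hpre 0 (Nat.zero_le _)
  rw [walk_zero] at h0
  obtain ⟨d, a, hda⟩ := exists_eq_walk (by omega) hr hw.adj h0
  have hk : walk m s n r L v d a k = pt m s L v := by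
    rw [← hda, ← h0, ← hw.periodic 0, zero_add]
  have hfst := congrArg Prod.fst hk
  have hsnd : ∑ i ∈ Finset.range k, a i • E s n r (L + edgeLevel d i) = 0 := by
    simpa [walk] using congrArg Prod.snd hk
  refine ⟨d, a, ?_, ?_, ?_, ?_, ?_⟩
  · exact walk_unique hn h3 fun j hj => by rw [← hda, hpre j hj]
  · intro j
    rw [← walk_nb_iff (r := r) hn h3 L v d a j, ← hda, ← hda]
    exact hw.nb j
  · rw [← ZMod.intCast_zmod_eq_zero_iff_dvd]
    simpa [walk] using hfst
  · exact (sum_smul_E_eq_zero_iff L d a k).1 hsnd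
  · intro hsum
    have h1 : walk m s n r L v d a (k + 1) = walk m s n r L v d a 1 := by
      rw [← hda, ← hda, ← hw.periodic 1, add_comm]
    rw [walk_succ, walk_one, hsum, hsnd] at h1
    simp only [add_zero] at h1
    exact step_unique hn h3 h1

/-- A walk that returns to its first arc closes up. -/
theorem exists_isClosedWalk [NeZero (m * s)] (hn : 3 ≤ n) (h3 : 3 ≤ m * s)
    (hr : (r : ZMod n) ^ (m * s) = 1 ∨ (r : ZMod n) ^ (m * s) = -1) (L : ℤ)
    (v : ZMod s → ZMod n) {k : ℕ} (hk : 2 ≤ k) (d a : ℕ → ℤˣ)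
    (hnb : ∀ j < k, d (j + 1) = -d j → a (j + 1) = a j)
    (h0 : walk m s n r L v d a k = walk m s n r L v d a 0)
    (h1 : walk m s n r L v d a (k + 1) = walk m s n r L v d a 1) :
    ∃ w, IsClosedWalk (fullGraph m s n r) k w ∧ ∀ j ≤ k, w j = walk m s n r L v d a j := by
  have hlt : ∀ i, i % k < k := fun i => Nat.mod_lt _ (by omega)
  have hmod : ∀ i j, j ≤ k + 1 → j % k = i % k →
      walk m s n r L v d a (i % k) = walk m s n r L v d a j := by
    intro i j hj hij
    rw [← hij]
    rcases Nat.lt_or_ge j k with h | h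
    · rw [Nat.mod_eq_of_lt h]
    · obtain rfl | rfl : j = k ∨ j = k + 1 := by omega
      · rw [Nat.mod_self, h0]
      · rw [Nat.add_mod_left, Nat.mod_eq_of_lt (by omega), h1]
  refine ⟨fun i => walk m s n r L v d a (i % k), ⟨fun i => ?_, fun i => ?_, fun i => ?_⟩, ?_⟩
  · rw [hmod (i + 1) (i % k + 1) (by have := hlt i; omega) (by simp)]
    exact walk_adj (by omega) hr L v d a _
  · rw [hmod (i + 2) (i % k + 2) (by have := hlt i; omega) (by simp)]
    exact (walk_nb_iff hn h3 L v d a _).2 (hnb _ (hlt i))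
  · simp
  · intro j hj
    exact hmod j j (by omega) rfl

/-- Directions of total `0` and signs that cancel in each coordinate give a closed walk. -/
theorem exists_isClosedWalk_of_sum [NeZero (m * s)] [NeZero s] (hn : 3 ≤ n) (h3 : 3 ≤ m * s)
    (hr : (r : ZMod n) ^ (m * s) = 1 ∨ (r : ZMod n) ^ (m * s) = -1) (L : ℤ)
    (v : ZMod s → ZMod n) {k : ℕ} (hk : 2 ≤ k) (d a : ℕ → ℤˣ)
    (hnb : ∀ j < k, d (j + 1) = -d j → a (j + 1) = a j)
    (hd : ∑ i ∈ Finset.range k, (d i : ℤ) = 0)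
    (ha : ∀ c : ℤ, ∑ i ∈ Finset.range k, ((a i : ℤ) : ZMod n) * e s n r (edgeLevel d i - c) = 0)
    (hdk : d k = d 0) (hak : a k = a 0) :
    ∃ w, IsClosedWalk (fullGraph m s n r) k w ∧ ∀ j ≤ k, w j = walk m s n r L v d a j := by
  have h1 := (sum_smul_E_eq_zero_iff L d a k).2 ha
  refine exists_isClosedWalk hn h3 hr L v hk d a hnb ?_ ?_
  · simp [walk, hd, h1]
  · rw [walk_succ, ← zero_add 1, walk_succ, hd, h1, hdk, hak]
    simp

/-- Directions that only raise the level, to a total of `m * s`, and signs that cancel in each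
coordinate give a closed walk. -/
theorem exists_isClosedWalk_of_winding [NeZero (m * s)] [NeZero s] (hn : 3 ≤ n) (h3 : 3 ≤ m * s)
    (hr : (r : ZMod n) ^ (m * s) = 1 ∨ (r : ZMod n) ^ (m * s) = -1) (L : ℤ)
    (v : ZMod s → ZMod n) (a : ℕ → ℤˣ)
    (ha : ∀ c : ℤ, ∑ i ∈ Finset.range (m * s), ((a i : ℤ) : ZMod n) * e s n r (i - c) = 0) :
    ∃ w, IsClosedWalk (fullGraph m s n r) (m * s) w ∧
      ∀ j ≤ m * s, w j = walk m s n r L v (fun _ => 1) a j := by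
  have hms : (m : ZMod (m * s)) * s = 0 := by rw [← Nat.cast_mul, ZMod.natCast_self]
  have hel : ∀ i : ℕ, edgeLevel (fun _ => 1) i = i := by intro i; simp [edgeLevel, edgeShift]
  obtain ⟨b, hb⟩ := E_congr (r := r) hr (L := L + (m * s : ℕ)) (M := L) (by simp [hms])
  -- after one round the first sign has to be adapted to the new representative of the level
  set a' : ℕ → ℤˣ := fun i => if i = m * s then b * a 0 else a i with ha'
  have hlt : ∀ i < m * s, a' i = a i := fun i hi => if_neg hi.ne
  have hwalk : ∀ j ≤ m * s, walk m s n r L v (fun _ => 1) a' j =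
      walk m s n r L v (fun _ => 1) a j := by
    intro j hj
    unfold walk
    congr 2
    refine Finset.sum_congr rfl fun i hi => ?_
    rw [hlt i (by have := Finset.mem_range.1 hi; omega)]
  have h1 : ∑ i ∈ Finset.range (m * s), a' i • E s n r (L + edgeLevel (fun _ => 1) i) = 0 := by
    rw [sum_smul_E_eq_zero_iff]
    intro c
    rw [← ha c]
    refine Finset.sum_congr rfl fun i hi => ?_
    rw [hlt i (Finset.mem_range.1 hi), hel]
  obtain ⟨w, hw, hw'⟩ := exists_isClosedWalk hn h3 hr L v (k := m * s) (by omega) (fun _ => 1) a'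
    (fun j _ h => absurd h (by decide))
    (by simp only [walk, h1]; simp [hms]) (by
      rw [walk_succ, walk_one, h1]
      have h2 : a' (m * s) • E s n r (L + (m * s : ℕ)) = a' 0 • E s n r L := by
        rw [hb, smul_smul, hlt 0 (by omega)]
        congr 1
        simp only [ha', if_true]
        rw [mul_comm, ← mul_assoc, Int.units_mul_self, one_mul]
      push_cast at h2
      simp [edgeShift, h2, hms])
  exact ⟨w, hw, fun j hj => by rw [hw' j hj, hwalk j hj]⟩

/-! ### Paths that lie on short closed walks -/

/-- The first `l + 1` vertices of the sequence `p` begin a closed walk of length `k` without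
backtracking. -/
def OnClosedWalk {V : Type*} (Γ : SimpleGraph V) (k l : ℕ) (p : ℕ → V) : Prop :=
  ∃ w, IsClosedWalk Γ k w ∧ ∀ j ≤ l, w j = p j

theorem OnClosedWalk.map {V : Type*} {Γ : SimpleGraph V} {k l : ℕ} {p : ℕ → V}
    (h : OnClosedWalk Γ k l p) (Φ : Γ ≃g Γ) : OnClosedWalk Γ k l (fun i => Φ (p i)) := by
  obtain ⟨w, hw, hp⟩ := h
  exact ⟨_, hw.map Φ, fun j hj => by rw [hp j hj]⟩

theorem onClosedWalk_map_iff {V : Type*} {Γ : SimpleGraph V} {k l : ℕ} {p : ℕ → V}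
    (Φ : Γ ≃g Γ) : OnClosedWalk Γ k l (fun i => Φ (p i)) ↔ OnClosedWalk Γ k l p := by
  refine ⟨fun h => ?_, fun h => h.map Φ⟩
  simpa using h.map Φ.symm

theorem OnClosedWalk.congr {V : Type*} {Γ : SimpleGraph V} {k l : ℕ} {p p' : ℕ → V}
    (h : OnClosedWalk Γ k l p) (hp : ∀ j ≤ l, p j = p' j) : OnClosedWalk Γ k l p' := by
  obtain ⟨w, hw, hw'⟩ := h
  exact ⟨w, hw, fun j hj => by rw [hw' j hj, hp j hj]⟩

/-- A walk of length `8` may be traversed in the opposite direction. -/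
theorem OnClosedWalk.reverse {V : Type*} {Γ : SimpleGraph V} {p : ℕ → V}
    (h : OnClosedWalk Γ 8 3 p) : OnClosedWalk Γ 8 3 (fun i => p (3 - i)) := by
  obtain ⟨w, hw, hp⟩ := h
  have hper : ∀ i j, w (i + 8 * j) = w i := by
    intro i j
    induction j with
    | zero => rfl
    | succ j ih => rw [mul_add, mul_one, ← add_assoc, hw.periodic, ih]
  refine ⟨fun i => w (3 + 7 * i), ⟨fun i => ?_, fun i => ?_, fun i => ?_⟩, fun j hj => ?_⟩
  · have h1 := hw.adj (3 + 7 * i + 7)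
    rw [hw.periodic (3 + 7 * i)] at h1
    exact h1.symm
  · have h1 := hw.nb (3 + 7 * i + 6)
    rw [hw.periodic (3 + 7 * i), ← hw.periodic (3 + 7 * i + 6)] at h1
    exact h1.symm
  · exact hper (3 + 7 * i) 7
  · have : 3 + 7 * j = 3 - j + 8 * j := by omega
    dsimp only
    rw [this, hper, hp _ (by omega)]

/-- The sequence `p, q, t, u, t, u, …`. -/
def arc3 {V : Type*} (p q t u : V) : ℕ → V
  | 0 => p
  | 1 => q
  | i + 2 => if Even i then t else u

theorem arc3_adj {V : Type*} {Γ : SimpleGraph V} {p q t u : V} (h1 : Γ.Adj p q) (h2 : Γ.Adj q t)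
    (h3 : Γ.Adj t u) (i : ℕ) : Γ.Adj (arc3 p q t u i) (arc3 p q t u (i + 1)) := by
  rcases i with _ | _ | i
  · exact h1
  · simpa [arc3] using h2
  · by_cases hi : Even i
    · simpa [arc3, hi, Nat.even_add_one] using h3
    · simpa [arc3, hi, Nat.even_add_one] using h3.symm

theorem arc3_three {V : Type*} (p q t u : V) : arc3 p q t u 3 = u := by simp [arc3]

theorem arc3_two {V : Type*} (p q t u : V) : arc3 p q t u 2 = t := by simp [arc3]

theorem walk_congr (L : ℤ) (v : ZMod s → ZMod n) {d a d' a' : ℕ → ℤˣ} {l : ℕ}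
    (h : ∀ j < l, d j = d' j ∧ a j = a' j) :
    ∀ j ≤ l, walk m s n r L v d a j = walk m s n r L v d' a' j := by
  intro j hj
  have h1 : ∀ i ≤ j, ∑ k ∈ Finset.range i, (d k : ℤ) = ∑ k ∈ Finset.range i, (d' k : ℤ) := by
    intro i hi
    refine Finset.sum_congr rfl fun k hk => ?_
    rw [(h k (by have := Finset.mem_range.1 hk; omega)).1]
  unfold walk
  rw [h1 j le_rfl]
  congr 2
  refine Finset.sum_congr rfl fun i hi => ?_
  have hi := Finset.mem_range.1 hi
  rw [(h i (by omega)).2, edgeLevel, edgeLevel, h1 i hi.le, (h i (by omega)).1]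

theorem walk_add (L : ℤ) (v : ZMod s → ZMod n) (d a : ℕ → ℤˣ) (j i : ℕ) :
    walk m s n r L v d a (j + i) = walk m s n r (L + ∑ i ∈ Finset.range j, (d i : ℤ))
      (v + ∑ i ∈ Finset.range j, a i • E s n r (L + edgeLevel d i))
      (fun i => d (j + i)) (fun i => a (j + i)) i := by
  unfold walk
  rw [Finset.sum_range_add, Finset.sum_range_add, ← add_assoc, ← add_assoc]
  congr 2
  refine Finset.sum_congr rfl fun k _ => ?_
  rw [edgeLevel, edgeLevel, Finset.sum_range_add]
  congr 2
  ring

theorem fwd_walk_iff [NeZero (m * s)] (h3 : 3 ≤ m * s)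
    (hr : (r : ZMod n) ^ (m * s) = 1 ∨ (r : ZMod n) ^ (m * s) = -1) (L : ℤ) (v : ZMod s → ZMod n)
    (d a : ℕ → ℤˣ) (j : ℕ) :
    (Fwd m s n r (walk m s n r L v d a j) (walk m s n r L v d a (j + 1)) ↔ d j = 1) ∧
    (Fwd m s n r (walk m s n r L v d a (j + 1)) (walk m s n r L v d a j) ↔ d j = -1) := by
  have h1 : d j = 1 → Fwd m s n r (walk m s n r L v d a j) (walk m s n r L v d a (j + 1)) := by
    intro hd
    rw [walk_succ, walk, fwd_pt_iff hr, hd]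
    exact ⟨a j, by simp [edgeShift]⟩
  have h2 : d j = -1 → Fwd m s n r (walk m s n r L v d a (j + 1)) (walk m s n r L v d a j) := by
    intro hd
    rw [walk_succ, walk, fwd_pt_iff' hr, hd]
    exact ⟨a j, by simp [edgeShift, sub_eq_add_neg]⟩
  constructor
  · refine ⟨fun h => ?_, h1⟩
    rcases Int.units_eq_one_or (d j) with hd | hd
    · exact hd
    · exact absurd (h2 hd) (fwd_asymm h3 h)
  · refine ⟨fun h => ?_, h2⟩
    rcases Int.units_eq_one_or (d j) with hd | hd
    · exact absurd (h1 hd) (fwd_asymm h3 h)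
    · exact hd

/-- A path of length `3` in coordinates. -/
theorem exists_walk_arc3 [NeZero (m * s)] (h2 : 2 ≤ m * s)
    (hr : (r : ZMod n) ^ (m * s) = 1 ∨ (r : ZMod n) ^ (m * s) = -1) {p q t u : Vert m s n}
    (h1 : (fullGraph m s n r).Adj p q) (h2' : (fullGraph m s n r).Adj q t)
    (h3 : (fullGraph m s n r).Adj t u) :
    ∃ (L : ℤ) (v : ZMod s → ZMod n) (d a : ℕ → ℤˣ),
      ∀ j, arc3 p q t u j = walk m s n r L v d a j := by
  obtain ⟨L, v, hp⟩ := exists_pt p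
  obtain ⟨d, a, h⟩ := exists_eq_walk h2 hr (arc3_adj h1 h2' h3) (L := L) (v := v) hp
  exact ⟨L, v, d, a, h⟩

theorem edgeShift_one : edgeShift 1 = 0 := rfl

theorem edgeShift_neg_one : edgeShift (-1) = -1 := rfl

theorem e_add_period (k : ℤ) : e s n r (k + s) = e s n r k * (r : ZMod n) ^ s := by
  unfold e
  have : (s : ℤ) ∣ k + s ↔ (s : ℤ) ∣ k := by simp
  by_cases h : (s : ℤ) ∣ k
  · rw [if_pos h, if_pos (this.2 h), zpow_add, Units.val_mul, zpow_natCast,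
      Units.val_pow_eq_pow_val]
  · rw [if_neg h, if_neg (mt this.1 h), zero_mul]

theorem e_zero : e s n r 0 = 1 := by simp [e]

theorem e_of_abs_lt {k : ℤ} (h0 : k ≠ 0) (hk : |k| < s) : e s n r k = 0 :=
  e_of_not_dvd fun h => h0 (Int.eq_zero_of_abs_lt_dvd h hk)

/-- The directions and signs of a closed walk of length `8`, given by lists. -/
theorem onClosedWalk_of_lists [NeZero (m * s)] [NeZero s] (hn : 3 ≤ n) (h3 : 3 ≤ m * s)
    (hr : (r : ZMod n) ^ (m * s) = 1 ∨ (r : ZMod n) ^ (m * s) = -1) {L : ℤ}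
    {v : ZMod s → ZMod n} {d a : ℕ → ℤˣ} {l : ℕ} (hl : l ≤ 8) (d' a' : ℕ → ℤˣ)
    (h : ∀ j < l, d' j = d j ∧ a' j = a j)
    (hnb : ∀ j < 8, d' (j + 1) = -d' j → a' (j + 1) = a' j)
    (hd : ∑ i ∈ Finset.range 8, (d' i : ℤ) = 0)
    (ha : ∀ c : ℤ, ∑ i ∈ Finset.range 8, ((a' i : ℤ) : ZMod n) * e s n r (edgeLevel d' i - c) = 0)
    (hdk : d' 8 = d' 0) (hak : a' 8 = a' 0) :
    OnClosedWalk (fullGraph m s n r) 8 l (walk m s n r L v d a) := by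
  obtain ⟨w, hw, hw'⟩ :=
    exists_isClosedWalk_of_sum hn h3 hr L v (by norm_num) d' a' hnb hd ha hdk hak
  exact ⟨w, hw, fun j hj => by rw [hw' j (by omega), walk_congr L v h j hj]⟩

/-- The commutator walk through a path that goes down, up and up. -/
theorem onClosedWalk_down_up_up [NeZero (m * s)] [NeZero s] (hn : 3 ≤ n) (h3 : 3 ≤ m * s)
    (hr : (r : ZMod n) ^ (m * s) = 1 ∨ (r : ZMod n) ^ (m * s) = -1) {L : ℤ}
    {v : ZMod s → ZMod n} {d a : ℕ → ℤˣ} (hd0 : d 0 = -1) (hd1 : d 1 = 1) (hd2 : d 2 = 1)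
    (ha : a 1 = a 0) :
    OnClosedWalk (fullGraph m s n r) 8 3 (walk m s n r L v d a) := by
  refine onClosedWalk_of_lists hn h3 hr (by norm_num)
    (fun i => [-1, 1, 1, -1, -1, 1, 1, -1].getD i (-1))
    (fun i => [a 0, a 0, a 2, a 2, -a 0, -a 0, -a 2, -a 2].getD i (a 0)) ?_ ?_ (by decide) ?_
    rfl rfl
  · intro j hj
    interval_cases j <;> simp [hd0, hd1, hd2, ha]
  · intro j hj
    interval_cases j <;> simp
  · intro c
    simp [Finset.sum_range_succ, edgeLevel, edgeShift_one, edgeShift_neg_one]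
    ring

/-- The commutator walk through a path that goes up, up and down. -/
theorem onClosedWalk_up_up_down [NeZero (m * s)] [NeZero s] (hn : 3 ≤ n) (h3 : 3 ≤ m * s)
    (hr : (r : ZMod n) ^ (m * s) = 1 ∨ (r : ZMod n) ^ (m * s) = -1) {L : ℤ}
    {v : ZMod s → ZMod n} {d a : ℕ → ℤˣ} (hd0 : d 0 = 1) (hd1 : d 1 = 1) (hd2 : d 2 = -1)
    (ha : a 2 = a 1) :
    OnClosedWalk (fullGraph m s n r) 8 3 (walk m s n r L v d a) := by
  refine onClosedWalk_of_lists hn h3 hr (by norm_num)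
    (fun i => [1, 1, -1, -1, 1, 1, -1, -1].getD i 1)
    (fun i => [a 0, a 1, a 1, -a 0, -a 0, -a 1, -a 1, a 0].getD i (a 0)) ?_ ?_ (by decide) ?_
    rfl rfl
  · intro j hj
    interval_cases j <;> simp [hd0, hd1, hd2, ha]
  · intro j hj
    interval_cases j <;> simp
  · intro c
    simp [Finset.sum_range_succ, edgeLevel, edgeShift_one, edgeShift_neg_one]
    ring

/-- If `4 r^2 = ±2` or `2 r^2 = ±4` and `s = 2`, an alternating path of length `3` lies on a closed
walk of length `8`. -/
theorem onClosedWalk_down_up_down [NeZero (m * 2)] (hn : 3 ≤ n) (h3 : 3 ≤ m * 2)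
    (hr : (r : ZMod n) ^ (m * 2) = 1 ∨ (r : ZMod n) ^ (m * 2) = -1) {L : ℤ}
    {v : ZMod 2 → ZMod n} {d a : ℕ → ℤˣ} (hd0 : d 0 = -1) (hd1 : d 1 = 1) (hd2 : d 2 = -1)
    (ha1 : a 1 = a 0) (ha2 : a 2 = a 0) {b c : ℤˣ}
    (hsp : 2 * ((b : ℤ) : ZMod n) + 4 * ((c : ℤ) : ZMod n) * (r : ZMod n) ^ 2 = 0 ∨
      4 * ((b : ℤ) : ZMod n) + 2 * ((c : ℤ) : ZMod n) * (r : ZMod n) ^ 2 = 0) :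
    OnClosedWalk (fullGraph m 2 n r) 8 3 (walk m 2 n r L v d a) := by
  have hsq : ∀ x : ℤˣ, ((x : ℤ) : ZMod n) * ((x : ℤ) : ZMod n) = 1 := by
    intro x
    rcases Int.units_eq_one_or x with rfl | rfl <;> simp
  rcases hsp with hsp | hsp
  · refine onClosedWalk_of_lists hn h3 hr (by norm_num)
      (fun i => [-1, 1, -1, -1, -1, 1, 1, 1].getD i (-1))
      (fun i => [a 0, a 0, a 0, 1, a 0 * c * b, a 0 * c * b, -1, a 0].getD i (a 0))
      ?_ ?_ (by decide) ?_ rfl rfl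
    · intro j hj
      interval_cases j <;> simp [hd0, hd1, hd2, ha1, ha2]
    · intro j hj
      interval_cases j <;> simp
    · intro k
      simp [Finset.sum_range_succ, edgeLevel, edgeShift_one, edgeShift_neg_one]
      have h1 := e_add_period (s := 2) (r := r) (-3 - k)
      rw [show -3 - k + (2 : ℕ) = -1 - k by push_cast; ring] at h1
      rw [h1]
      linear_combination ((a 0 : ℤ) : ZMod n) * ((c : ℤ) : ZMod n) * e 2 n r (-3 - k) * hsp -
        4 * ((a 0 : ℤ) : ZMod n) * (r : ZMod n) ^ 2 * e 2 n r (-3 - k) * hsq c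
  · refine onClosedWalk_of_lists hn h3 hr (by norm_num)
      (fun i => [-1, 1, -1, 1, 1, 1, -1, -1].getD i (-1))
      (fun i => [a 0, a 0, a 0, a 0, 1, a 0 * b * c, a 0 * b * c, -1].getD i (a 0))
      ?_ ?_ (by decide) ?_ rfl rfl
    · intro j hj
      interval_cases j <;> simp [hd0, hd1, hd2, ha1, ha2]
    · intro j hj
      interval_cases j <;> simp
    · intro k
      simp [Finset.sum_range_succ, edgeLevel, edgeShift_one, edgeShift_neg_one]
      have h1 := e_add_period (s := 2) (r := r) (-1 - k)
      rw [show -1 - k + (2 : ℕ) = 1 - k by push_cast; ring] at h1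
      rw [h1]
      linear_combination ((a 0 : ℤ) : ZMod n) * ((b : ℤ) : ZMod n) * e 2 n r (-1 - k) * hsp -
        4 * ((a 0 : ℤ) : ZMod n) * e 2 n r (-1 - k) * hsq b

/-- A relation `±1 ± r^2 ± r^4 = 0` gives closed walks of length `6` that wind once around. -/
theorem onClosedWalk_up_up_six [NeZero (3 * 2)] (hn : 3 ≤ n)
    (hr : (r : ZMod n) ^ (3 * 2) = 1 ∨ (r : ZMod n) ^ (3 * 2) = -1) {L : ℤ}
    {v : ZMod 2 → ZMod n} {d a : ℕ → ℤˣ} (hd0 : d 0 = 1) (hd1 : d 1 = 1) {b : ℕ → ℤˣ}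
    (hrel : ((b 0 : ℤ) : ZMod n) + ((b 1 : ℤ) : ZMod n) * (r : ZMod n) ^ 2 +
      ((b 2 : ℤ) : ZMod n) * ((r : ZMod n) ^ 2) ^ 2 = 0) :
    OnClosedWalk (fullGraph 3 2 n r) 6 2 (walk 3 2 n r L v d a) := by
  obtain ⟨w, hw, hw'⟩ := exists_isClosedWalk_of_winding hn (by norm_num) hr L v
    (fun i => a (i % 2) * b 0 * b (i / 2)) (by
      intro c
      have h1 := e_add_period (s := 2) (r := r) (0 - c)
      have h2 := e_add_period (s := 2) (r := r) (1 - c)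
      have h4 := e_add_period (s := 2) (r := r) (2 - c)
      have h5 := e_add_period (s := 2) (r := r) (3 - c)
      rw [show 0 - c + (2 : ℕ) = 2 - c by push_cast; ring] at h1
      rw [show 1 - c + (2 : ℕ) = 3 - c by push_cast; ring] at h2
      rw [show 2 - c + (2 : ℕ) = 4 - c by push_cast; ring, h1] at h4
      rw [show 3 - c + (2 : ℕ) = 5 - c by push_cast; ring, h2] at h5
      simp only [Nat.reduceMul, Finset.sum_range_succ, Finset.sum_range_zero]
      push_cast
      norm_num
      rw [h5, h4, h2, h1, zero_sub]
      linear_combination (((a 0 : ℤ) : ZMod n) * ((b 0 : ℤ) : ZMod n) * e 2 n r (-c) +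
        ((a 1 : ℤ) : ZMod n) * ((b 0 : ℤ) : ZMod n) * e 2 n r (1 - c)) * hrel)
  refine ⟨w, hw, fun j hj => ?_⟩
  rw [hw' j (by omega)]
  refine walk_congr L v (l := 2) ?_ j hj
  intro j hj
  interval_cases j <;> simp [hd0, hd1, mul_assoc, Int.units_mul_self]

/-- A relation `1 ± r^2 + r^4 ± r^6 = 0` gives closed walks of length `8` that wind once around. -/
theorem onClosedWalk_up_up_up [NeZero (4 * 2)] (hn : 3 ≤ n)
    (hr : (r : ZMod n) ^ (4 * 2) = 1 ∨ (r : ZMod n) ^ (4 * 2) = -1) {L : ℤ}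
    {v : ZMod 2 → ZMod n} {d a : ℕ → ℤˣ} (hd0 : d 0 = 1) (hd1 : d 1 = 1) (hd2 : d 2 = 1) {b : ℤˣ}
    (ha : a 2 = b * a 0)
    (hrel : 1 + ((b : ℤ) : ZMod n) * (r : ZMod n) ^ 2 + ((r : ZMod n) ^ 2) ^ 2 +
      ((b : ℤ) : ZMod n) * ((r : ZMod n) ^ 2) ^ 3 = 0) :
    OnClosedWalk (fullGraph 4 2 n r) 8 3 (walk 4 2 n r L v d a) := by
  obtain ⟨w, hw, hw'⟩ := exists_isClosedWalk_of_winding hn (by norm_num) hr L v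
    (fun i => [a 0, a 1, b * a 0, b * a 1, a 0, a 1, b * a 0, b * a 1].getD i 1) (by
      intro c
      have h1 := e_add_period (s := 2) (r := r) (0 - c)
      have h2 := e_add_period (s := 2) (r := r) (1 - c)
      have h4 := e_add_period (s := 2) (r := r) (2 - c)
      have h5 := e_add_period (s := 2) (r := r) (3 - c)
      have h6 := e_add_period (s := 2) (r := r) (4 - c)
      have h7 := e_add_period (s := 2) (r := r) (5 - c)
      rw [show 0 - c + (2 : ℕ) = 2 - c by push_cast; ring] at h1
      rw [show 1 - c + (2 : ℕ) = 3 - c by push_cast; ring] at h2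
      rw [show 2 - c + (2 : ℕ) = 4 - c by push_cast; ring, h1] at h4
      rw [show 3 - c + (2 : ℕ) = 5 - c by push_cast; ring, h2] at h5
      rw [show 4 - c + (2 : ℕ) = 6 - c by push_cast; ring, h4] at h6
      rw [show 5 - c + (2 : ℕ) = 7 - c by push_cast; ring, h5] at h7
      simp only [Nat.reduceMul, Finset.sum_range_succ, Finset.sum_range_zero]
      push_cast
      norm_num
      rw [h7, h6, h5, h4, h2, h1, zero_sub]
      linear_combination (((a 0 : ℤ) : ZMod n) * e 2 n r (-c) +
        ((a 1 : ℤ) : ZMod n) * e 2 n r (1 - c)) * hrel)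
  refine ⟨w, hw, fun j hj => ?_⟩
  rw [hw' j (by omega)]
  refine walk_congr L v (l := 3) ?_ j hj
  intro j hj
  interval_cases j <;> simp [hd0, hd1, hd2, ha]

/-! ### Signs of short closed walks -/

theorem units_mul_self_cast (x : ℤˣ) : ((x : ℤ) : ZMod n) * ((x : ℤ) : ZMod n) = 1 := by
  rcases Int.units_eq_one_or x with rfl | rfl <;> simp

theorem units_eq_or_eq_neg (x y : ℤˣ) : x = y ∨ x = -y := by
  rcases Int.units_eq_one_or x with rfl | rfl <;> rcases Int.units_eq_one_or y with rfl | rfl <;>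
    simp

theorem two_mul_units_ne_zero (hn : 3 ≤ n) (x : ℤˣ) : 2 * ((x : ℤ) : ZMod n) ≠ 0 := by
  intro h
  apply two_ne_zero' hn
  linear_combination ((x : ℤ) : ZMod n) * h - 2 * units_mul_self_cast (n := n) x

theorem two_add_two_ne_zero {q : ZMod n} (hq : 2 * (q ^ 2 - 1) ≠ 0) (x y : ℤˣ) :
    2 * ((x : ℤ) : ZMod n) + 2 * ((y : ℤ) : ZMod n) * q ≠ 0 := by
  intro h
  apply hq
  have hx := units_mul_self_cast (n := n) x
  have hy := units_mul_self_cast (n := n) y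
  generalize ((x : ℤ) : ZMod n) = x at *
  generalize ((y : ℤ) : ZMod n) = y at *
  linear_combination (q * y - x) * h - 2 * q ^ 2 * hy + 2 * hx

theorem e_one (hs : 2 ≤ s) : e s n r 1 = 0 :=
  e_of_abs_lt one_ne_zero (by rw [abs_one]; exact_mod_cast hs)

theorem e_neg_one (hs : 2 ≤ s) : e s n r (-1) = 0 :=
  e_of_abs_lt (by norm_num) (by rw [abs_neg, abs_one]; exact_mod_cast hs)

theorem e_period : e s n r s = (r : ZMod n) ^ s := by
  have := e_add_period (s := s) (r := r) 0
  rwa [zero_add, e_zero, one_mul] at this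

theorem e_two_three_cases (hs : 2 ≤ s) :
    (s = 2 ∧ e s n r 2 = (r : ZMod n) ^ s ∧ e s n r 3 = 0) ∨
    (e s n r 2 = 0 ∧ (e s n r 3 = (r : ZMod n) ^ s ∨ e s n r 3 = 0)) := by
  obtain rfl | rfl | h : s = 2 ∨ s = 3 ∨ 4 ≤ s := by omega
  · left
    refine ⟨rfl, e_period, ?_⟩
    have := e_add_period (s := 2) (r := r) 1
    rw [e_one hs, zero_mul] at this
    exact this
  · exact Or.inr ⟨e_of_abs_lt (by norm_num) (by norm_num), Or.inl e_period⟩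
  · have h' : (4 : ℤ) ≤ s := by exact_mod_cast h
    refine Or.inr ⟨e_of_abs_lt (by norm_num) ?_, Or.inr (e_of_abs_lt (by norm_num) ?_)⟩
    · rw [abs_of_pos (by norm_num)]; omega
    · rw [abs_of_pos (by norm_num)]; omega

theorem e_two_two : e 2 n r 2 = (r : ZMod n) ^ 2 := e_period

theorem e_two_three : e 2 n r 3 = 0 := e_of_not_dvd (by decide)

theorem e_two_four : e 2 n r 4 = ((r : ZMod n) ^ 2) ^ 2 := by
  have := e_add_period (s := 2) (r := r) 2
  rw [e_two_two, ← pow_two] at this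
  exact this

theorem e_two_five : e 2 n r 5 = 0 := e_of_not_dvd (by decide)

theorem e_two_six : e 2 n r 6 = ((r : ZMod n) ^ 2) ^ 3 := by
  have := e_add_period (s := 2) (r := r) 4
  rw [e_two_four, ← pow_succ] at this
  exact this

theorem e_two_seven : e 2 n r 7 = 0 := e_of_not_dvd (by decide)

theorem eight_ne_zero (hn : 3 ≤ n) (hq : 2 * (((r : ZMod n) ^ s) ^ 2 - 1) ≠ 0) :
    (8 : ZMod n) ≠ 0 := by
  intro h
  apply hq
  rw [pow_right_comm, pow_eq_one_of_eight_eq_zero hn r h]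
  simp

/-- The relations between the powers of `r ^ s` that can be read off from a closed walk of length
`8` which starts with three arcs that raise the level. The first is due to walks whose total level
change is `0`, the other two to walks that wind once around. -/
theorem relation_of_up_up_up (hn : 3 ≤ n) (hs : 2 ≤ s)
    (hms : m = 3 ∧ s = 2 ∨ m = 4 ∧ s = 2 ∨ 9 ≤ m * s)
    (hq : 2 * (((r : ZMod n) ^ s) ^ 2 - 1) ≠ 0) {d a : ℕ → ℤˣ}
    (hd0 : d 0 = 1) (hd1 : d 1 = 1) (hd2 : d 2 = 1)
    (hnb : ∀ j, d (j + 1) = -d j → a (j + 1) = a j)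
    (hdvd : ((m * s : ℕ) : ℤ) ∣ ∑ i ∈ Finset.range 8, (d i : ℤ))
    (heq : ∀ c : ℤ, ∑ i ∈ Finset.range 8, ((a i : ℤ) : ZMod n) * e s n r (edgeLevel d i - c) = 0)
    (hwrap : ∑ i ∈ Finset.range 8, (d i : ℤ) = 0 → d 8 = d 0 ∧ a 8 = a 0) :
    (s = 2 ∧ (2 * ((a 0 : ℤ) : ZMod n) + 4 * ((a 2 : ℤ) : ZMod n) * (r : ZMod n) ^ s = 0 ∨
      4 * ((a 0 : ℤ) : ZMod n) + 2 * ((a 2 : ℤ) : ZMod n) * (r : ZMod n) ^ s = 0)) ∨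
    (m = 3 ∧ s = 2 ∧ ∃ b : ℕ → ℤˣ, ((b 0 : ℤ) : ZMod n) + ((b 1 : ℤ) : ZMod n) * (r : ZMod n) ^ s +
      ((b 2 : ℤ) : ZMod n) * ((r : ZMod n) ^ s) ^ 2 = 0) ∨
    (m = 4 ∧ s = 2 ∧ ∃ b : ℕ → ℤˣ, ((b 0 : ℤ) : ZMod n) + ((b 1 : ℤ) : ZMod n) * (r : ZMod n) ^ s +
      ((b 2 : ℤ) : ZMod n) * ((r : ZMod n) ^ s) ^ 2 +
      ((b 3 : ℤ) : ZMod n) * ((r : ZMod n) ^ s) ^ 3 = 0) := by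
  have he0 := e_zero (s := s) (r := r)
  have he1 := e_one (s := s) (r := r) hs
  have he1' := e_neg_one (s := s) (r := r) hs
  have hne1 : ∀ x y z w : ℤˣ, 2 * ((x : ℤ) : ZMod n) +
      (((y : ℤ) : ZMod n) + ((z : ℤ) : ZMod n)) * e s n r 2 +
      2 * ((w : ℤ) : ZMod n) * e s n r 3 ≠ 0 := by
    intro x y z w h
    rcases e_two_three_cases (r := r) hs with ⟨-, h2, h3⟩ | ⟨h2, h3 | h3⟩ <;> rw [h2, h3] at h
    · obtain rfl | rfl : z = y ∨ z = -y := units_eq_or_eq_neg z y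
      · exact two_add_two_ne_zero hq x z (by linear_combination h)
      · exact two_mul_units_ne_zero hn x (by push_cast at h; linear_combination h)
    · exact two_add_two_ne_zero hq x w (by linear_combination h)
    · exact two_mul_units_ne_zero hn x (by linear_combination h)
  have hne2 : ∀ x y : ℤˣ, 2 * ((x : ℤ) : ZMod n) + 2 * ((y : ℤ) : ZMod n) * e s n r 2 ≠ 0 := by
    intro x y h
    rcases e_two_three_cases (r := r) hs with ⟨-, h2, h3⟩ | ⟨h2, h3⟩ <;> rw [h2] at h
    · exact two_add_two_ne_zero hq x y h
    · exact two_mul_units_ne_zero hn x (by linear_combination h)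
  have hs2 : ∀ x y : ℤˣ, (2 * ((x : ℤ) : ZMod n) + 4 * ((y : ℤ) : ZMod n) * e s n r 2 = 0 ∨
      4 * ((x : ℤ) : ZMod n) + 2 * ((y : ℤ) : ZMod n) * e s n r 2 = 0) →
      s = 2 ∧ e s n r 2 = (r : ZMod n) ^ s := by
    intro x y h
    rcases e_two_three_cases (r := r) hs with ⟨h1, h2, -⟩ | ⟨h2, -⟩
    · exact ⟨h1, h2⟩
    · rw [h2] at h
      rcases h with h | h
      · exact absurd (by linear_combination h) (two_mul_units_ne_zero hn x)
      · refine absurd ?_ (eight_ne_zero hn hq)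
        linear_combination 2 * ((x : ℤ) : ZMod n) * h - 8 * units_mul_self_cast (n := n) x
  have hpar : ∀ i, ∃ k : ℤ, (d i : ℤ) = 2 * k - 1 ∧ 0 ≤ k ∧ k ≤ 1 := by
    intro i
    rcases Int.units_eq_one_or (d i) with h | h
    · exact ⟨1, by simp [h], by norm_num, by norm_num⟩
    · exact ⟨0, by simp [h], by norm_num, by norm_num⟩
  have hsum : ∑ i ∈ Finset.range 8, (d i : ℤ) = 0 ∨
      m = 3 ∧ s = 2 ∧ ∑ i ∈ Finset.range 8, (d i : ℤ) = 6 ∨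
      m = 4 ∧ s = 2 ∧ ∑ i ∈ Finset.range 8, (d i : ℤ) = 8 := by
    have hS : ∑ i ∈ Finset.range 8, (d i : ℤ) = 3 + d 3 + d 4 + d 5 + d 6 + d 7 := by
      simp [Finset.sum_range_succ, hd0, hd1, hd2]
    obtain ⟨k3, h3⟩ := hpar 3
    obtain ⟨k4, h4⟩ := hpar 4
    obtain ⟨k5, h5⟩ := hpar 5
    obtain ⟨k6, h6⟩ := hpar 6
    obtain ⟨k7, h7⟩ := hpar 7
    rcases hms with ⟨rfl, rfl⟩ | ⟨rfl, rfl⟩ | h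
    · push_cast at hdvd; omega
    · push_cast at hdvd; omega
    · left
      refine Int.eq_zero_of_abs_lt_dvd hdvd ?_
      have : (9 : ℤ) ≤ (m * s : ℕ) := by exact_mod_cast h
      rw [abs_lt]; omega
  rcases hsum with hsum | ⟨rfl, rfl, hsum⟩ | ⟨rfl, rfl, hsum⟩
  · -- total level change `0`: one of the last five steps goes up, and the signs of the edges over
    -- a suitable coordinate cannot cancel, except in the two cases of the first relation
    obtain ⟨hd8, ha8⟩ := hwrap hsum
    rw [hd0] at hd8
    simp only [Finset.sum_range_succ, Finset.sum_range_zero, hd0, hd1, hd2] at hsum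
    rcases Int.units_eq_one_or (d 3) with h3 | h3 <;>
    rcases Int.units_eq_one_or (d 4) with h4 | h4 <;>
    rcases Int.units_eq_one_or (d 5) with h5 | h5 <;>
    rcases Int.units_eq_one_or (d 6) with h6 | h6 <;>
    rcases Int.units_eq_one_or (d 7) with h7 | h7 <;>
    simp [h3, h4, h5, h6, h7] at hsum
    all_goals
      have n2 := hnb 2
      have n3 := hnb 3
      have n4 := hnb 4
      have n5 := hnb 5
      have n6 := hnb 6
      have n7 := hnb 7
      simp [hd2, h3, h4, h5, h6, h7, hd8, ha8] at n2 n3 n4 n5 n6 n7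
      have c0 := heq 0
      have c1 := heq (-1)
      simp [Finset.sum_range_succ, edgeLevel, edgeShift_one, edgeShift_neg_one, hd0, hd1, hd2,
        h3, h4, h5, h6, h7, he0, he1, he1'] at c0 c1
    · -- the levels are `0, 1, 2, 3, 3, 2, 1, 0`
      rw [n3, ← n7] at c0
      exact absurd (by linear_combination c0) (hne1 (a 0) (a 2) (a 5) (a 3))
    · -- the levels are `0, 1, 2, 2, 2, 2, 1, 0`
      rw [n4, n3, n2, ← n7] at c0
      obtain ⟨rfl, h⟩ := hs2 (a 0) (a 2) (Or.inl (by linear_combination c0))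
      exact Or.inl ⟨rfl, Or.inl (by rw [← h]; linear_combination c0)⟩
    · -- the levels are `0, 1, 2, 2, 1, 1, 1, 0`
      rw [n2, ← n7] at c0
      exact absurd (by linear_combination c0) (hne2 (a 0) (a 2))
    · -- the levels are `0, 1, 2, 2, 1, 0, 0, 0`
      rw [← n5, ← n6, ← n7, n2] at c0
      obtain ⟨rfl, h⟩ := hs2 (a 0) (a 2) (Or.inr (by linear_combination c0))
      exact Or.inl ⟨rfl, Or.inr (by rw [← h]; linear_combination c0)⟩
    · -- the levels are `0, 1, 2, 2, 1, 0, -1, -1`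
      rw [n2, n6] at c1
      exact absurd (by linear_combination c1) (hne1 (a 6) (a 1) (a 4) (a 2))
  · -- once around `6` levels: one step goes down, and the coordinate of the opposite parity carries
    -- exactly three edges
    refine Or.inr (Or.inl ⟨rfl, rfl, ?_⟩)
    simp only [Finset.sum_range_succ, Finset.sum_range_zero, hd0, hd1, hd2] at hsum
    rcases Int.units_eq_one_or (d 3) with h3 | h3 <;>
    rcases Int.units_eq_one_or (d 4) with h4 | h4 <;>
    rcases Int.units_eq_one_or (d 5) with h5 | h5 <;>
    rcases Int.units_eq_one_or (d 6) with h6 | h6 <;>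
    rcases Int.units_eq_one_or (d 7) with h7 | h7 <;>
    simp [h3, h4, h5, h6, h7] at hsum
    all_goals
      have c0 := heq 0
      have c1 := heq 1
      simp [Finset.sum_range_succ, edgeLevel, edgeShift_one, edgeShift_neg_one, hd0, hd1, hd2,
        h3, h4, h5, h6, h7, he0, he1, he1', e_two_two, e_two_three, e_two_four, e_two_five]
        at c0 c1
    · exact ⟨fun i => [a 1, a 3, a 5].getD i 1, by simpa using c1⟩
    · exact ⟨fun i => [a 0, a 2, a 4].getD i 1, by simpa using c0⟩
    · exact ⟨fun i => [a 1, a 3, a 7].getD i 1, by simpa using c1⟩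
    · exact ⟨fun i => [a 0, a 2, a 6].getD i 1, by simpa using c0⟩
    · exact ⟨fun i => [a 1, a 5, a 7].getD i 1, by simpa using c1⟩
  · -- once around `8` levels: all steps go up
    refine Or.inr (Or.inr ⟨rfl, rfl, ?_⟩)
    simp only [Finset.sum_range_succ, Finset.sum_range_zero, hd0, hd1, hd2] at hsum
    have h3 : d 3 = 1 ∧ d 4 = 1 ∧ d 5 = 1 ∧ d 6 = 1 ∧ d 7 = 1 := by
      simp only [← Units.val_inj, Units.val_one] at *
      obtain ⟨k3, h3⟩ := hpar 3
      obtain ⟨k4, h4⟩ := hpar 4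
      obtain ⟨k5, h5⟩ := hpar 5
      obtain ⟨k6, h6⟩ := hpar 6
      obtain ⟨k7, h7⟩ := hpar 7
      omega
    obtain ⟨h3, h4, h5, h6, h7⟩ := h3
    have c0 := heq 0
    simp [Finset.sum_range_succ, edgeLevel, edgeShift_one, hd0, hd1, hd2,
      h3, h4, h5, h6, h7, he0, he1, e_two_two, e_two_three, e_two_four, e_two_five, e_two_six,
        e_two_seven] at c0
    exact ⟨fun i => [a 0, a 2, a 4, a 6].getD i 1, by simpa using c0⟩

theorem dvd_of_natCast_eq_zero {k : ℕ} (hk : 0 < k) (h : (k : ZMod n) = 0) : n ∣ k ∧ n ≤ k := by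
  rw [ZMod.natCast_eq_zero_iff] at h
  exact ⟨h, Nat.le_of_dvd hk h⟩

/-- Modulo `30` fourth powers of units are `1`. -/
theorem thirty_ne_zero (hn : 3 ≤ n) (hq : 2 * (((r : ZMod n) ^ 2) ^ 2 - 1) ≠ 0) :
    (30 : ZMod n) ≠ 0 := by
  intro h
  obtain ⟨h1, h2⟩ := dvd_of_natCast_eq_zero (k := 30) (by norm_num) (by exact_mod_cast h)
  apply hq
  have hinv : (r : ZMod n) * ((r⁻¹ : (ZMod n)ˣ) : ZMod n) = 1 := by simp
  generalize (r : ZMod n) = x at *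
  generalize ((r⁻¹ : (ZMod n)ˣ) : ZMod n) = y at *
  clear h hq
  obtain rfl | rfl | rfl | rfl | rfl | rfl :
      n = 3 ∨ n = 5 ∨ n = 6 ∨ n = 10 ∨ n = 15 ∨ n = 30 := by
    have h3 : n ∈ Nat.divisors 30 := by simpa using h1
    have h4 : Nat.divisors 30 = {1, 2, 3, 5, 6, 10, 15, 30} := by decide
    rw [h4] at h3
    simp at h3
    omega
  all_goals revert x y; decide

theorem six_ne_zero' (hn : 3 ≤ n) (hq : 2 * (((r : ZMod n) ^ 2) ^ 2 - 1) ≠ 0) :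
    (6 : ZMod n) ≠ 0 :=
  fun h => thirty_ne_zero hn hq (by linear_combination 5 * h)

theorem ten_ne_zero (hn : 3 ≤ n) (hq : 2 * (((r : ZMod n) ^ 2) ^ 2 - 1) ≠ 0) :
    (10 : ZMod n) ≠ 0 :=
  fun h => thirty_ne_zero hn hq (by linear_combination 3 * h)

theorem four_ne_zero' (hn : 3 ≤ n) (hq : 2 * (((r : ZMod n) ^ s) ^ 2 - 1) ≠ 0) :
    (4 : ZMod n) ≠ 0 :=
  fun h => eight_ne_zero hn hq (by linear_combination 2 * h)

theorem mul_units_ne_zero {k : ZMod n} (hk : k ≠ 0) (x : ℤˣ) : k * ((x : ℤ) : ZMod n) ≠ 0 := by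
  intro h
  apply hk
  linear_combination ((x : ℤ) : ZMod n) * h - k * units_mul_self_cast (n := n) x

/-- The data `d`, `a` of a closed walk of length `6` do not begin with a step down and a step up,
if `m = 3` and `s = 2`. -/
theorem not_down_up_of_six (hn : 3 ≤ n) (hq : 2 * (((r : ZMod n) ^ 2) ^ 2 - 1) ≠ 0)
    {d a : ℕ → ℤˣ} (hd0 : d 0 = -1) (hd1 : d 1 = 1)
    (hnb : ∀ j, d (j + 1) = -d j → a (j + 1) = a j)
    (hdvd : ((3 * 2 : ℕ) : ℤ) ∣ ∑ i ∈ Finset.range 6, (d i : ℤ))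
    (heq : ∀ c : ℤ, ∑ i ∈ Finset.range 6, ((a i : ℤ) : ZMod n) * e 2 n r (edgeLevel d i - c) = 0) :
    False := by
  have he0 := e_zero (s := 2) (r := r)
  have he1 := e_one (s := 2) (r := r) le_rfl
  have he1' := e_neg_one (s := 2) (r := r) le_rfl
  simp only [Finset.sum_range_succ, Finset.sum_range_zero, hd0, hd1] at hdvd
  have n0 := hnb 0 (by simp [hd0, hd1])
  rcases Int.units_eq_one_or (d 2) with h2 | h2 <;>
  rcases Int.units_eq_one_or (d 3) with h3 | h3 <;>
  rcases Int.units_eq_one_or (d 4) with h4 | h4 <;>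
  rcases Int.units_eq_one_or (d 5) with h5 | h5 <;>
  norm_num [h2, h3, h4, h5] at hdvd
  -- `n i` says that the signs agree at a change of direction, `c k` is the cancellation of signs in
  -- one coordinate; in each pattern some coordinate gives a contradiction
  all_goals
    have n1 := hnb 1
    have n2 := hnb 2
    have n3 := hnb 3
    have n4 := hnb 4
    simp [hd1, h2, h3, h4, h5] at n0 n1 n2 n3 n4
    have c0 := heq 0
    have c1 := heq (-1)
    have c2 := heq (-2)
    simp [Finset.sum_range_succ, edgeLevel, edgeShift_one, edgeShift_neg_one, hd0, hd1, h2,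
      h3, h4, h5, he0, he1, he1', e_two_two] at c0 c1 c2
  · rw [n0, n3] at c1
    exact two_add_two_ne_zero hq (a 0) (a 3) (by linear_combination c1)
  · rw [n0] at c1
    exact two_mul_units_ne_zero hn (a 0) (by linear_combination c1)
  · rw [n2] at c0
    exact two_mul_units_ne_zero hn (a 2) (by linear_combination c0)
  · rw [n4] at c0
    exact two_mul_units_ne_zero hn (a 4) (by linear_combination c0)
  · rw [n4, n3, n2, n1, n0] at c1
    exact mul_units_ne_zero (six_ne_zero' hn hq) (a 0) (by linear_combination c1)
  · rw [n3] at c2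
    exact two_mul_units_ne_zero hn (a 3) (by linear_combination c2)

/-- A closed walk of length `8` does not begin with an alternating path of length `3`, if `m = 4`,
`s = 2` and `2 r^2 ≠ ±4`, `4 r^2 ≠ ±2`. -/
theorem not_up_down_up (hn : 3 ≤ n) (hq : 2 * (((r : ZMod n) ^ 2) ^ 2 - 1) ≠ 0)
    (hsp : ∀ x y : ℤˣ, 2 * ((x : ℤ) : ZMod n) + 4 * ((y : ℤ) : ZMod n) * (r : ZMod n) ^ 2 ≠ 0 ∧
      4 * ((x : ℤ) : ZMod n) + 2 * ((y : ℤ) : ZMod n) * (r : ZMod n) ^ 2 ≠ 0)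
    {d a : ℕ → ℤˣ} (hd0 : d 0 = 1) (hd1 : d 1 = -1) (hd2 : d 2 = 1)
    (hnb : ∀ j, d (j + 1) = -d j → a (j + 1) = a j)
    (hdvd : ((4 * 2 : ℕ) : ℤ) ∣ ∑ i ∈ Finset.range 8, (d i : ℤ))
    (heq : ∀ c : ℤ, ∑ i ∈ Finset.range 8, ((a i : ℤ) : ZMod n) * e 2 n r (edgeLevel d i - c) = 0)
    (hwrap : ∑ i ∈ Finset.range 8, (d i : ℤ) = 0 → d 8 = d 0 ∧ a 8 = a 0) :
    False := by
  have he0 := e_zero (s := 2) (r := r)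
  have he1 := e_one (s := 2) (r := r) le_rfl
  have he1' := e_neg_one (s := 2) (r := r) le_rfl
  simp only [Finset.sum_range_succ, Finset.sum_range_zero, hd0, hd1, hd2] at hdvd hwrap
  have n0 := hnb 0 (by simp [hd0, hd1])
  have n1 := hnb 1 (by simp [hd1, hd2])
  rcases Int.units_eq_one_or (d 3) with h3 | h3 <;>
  rcases Int.units_eq_one_or (d 4) with h4 | h4 <;>
  rcases Int.units_eq_one_or (d 5) with h5 | h5 <;>
  rcases Int.units_eq_one_or (d 6) with h6 | h6 <;>
  rcases Int.units_eq_one_or (d 7) with h7 | h7 <;>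
  norm_num [h3, h4, h5, h6, h7] at hdvd
  -- as for walks of length `6`, in each pattern some coordinate gives a contradiction
  all_goals
    obtain ⟨hd8, ha8⟩ := hwrap (by norm_num [h3, h4, h5, h6, h7])
    have n2 := hnb 2
    have n3 := hnb 3
    have n4 := hnb 4
    have n5 := hnb 5
    have n6 := hnb 6
    have n7 := hnb 7
    simp [hd2, h3, h4, h5, h6, h7, hd8, ha8] at n0 n1 n2 n3 n4 n5 n6 n7
    have c0 := heq 0
    have c1 := heq 1
    have c2 := heq (-1)
    have c3 := heq (-2)
    simp [Finset.sum_range_succ, edgeLevel, edgeShift_one, edgeShift_neg_one, hd0, hd1, hd2,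
      h3, h4, h5, h6, h7, he0, he1, he1', e_two_two] at c0 c1 c2 c3
  · rw [n4, ← n7, n1, n0] at c0
    exact (hsp (a 0) (a 4)).2 (by linear_combination c0)
  · rw [n5, n4, n3] at c1
    exact mul_units_ne_zero (four_ne_zero' hn hq) (a 3) (by linear_combination c1)
  · rw [n3] at c1
    exact two_mul_units_ne_zero hn (a 3) (by linear_combination c1)
  · rw [n3, n6] at c2
    exact two_add_two_ne_zero hq (a 6) (a 3) (by linear_combination c2)
  · rw [n5] at c1
    exact two_mul_units_ne_zero hn (a 5) (by linear_combination c1)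
  · rw [← n7, n5, n4, n3, n2, n1, n0] at c0
    exact mul_units_ne_zero (eight_ne_zero hn hq) (a 0) (by linear_combination c0)
  · rw [n6] at c2
    exact two_mul_units_ne_zero hn (a 6) (by linear_combination c2)
  · rw [n4] at c2
    exact two_mul_units_ne_zero hn (a 4) (by linear_combination c2)
  · rw [n6, n5, n4] at c2
    exact mul_units_ne_zero (four_ne_zero' hn hq) (a 4) (by linear_combination c2)
  · rw [n5, n2, n1, n0] at c3
    exact (hsp (a 5) (a 0)).1 (by linear_combination c3)

/-- For given `x`, one of the two signs `y` avoids `2 x + 4 y r^2 = 0` and `4 x + 2 y r^2 = 0`. -/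
theorem exists_sign_not_special (hn : 3 ≤ n) (hq : 2 * (((r : ZMod n) ^ 2) ^ 2 - 1) ≠ 0)
    (x : ℤˣ) : ∃ y : ℤˣ, 2 * ((x : ℤ) : ZMod n) + 4 * ((y : ℤ) : ZMod n) * (r : ZMod n) ^ 2 ≠ 0 ∧
      4 * ((x : ℤ) : ZMod n) + 2 * ((y : ℤ) : ZMod n) * (r : ZMod n) ^ 2 ≠ 0 := by
  by_contra! h
  have h1 := h 1
  have h2 := h (-1)
  push_cast at h1 h2
  have h4 := mul_units_ne_zero (four_ne_zero' hn hq) x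
  have h8 := mul_units_ne_zero (eight_ne_zero hn hq) x
  have h10 := mul_units_ne_zero (ten_ne_zero hn hq) x
  by_cases h3 : 2 * ((x : ℤ) : ZMod n) + 4 * 1 * (r : ZMod n) ^ 2 = 0 <;>
  by_cases h5 : 2 * ((x : ℤ) : ZMod n) + 4 * (-1) * (r : ZMod n) ^ 2 = 0
  · exact h4 (by linear_combination h3 + h5)
  · exact h10 (by linear_combination h3 + 2 * h2 h5)
  · exact h10 (by linear_combination h5 + 2 * h1 h3)
  · exact h8 (by linear_combination h1 h3 + h2 h5)

theorem two_mul_ne {q : ZMod n} (hq : 2 * (q ^ 2 - 1) ≠ 0) (x : ℤˣ) :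
    2 * q ≠ 2 * ((x : ℤ) : ZMod n) := fun h =>
  hq (by linear_combination (q + ((x : ℤ) : ZMod n)) * h + 2 * units_mul_self_cast (n := n) x)

/-- A relation between the first four powers of `q` with coefficients `±1` has the shape
`1 ± q + q^2 ± q^3 = 0`. -/
theorem relation_normal_form {q : ZMod n} (h2 : (2 : ZMod n) ≠ 0) (hq : 2 * (q ^ 2 - 1) ≠ 0)
    (hq4 : q ^ 4 = 1 ∨ q ^ 4 = -1) {b : ℕ → ℤˣ}
    (h : ((b 0 : ℤ) : ZMod n) + ((b 1 : ℤ) : ZMod n) * q + ((b 2 : ℤ) : ZMod n) * q ^ 2 +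
      ((b 3 : ℤ) : ZMod n) * q ^ 3 = 0) :
    q ^ 4 = 1 ∧ ∃ c : ℤˣ, 1 + ((c : ℤ) : ZMod n) * q + q ^ 2 + ((c : ℤ) : ZMod n) * q ^ 3 = 0 := by
  have h0 := units_mul_self_cast (n := n) (b 0)
  have hx := two_mul_ne hq (b 0 * b 1)
  have hxx := units_mul_self_cast (n := n) (b 0 * b 1)
  -- after division by `b 0` the relation reads `1 + t q + …` with `t = b 0 * b 1`
  have hb1 : ((b 1 : ℤ) : ZMod n) = ((b 0 : ℤ) : ZMod n) * ((b 0 * b 1 : ℤˣ) : ℤ) := by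
    push_cast
    linear_combination -((b 1 : ℤ) : ZMod n) * h0
  obtain ⟨c, hc⟩ : ∃ c, c = b 0 * b 1 := ⟨_, rfl⟩
  rw [← hc] at hx hxx hb1
  rcases units_eq_or_eq_neg (b 2) (b 0) with h2' | h2' <;>
  rcases units_eq_or_eq_neg (b 3) (b 1) with h3' | h3' <;>
  rw [h2', h3'] at h <;> push_cast at h <;> rw [hb1] at h <;>
  generalize ((b 0 : ℤ) : ZMod n) = x at * <;>
  generalize ht : ((c : ℤ) : ZMod n) = t at *
  · have hP : 1 + t * q + q ^ 2 + t * q ^ 3 = 0 := by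
      linear_combination x * h - (1 + t * q + q ^ 2 + t * q ^ 3) * h0
    exact ⟨by linear_combination (t * q - 1) * hP - (q ^ 4 + q ^ 2) * hxx, c, by rw [ht]; exact hP⟩
  · exfalso
    have hP : 1 + t * q + q ^ 2 - t * q ^ 3 = 0 := by
      linear_combination x * h - (1 + t * q + q ^ 2 - t * q ^ 3) * h0
    have hQ : 1 - 2 * t * q ^ 3 + q ^ 4 = 0 := by
      linear_combination (1 - t * q) * hP + (q ^ 2 - q ^ 4) * hxx
    rcases hq4 with h4 | h4
    · exact hx (by linear_combination q * hQ - (q - 2 * t) * h4)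
    · exact h2 (by linear_combination t * q * hQ + 2 * q ^ 4 * hxx + (2 - t * q) * h4)
  · exfalso
    have hP : 1 + t * q - q ^ 2 + t * q ^ 3 = 0 := by
      linear_combination x * h - (1 + t * q - q ^ 2 + t * q ^ 3) * h0
    have hQ : 1 - 2 * q ^ 2 + 2 * t * q ^ 3 - q ^ 4 = 0 := by
      linear_combination (1 - t * q) * hP + (q ^ 2 + q ^ 4) * hxx
    rcases hq4 with h4 | h4
    · exact hx (by
        linear_combination t * q ^ 2 * hQ - (2 * q - 2 * t - t * q ^ 2) * h4 - 2 * q ^ 5 * hxx)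
    · exact hx (by
        linear_combination q ^ 3 * (1 + t * q) * hQ +
          (q ^ 3 * (1 + t * q) - 2 * t ^ 2 * q ^ 3 + 2 * q - 2 * t) * h4 + 2 * q ^ 3 * hxx)
  · exfalso
    have hP : 1 + t * q - q ^ 2 - t * q ^ 3 = 0 := by
      linear_combination x * h - (1 + t * q - q ^ 2 - t * q ^ 3) * h0
    have hQ : 1 - 2 * q ^ 2 + q ^ 4 = 0 := by
      linear_combination (1 - t * q) * hP + (q ^ 2 - q ^ 4) * hxx
    rcases hq4 with h4 | h4
    · exact hq (by linear_combination h4 - hQ)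
    · exact h2 (by linear_combination q ^ 2 * hQ - (q ^ 2 - 2) * h4)

/-- A relation `1 ± q + q^2 ± q^3 = 0` with `q = r^2` is incompatible with `2 q = ±4` and with
`4 q = ±2`. -/
theorem not_special_of_pow_four (hn : 3 ≤ n) (hq : 2 * (((r : ZMod n) ^ 2) ^ 2 - 1) ≠ 0)
    (h4 : ((r : ZMod n) ^ 2) ^ 4 = 1) (x y : ℤˣ) :
    2 * ((x : ℤ) : ZMod n) + 4 * ((y : ℤ) : ZMod n) * (r : ZMod n) ^ 2 ≠ 0 ∧
      4 * ((x : ℤ) : ZMod n) + 2 * ((y : ℤ) : ZMod n) * (r : ZMod n) ^ 2 ≠ 0 := by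
  have hx := units_mul_self_cast (n := n) x
  have hy := units_mul_self_cast (n := n) y
  have h30 := thirty_ne_zero hn hq
  generalize (r : ZMod n) ^ 2 = q at *
  generalize ((x : ℤ) : ZMod n) = x at *
  generalize ((y : ℤ) : ZMod n) = y at *
  refine ⟨fun h => h30 ?_, fun h => h30 ?_⟩
  · linear_combination (2 * y * q - x) * (4 * q ^ 2 + 1) * h - 32 * h4 -
      8 * q ^ 2 * (4 * q ^ 2 + 1) * hy + 2 * (4 * q ^ 2 + 1) * hx
  · linear_combination -(y * q - 2 * x) * (q ^ 2 + 4) * h + 2 * h4 +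
      2 * q ^ 2 * (q ^ 2 + 4) * hy - 8 * (q ^ 2 + 4) * hx

/-! ### Images of the two arcs out of a vertex -/

/-- The coordinates of a path of length `3` that begins with a step down and a step up. -/
theorem exists_walk_fork [NeZero (m * s)] (hn : 3 ≤ n) (h3 : 3 ≤ m * s)
    (hr : (r : ZMod n) ^ (m * s) = 1 ∨ (r : ZMod n) ^ (m * s) = -1) {x y y' z : Vert m s n}
    (hy : Fwd m s n r x y) (hy' : Fwd m s n r x y') (hne : y ≠ y')
    (hz : (fullGraph m s n r).Adj y z) :
    ∃ (L : ℤ) (v : ZMod s → ZMod n) (d a : ℕ → ℤˣ), d 0 = -1 ∧ d 1 = 1 ∧ a 1 = a 0 ∧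
      ∀ j, arc3 y' x y z j = walk m s n r L v d a j := by
  have hxy := (adj_iff (by omega)).2 (Or.inl hy)
  have hxy' := (adj_iff (by omega)).2 (Or.inl hy')
  obtain ⟨L, v, d, a, h⟩ := exists_walk_arc3 (by omega) hr hxy'.symm hxy hz
  have hd0 : d 0 = -1 := by
    rw [← (fwd_walk_iff h3 hr L v d a 0).2, ← h, ← h]
    exact hy'
  have hd1 : d 1 = 1 := by
    rw [← (fwd_walk_iff h3 hr L v d a 1).1, ← h, ← h, arc3_two]
    exact hy
  refine ⟨L, v, d, a, hd0, hd1, ?_, h⟩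
  refine (walk_nb_iff (r := r) hn h3 L v d a 0).1 ?_ (by rw [hd0, hd1]; rfl)
  rw [← h, ← h, arc3_two]
  exact hne

theorem onClosedWalk_fork_up [NeZero (m * s)] [NeZero s] (hn : 3 ≤ n) (h3 : 3 ≤ m * s)
    (hr : (r : ZMod n) ^ (m * s) = 1 ∨ (r : ZMod n) ^ (m * s) = -1) {x y y' z : Vert m s n}
    (hy : Fwd m s n r x y) (hy' : Fwd m s n r x y') (hne : y ≠ y') (hz : Fwd m s n r y z) :
    OnClosedWalk (fullGraph m s n r) 8 3 (arc3 y' x y z) := by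
  obtain ⟨L, v, d, a, hd0, hd1, ha, h⟩ :=
    exists_walk_fork hn h3 hr hy hy' hne ((adj_iff (by omega)).2 (Or.inl hz))
  refine (onClosedWalk_down_up_up hn h3 hr hd0 hd1 ?_ ha).congr fun j _ => (h j).symm
  rw [← (fwd_walk_iff h3 hr L v d a 2).1, ← h, ← h, arc3_two, arc3_three]
  exact hz

theorem onClosedWalk_fork_down [NeZero (m * 2)] (hn : 3 ≤ n) (h3 : 3 ≤ m * 2)
    (hr : (r : ZMod n) ^ (m * 2) = 1 ∨ (r : ZMod n) ^ (m * 2) = -1) {x y y' z : Vert m 2 n}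
    (hy : Fwd m 2 n r x y) (hy' : Fwd m 2 n r x y') (hne : y ≠ y') (hz : Fwd m 2 n r z y)
    (hzx : z ≠ x) {b c : ℤˣ}
    (hsp : 2 * ((b : ℤ) : ZMod n) + 4 * ((c : ℤ) : ZMod n) * (r : ZMod n) ^ 2 = 0 ∨
      4 * ((b : ℤ) : ZMod n) + 2 * ((c : ℤ) : ZMod n) * (r : ZMod n) ^ 2 = 0) :
    OnClosedWalk (fullGraph m 2 n r) 8 3 (arc3 y' x y z) := by
  obtain ⟨L, v, d, a, hd0, hd1, ha, h⟩ :=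
    exists_walk_fork hn h3 hr hy hy' hne ((adj_iff (by omega)).2 (Or.inr hz))
  have hd2 : d 2 = -1 := by
    rw [← (fwd_walk_iff h3 hr L v d a 2).2, ← h, ← h, arc3_two, arc3_three]
    exact hz
  refine (onClosedWalk_down_up_down hn h3 hr hd0 hd1 hd2 ha ?_ hsp).congr fun j _ => (h j).symm
  rw [← ha]
  refine (walk_nb_iff (r := r) hn h3 L v d a 1).1 ?_ (by rw [hd1, hd2])
  rw [← h, ← h, arc3_three]
  exact hzx

/-- The relations of `relation_of_up_up_up` that come from walks winding once around. -/
def HasWindingRelation (m s n : ℕ) (r : (ZMod n)ˣ) : Prop :=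
  (m = 3 ∧ s = 2 ∧ ∃ b : ℕ → ℤˣ, ((b 0 : ℤ) : ZMod n) + ((b 1 : ℤ) : ZMod n) * (r : ZMod n) ^ s +
    ((b 2 : ℤ) : ZMod n) * ((r : ZMod n) ^ s) ^ 2 = 0) ∨
  (m = 4 ∧ s = 2 ∧ ∃ b : ℕ → ℤˣ, ((b 0 : ℤ) : ZMod n) + ((b 1 : ℤ) : ZMod n) * (r : ZMod n) ^ s +
    ((b 2 : ℤ) : ZMod n) * ((r : ZMod n) ^ s) ^ 2 +
    ((b 3 : ℤ) : ZMod n) * ((r : ZMod n) ^ s) ^ 3 = 0)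

/-- Among the directed paths of length `3` that extend a given directed path of length `2`, at
least one lies on no closed walk of length `8`, and this holds for every extension unless
`4 r^2 = ±2` or `2 r^2 = ±4`. -/
theorem exists_not_onClosedWalk_up [NeZero (m * s)] [NeZero s] (hn : 3 ≤ n) (hs : 2 ≤ s)
    (hr : (r : ZMod n) ^ (m * s) = 1 ∨ (r : ZMod n) ^ (m * s) = -1)
    (hms : m = 3 ∧ s = 2 ∨ m = 4 ∧ s = 2 ∨ 9 ≤ m * s)
    (hq : 2 * (((r : ZMod n) ^ s) ^ 2 - 1) ≠ 0) (hrel : ¬ HasWindingRelation m s n r)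
    {p q u : Vert m s n} (hpq : Fwd m s n r p q) (hqu : Fwd m s n r q u) :
    (∃ t, Fwd m s n r u t ∧ ¬ OnClosedWalk (fullGraph m s n r) 8 3 (arc3 p q u t)) ∧
    ((∀ t, Fwd m s n r u t → ¬ OnClosedWalk (fullGraph m s n r) 8 3 (arc3 p q u t)) ∨
      s = 2 ∧ ∃ b c : ℤˣ,
        2 * ((b : ℤ) : ZMod n) + 4 * ((c : ℤ) : ZMod n) * (r : ZMod n) ^ s = 0 ∨
        4 * ((b : ℤ) : ZMod n) + 2 * ((c : ℤ) : ZMod n) * (r : ZMod n) ^ s = 0) := by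
  have h3 : 3 ≤ m * s := by
    rcases hms with ⟨rfl, rfl⟩ | ⟨rfl, rfl⟩ | h <;> omega
  obtain ⟨L, v, rfl⟩ := exists_pt p
  obtain ⟨a₀, rfl⟩ := (fwd_pt_iff hr).1 hpq
  obtain ⟨a₁, rfl⟩ := (fwd_pt_iff hr).1 hqu
  have hout : ∀ t, Fwd m s n r (pt m s (L + 1 + 1) (v + a₀ • E s n r L + a₁ • E s n r (L + 1))) t →
      ∃ a₂ : ℤˣ, t = pt m s (L + 1 + 1 + 1)
        (v + a₀ • E s n r L + a₁ • E s n r (L + 1) + a₂ • E s n r (L + 1 + 1)) :=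
    fun t ht => (fwd_pt_iff hr).1 ht
  have key : ∀ a₂ : ℤˣ, OnClosedWalk (fullGraph m s n r) 8 3 (arc3 (pt m s L v)
      (pt m s (L + 1) (v + a₀ • E s n r L))
      (pt m s (L + 1 + 1) (v + a₀ • E s n r L + a₁ • E s n r (L + 1)))
      (pt m s (L + 1 + 1 + 1)
        (v + a₀ • E s n r L + a₁ • E s n r (L + 1) + a₂ • E s n r (L + 1 + 1)))) →
      s = 2 ∧ (2 * ((a₀ : ℤ) : ZMod n) + 4 * ((a₂ : ℤ) : ZMod n) * (r : ZMod n) ^ s = 0 ∨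
        4 * ((a₀ : ℤ) : ZMod n) + 2 * ((a₂ : ℤ) : ZMod n) * (r : ZMod n) ^ s = 0) := by
    rintro a₂ ⟨w, hw, hw'⟩
    obtain ⟨d, a, hpre, hnb, hdvd, heq, hwrap⟩ := hw.exists_data (l := 3) hn h3 hr (fun _ => 1)
      (fun i => [a₀, a₁, a₂].getD i 1) (L := L) (v := v) (by
        intro j hj
        rw [hw' j hj]
        interval_cases j
        · rw [walk_zero]; rfl
        · rw [walk_one]; simp [arc3, edgeShift]
        · rw [walk_succ]; simp [arc3, edgeShift, edgeLevel]
        · rw [walk_succ, arc3_three]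
          simp [edgeShift, edgeLevel, Finset.sum_range_succ, add_assoc])
    have h0 := hpre 0 (by norm_num)
    have h1 := hpre 1 (by norm_num)
    have h2 := hpre 2 (by norm_num)
    have := relation_of_up_up_up hn hs hms hq h0.1 h1.1 h2.1 hnb hdvd heq hwrap
    rw [h0.2, h2.2] at this
    exact this.resolve_right hrel
  constructor
  · obtain ⟨a₂, ha₂⟩ : ∃ a₂ : ℤˣ, ¬ (s = 2 ∧
        (2 * ((a₀ : ℤ) : ZMod n) + 4 * ((a₂ : ℤ) : ZMod n) * (r : ZMod n) ^ s = 0 ∨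
        4 * ((a₀ : ℤ) : ZMod n) + 2 * ((a₂ : ℤ) : ZMod n) * (r : ZMod n) ^ s = 0)) := by
      by_cases h : s = 2
      · subst h
        obtain ⟨a₂, h1, h2⟩ := exists_sign_not_special hn hq a₀
        exact ⟨a₂, fun h => h.2.elim h1 h2⟩
      · exact ⟨1, fun h' => h h'.1⟩
    exact ⟨_, (fwd_pt_iff hr).2 ⟨a₂, rfl⟩, fun h => ha₂ (key a₂ h)⟩
  · rw [or_iff_not_imp_right]
    intro hno t ht hcl
    obtain ⟨a₂, rfl⟩ := hout t ht
    exact hno ⟨(key a₂ hcl).1, a₀, a₂, (key a₂ hcl).2⟩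

theorem map_arc3 {V W : Type*} (f : V → W) (p q t u : V) (i : ℕ) :
    f (arc3 p q t u i) = arc3 (f p) (f q) (f t) (f u) i := by
  rcases i with _ | _ | i
  · rfl
  · rfl
  · simp only [arc3]
    split_ifs <;> rfl

/-- All upward extensions of the path `y', x, y` formed by two arcs out of `x` lie on closed walks
of length `8`, while a directed path has an upward extension that does not. The preimage of the
latter is an extension of `y', x, y` as well; if it goes down, either it still lies on such a walk, or
the same happens for both upward extensions, and `y` has too many in-neighbours. -/
theorem noMixing_of_not_hasWindingRelation [NeZero (m * s)] [NeZero s] (hn : 3 ≤ n) (hs : 2 ≤ s)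
    (hr : (r : ZMod n) ^ (m * s) = 1 ∨ (r : ZMod n) ^ (m * s) = -1)
    (hms : m = 3 ∧ s = 2 ∨ m = 4 ∧ s = 2 ∨ 9 ≤ m * s)
    (hq : 2 * (((r : ZMod n) ^ s) ^ 2 - 1) ≠ 0) (hrel : ¬ HasWindingRelation m s n r) :
    NoMixing m s n r := by
  have h3 : 3 ≤ m * s := by
    rcases hms with ⟨rfl, rfl⟩ | ⟨rfl, rfl⟩ | h <;> omega
  rintro Φ x y y' hy hy' hne ⟨hΦy, hΦy'⟩
  obtain ⟨⟨t, ht, htn⟩, hall⟩ := exists_not_onClosedWalk_up hn hs hr hms hq hrel hΦy' hΦy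
  -- the preimage of an out-neighbour of `Φ y` is a neighbour of `y` other than `x`
  have hpull : ∀ t, Fwd m s n r (Φ y) t → Φ.symm t ≠ x ∧
      (Fwd m s n r y (Φ.symm t) ∨ Fwd m s n r (Φ.symm t) y) := by
    intro t ht
    constructor
    · rintro rfl
      rw [RelIso.apply_symm_apply] at hΦy
      exact fwd_asymm h3 ht hΦy
    · rw [← adj_iff (by omega), ← Φ.map_adj_iff, RelIso.apply_symm_apply, adj_iff (by omega)]
      exact Or.inl ht
  have hpre : ∀ t, OnClosedWalk (fullGraph m s n r) 8 3 (arc3 y' x y (Φ.symm t)) →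
      OnClosedWalk (fullGraph m s n r) 8 3 (arc3 (Φ y') (Φ x) (Φ y) t) := by
    intro t h
    refine (h.map Φ).congr fun j _ => ?_
    exact (map_arc3 Φ _ _ _ _ j).trans (by rw [RelIso.apply_symm_apply])
  rcases hall with hall | ⟨rfl, b, c, hsp⟩
  · obtain ⟨t₁, t₂, ht, h1, h2⟩ := exists_out hn hr (Φ y)
    have hdown : ∀ t, Fwd m s n r (Φ y) t → Fwd m s n r (Φ.symm t) y := fun t ht =>
      (hpull t ht).2.resolve_left fun h =>
        hall t ht (hpre t (onClosedWalk_fork_up hn h3 hr hy hy' hne h))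
    rcases fwd_in_cases hr (hdown t₁ h1) (hdown t₂ h2) hy (Φ.symm.injective.ne ht) with h | h
    · exact (hpull t₁ h1).1 h.symm
    · exact (hpull t₂ h2).1 h.symm
  · rcases (hpull t ht).2 with h | h
    · exact htn (hpre t (onClosedWalk_fork_up hn h3 hr hy hy' hne h))
    · exact htn (hpre t (onClosedWalk_fork_down hn h3 hr hy hy' hne h (hpull t ht).1 hsp))

/-- If `m = 3`, `s = 2` and `±1 ± r^2 ± r^4 = 0`, directed paths of length `2` lie on closed walks
of length `6`, and the paths formed by two arcs out of a vertex do not. -/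
theorem noMixing_of_three [NeZero (3 * 2)] (hn : 3 ≤ n)
    (hr : (r : ZMod n) ^ (3 * 2) = 1 ∨ (r : ZMod n) ^ (3 * 2) = -1)
    (hq : 2 * (((r : ZMod n) ^ 2) ^ 2 - 1) ≠ 0) {b : ℕ → ℤˣ}
    (hrel : ((b 0 : ℤ) : ZMod n) + ((b 1 : ℤ) : ZMod n) * (r : ZMod n) ^ 2 +
      ((b 2 : ℤ) : ZMod n) * ((r : ZMod n) ^ 2) ^ 2 = 0) : NoMixing 3 2 n r := by
  have h3 : 3 ≤ 3 * 2 := by norm_num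
  rintro Φ x y y' hy hy' hne ⟨hΦy, hΦy'⟩
  have hadj : ∀ {y z}, Fwd 3 2 n r y z → (fullGraph 3 2 n r).Adj y z := fun h =>
    (adj_iff (by norm_num)).2 (Or.inl h)
  obtain ⟨L, v, d, a, h⟩ :=
    exists_walk_arc3 (by norm_num) hr (hadj hΦy') (hadj hΦy) (hadj hΦy).symm
  have hcl : OnClosedWalk (fullGraph 3 2 n r) 6 2 (fun i => Φ (arc3 y' x y x i)) := by
    refine (onClosedWalk_up_up_six (L := L) (v := v) (d := d) (a := a) hn hr ?_ ?_ hrel).congr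
      fun j _ => ?_
    · rw [← (fwd_walk_iff h3 hr L v d a 0).1, ← h, ← h]
      exact hΦy'
    · rw [← (fwd_walk_iff h3 hr L v d a 1).1, ← h, ← h, arc3_two]
      exact hΦy
    · rw [← h]
      exact (map_arc3 Φ _ _ _ _ j).symm
  obtain ⟨w, hw, hw'⟩ := (onClosedWalk_map_iff Φ).1 hcl
  obtain ⟨L, v, d, a, hd0, hd1, -, h⟩ := exists_walk_fork hn h3 hr hy hy' hne (hadj hy).symm
  obtain ⟨d', a', hpre, hnb, hdvd, heq, -⟩ := hw.exists_data (l := 2) hn h3 hr d a fun j hj => by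
    rw [hw' j hj, h]
  exact not_down_up_of_six hn hq ((hpre 0 (by norm_num)).1.trans hd0)
    ((hpre 1 (by norm_num)).1.trans hd1) hnb hdvd heq

/-! ### Alternating paths in the case `m = 4`, `s = 2` -/

theorem not_onClosedWalk_up_down_up [NeZero (4 * 2)] (hn : 3 ≤ n)
    (hr : (r : ZMod n) ^ (4 * 2) = 1 ∨ (r : ZMod n) ^ (4 * 2) = -1)
    (hq : 2 * (((r : ZMod n) ^ 2) ^ 2 - 1) ≠ 0)
    (hsp : ∀ x y : ℤˣ, 2 * ((x : ℤ) : ZMod n) + 4 * ((y : ℤ) : ZMod n) * (r : ZMod n) ^ 2 ≠ 0 ∧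
      4 * ((x : ℤ) : ZMod n) + 2 * ((y : ℤ) : ZMod n) * (r : ZMod n) ^ 2 ≠ 0)
    {p : ℕ → Vert 4 2 n} (h0 : Fwd 4 2 n r (p 0) (p 1)) (h1 : Fwd 4 2 n r (p 2) (p 1))
    (h2 : Fwd 4 2 n r (p 2) (p 3)) :
    ¬ OnClosedWalk (fullGraph 4 2 n r) 8 3 p := by
  have h3 : 3 ≤ 4 * 2 := by norm_num
  rintro ⟨w, hw, hw'⟩
  obtain ⟨L, v, hp⟩ := exists_pt (w 0)
  obtain ⟨d', a', h⟩ := exists_eq_walk (by norm_num) hr hw.adj hp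
  obtain ⟨d, a, hpre, hnb, hdvd, heq, hwrap⟩ := hw.exists_data (l := 3) hn h3 hr d' a'
    fun j _ => h j
  refine not_up_down_up hn hq hsp (a := a) (d := d) ?_ ?_ ?_ hnb hdvd heq hwrap
  · rw [(hpre 0 (by norm_num)).1, ← (fwd_walk_iff h3 hr L v d' a' 0).1, ← h, ← h,
      hw' 0 (by norm_num), hw' 1 (by norm_num)]
    exact h0
  · rw [(hpre 1 (by norm_num)).1, ← (fwd_walk_iff h3 hr L v d' a' 1).2, ← h, ← h,
      hw' 1 (by norm_num), hw' 2 (by norm_num)]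
    exact h1
  · rw [(hpre 2 (by norm_num)).1, ← (fwd_walk_iff h3 hr L v d' a' 2).1, ← h, ← h,
      hw' 2 (by norm_num), hw' 3 (by norm_num)]
    exact h2

/-- Directions that alternate, beginning with a step down. -/
def altDir (j : ℕ) : ℤˣ := if Even j then -1 else 1

theorem sum_altDir (j : ℕ) : ∑ i ∈ Finset.range j, (altDir i : ℤ) = if Even j then 0 else -1 := by
  induction j with
  | zero => simp
  | succ j ih =>
    rw [Finset.sum_range_succ, ih]
    by_cases h : Even j <;> simp [altDir, h, Nat.even_add_one]

theorem edgeLevel_altDir (j : ℕ) : edgeLevel altDir j = -1 := by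
  unfold edgeLevel
  rw [sum_altDir]
  by_cases h : Even j <;> simp [altDir, h, edgeShift]

theorem walk_altDir_period (L : ℤ) (v : ZMod s → ZMod n) (a : ℤˣ) {N : ℕ} (hN : Even N)
    (hnN : n ∣ N) : walk m s n r L v altDir (fun _ => a) N =
      walk m s n r L v altDir (fun _ => a) 0 := by
  unfold walk
  rw [sum_altDir, if_pos hN]
  simp only [edgeLevel_altDir, Finset.sum_const, Finset.card_range, Finset.range_zero,
    Finset.sum_empty, Finset.card_empty, zero_smul]
  congr 2
  ext l
  rw [Pi.smul_apply, nsmul_eq_mul, (ZMod.natCast_eq_zero_iff N n).2 hnN, zero_mul]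
  rfl

/-- An alternating path contains no `3`-arc of a closed walk of length `8`. -/
theorem not_onClosedWalk_altDir [NeZero (4 * 2)] (hn : 3 ≤ n)
    (hr : (r : ZMod n) ^ (4 * 2) = 1 ∨ (r : ZMod n) ^ (4 * 2) = -1)
    (hq : 2 * (((r : ZMod n) ^ 2) ^ 2 - 1) ≠ 0)
    (hsp : ∀ x y : ℤˣ, 2 * ((x : ℤ) : ZMod n) + 4 * ((y : ℤ) : ZMod n) * (r : ZMod n) ^ 2 ≠ 0 ∧
      4 * ((x : ℤ) : ZMod n) + 2 * ((y : ℤ) : ZMod n) * (r : ZMod n) ^ 2 ≠ 0)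
    (L : ℤ) (v : ZMod 2 → ZMod n) (a : ℕ → ℤˣ) (j : ℕ) :
    ¬ OnClosedWalk (fullGraph 4 2 n r) 8 3 (fun i => walk 4 2 n r L v altDir a (j + i)) := by
  have hf := fun i => fwd_walk_iff (m := 4) (s := 2) (by norm_num) hr L v altDir a i
  by_cases hj : Even j
  · intro h
    refine not_onClosedWalk_up_down_up hn hr hq hsp ?_ ?_ ?_ h.reverse
    · exact (hf (j + 2)).2.2 (by simp [altDir, hj, Nat.even_add_one])
    · exact (hf (j + 1)).1.2 (by simp [altDir, hj, Nat.even_add_one])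
    · exact (hf j).2.2 (by simp [altDir, hj])
  · refine not_onClosedWalk_up_down_up hn hr hq hsp ?_ ?_ ?_
    · exact (hf j).1.2 (by simp [altDir, hj])
    · exact (hf (j + 1)).2.2 (by simp [altDir, hj, Nat.even_add_one])
    · exact (hf (j + 2)).1.2 (by simp [altDir, hj, Nat.even_add_one])

/-- A walk that starts with two steps up, never turns back and contains no `3`-arc of a closed walk
of length `8` always goes up, and its signs satisfy a recursion. -/
theorem up_of_not_onClosedWalk [NeZero (4 * 2)] (hn : 3 ≤ n)
    (hr : (r : ZMod n) ^ (4 * 2) = 1 ∨ (r : ZMod n) ^ (4 * 2) = -1) {c : ℤˣ}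
    (hrel : 1 + ((c : ℤ) : ZMod n) * (r : ZMod n) ^ 2 + ((r : ZMod n) ^ 2) ^ 2 +
      ((c : ℤ) : ZMod n) * ((r : ZMod n) ^ 2) ^ 3 = 0)
    {L : ℤ} {v : ZMod 2 → ZMod n} {d a : ℕ → ℤˣ} (hd0 : d 0 = 1) (hd1 : d 1 = 1)
    (hnb : ∀ j, d (j + 1) = -d j → a (j + 1) = a j)
    (hno : ∀ j, ¬ OnClosedWalk (fullGraph 4 2 n r) 8 3 (fun i => walk 4 2 n r L v d a (j + i)))
    (j : ℕ) : d j = 1 ∧ a (j + 2) = -c * a j := by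
  have h3 : 3 ≤ 4 * 2 := by norm_num
  have step : ∀ j, d j = 1 → d (j + 1) = 1 → d (j + 2) = 1 ∧ a (j + 2) = -c * a j := by
    intro j h0 h1
    have hno' := hno j
    rw [funext fun i => walk_add L v d a j i] at hno'
    have h2 : d (j + 2) = 1 := by
      by_contra hne
      have h2 : d (j + 2) = -1 := (Int.units_eq_one_or _).resolve_left hne
      exact hno' (onClosedWalk_up_up_down hn h3 hr h0 h1 h2 (hnb (j + 1) (by rw [h1]; exact h2)))
    refine ⟨h2, ?_⟩
    rcases units_eq_or_eq_neg (a (j + 2)) (c * a j) with h | h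
    · exact absurd (onClosedWalk_up_up_up hn hr h0 h1 h2 h hrel) hno'
    · rw [h, neg_mul]
  have hd : ∀ j, d j = 1 ∧ d (j + 1) = 1 := by
    intro j
    induction j with
    | zero => exact ⟨hd0, hd1⟩
    | succ j ih => exact ⟨ih.2, (step j ih.1 ih.2).1⟩
  exact ⟨(hd j).1, (step j (hd j).1 (hd j).2).2⟩

theorem sum_pow_range_four_mul {q : ZMod n} (hq : q ^ 4 = 1) (t : ℕ) :
    ∑ i ∈ Finset.range (4 * t), q ^ i = t * (1 + q + q ^ 2 + q ^ 3) := by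
  induction t with
  | zero => simp
  | succ t ih =>
    rw [show 4 * (t + 1) = 4 * t + 1 + 1 + 1 + 1 by ring]
    simp only [Finset.sum_range_succ, ih]
    have : q ^ (4 * t) = 1 := by rw [pow_mul, hq, one_pow]
    simp only [pow_succ, this]
    push_cast
    ring

/-- Signs with `a (j + 2) = -c * a j` along a directed path of length `n` do not cancel. -/
theorem sum_ne_zero_of_recursion {t : ℕ} (hn : n = 8 * t) (ht : 0 < t)
    (hq4 : ((r : ZMod n) ^ 2) ^ 4 = 1) {c : ℤˣ}
    (hrel : 1 + ((c : ℤ) : ZMod n) * (r : ZMod n) ^ 2 + ((r : ZMod n) ^ 2) ^ 2 +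
      ((c : ℤ) : ZMod n) * ((r : ZMod n) ^ 2) ^ 3 = 0) {a : ℕ → ℤˣ}
    (ha : ∀ j, a (j + 2) = -c * a j) :
    ∑ i ∈ Finset.range n, ((a i : ℤ) : ZMod n) * e 2 n r i ≠ 0 := by
  intro h
  have hc := units_mul_self_cast (n := n) c
  have hodd : ∀ k : ℕ, e 2 n r ((2 * k + 1 : ℕ) : ℤ) = 0 := fun k =>
    e_of_not_dvd (by push_cast; omega)
  have heven : ∀ k : ℕ, e 2 n r ((2 * k : ℕ) : ℤ) = ((r : ZMod n) ^ 2) ^ k := by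
    intro k
    induction k with
    | zero => simp [e_zero]
    | succ k ih =>
      rw [pow_succ, ← ih, ← e_add_period]
      push_cast
      congr 1
  have hak : ∀ k : ℕ, ((a (2 * k) : ℤ) : ZMod n) =
      ((a 0 : ℤ) : ZMod n) * (-((c : ℤ) : ZMod n)) ^ k := by
    intro k
    induction k with
    | zero => simp
    | succ k ih =>
      rw [show 2 * (k + 1) = 2 * k + 2 by ring, ha, pow_succ]
      push_cast
      rw [ih]
      ring
  have hsum : ∀ k : ℕ, ∑ i ∈ Finset.range (2 * k), ((a i : ℤ) : ZMod n) * e 2 n r i =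
      ((a 0 : ℤ) : ZMod n) *
        ∑ i ∈ Finset.range k, (-((c : ℤ) : ZMod n) * (r : ZMod n) ^ 2) ^ i := by
    intro k
    induction k with
    | zero => simp
    | succ k ih =>
      rw [show 2 * (k + 1) = 2 * k + 1 + 1 by ring, Finset.sum_range_succ, Finset.sum_range_succ,
        Finset.sum_range_succ, ih, hodd, heven, hak, mul_pow]
      ring
  have h1 : ∑ i ∈ Finset.range (2 * (4 * t)), ((a i : ℤ) : ZMod n) * e 2 n r i = 0 := by
    rw [← mul_assoc, show 2 * 4 * t = n by omega]
    exact h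
  have hcq : (-((c : ℤ) : ZMod n) * (r : ZMod n) ^ 2) ^ 4 = 1 := by
    linear_combination ((c : ℤ) : ZMod n) ^ 4 * hq4 + (((c : ℤ) : ZMod n) ^ 2 + 1) * hc
  rw [hsum, sum_pow_range_four_mul hcq] at h1
  -- the geometric sum is `2 t (1 + r^4)`
  have h2 : (t : ZMod n) * (2 * (1 + ((r : ZMod n) ^ 2) ^ 2)) = 0 := by
    have ha0 := units_mul_self_cast (n := n) (a 0)
    generalize ((a 0 : ℤ) : ZMod n) = x at *
    generalize ((c : ℤ) : ZMod n) = y at *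
    generalize (r : ZMod n) ^ 2 = q at *
    linear_combination x * h1 + t * hrel -
      t * (1 - y * q + y ^ 2 * q ^ 2 - y ^ 3 * q ^ 3) * ha0 - t * (q ^ 2 - y * q ^ 3) * hc
  have : NeZero n := ⟨by omega⟩
  obtain ⟨R, hR⟩ : ∃ R : ℕ, (R : ZMod n) = r := ⟨(r : ZMod n).val, by simp⟩
  rw [← hR] at h2
  have h3 : ((t * (2 * (1 + (R ^ 2) ^ 2)) : ℕ) : ZMod n) = 0 := by push_cast; exact h2
  rw [ZMod.natCast_eq_zero_iff] at h3
  have h4 : 8 * t ∣ t * (2 * (1 + (R ^ 2) ^ 2)) := hn ▸ h3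
  rw [mul_comm 8 t] at h4
  have h5 : 4 ∣ 1 + (R ^ 2) ^ 2 := by
    have := Nat.dvd_of_mul_dvd_mul_left ht h4
    omega
  have h6 : (R ^ 2) ^ 2 % 4 = 0 ∨ (R ^ 2) ^ 2 % 4 = 1 := by
    rw [Nat.pow_mod, Nat.pow_mod R]
    have := Nat.mod_lt R (show 4 > 0 by norm_num)
    interval_cases R % 4 <;> simp
  omega

/-- If `m = 4`, `s = 2` and `±1 ± r^2 ± r^4 ± r^6 = 0`, an alternating closed path would be mapped
to a directed one, and the signs along the latter contradict its being closed. -/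
theorem noMixing_of_four [NeZero (4 * 2)] (hn : 3 ≤ n)
    (hr : (r : ZMod n) ^ (4 * 2) = 1 ∨ (r : ZMod n) ^ (4 * 2) = -1)
    (hq : 2 * (((r : ZMod n) ^ 2) ^ 2 - 1) ≠ 0) {b : ℕ → ℤˣ}
    (hb : ((b 0 : ℤ) : ZMod n) + ((b 1 : ℤ) : ZMod n) * (r : ZMod n) ^ 2 +
      ((b 2 : ℤ) : ZMod n) * ((r : ZMod n) ^ 2) ^ 2 +
      ((b 3 : ℤ) : ZMod n) * ((r : ZMod n) ^ 2) ^ 3 = 0) : NoMixing 4 2 n r := by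
  have h3 : 3 ≤ 4 * 2 := by norm_num
  obtain ⟨hq4, c, hrel⟩ := relation_normal_form (two_ne_zero' hn) hq
    (by rwa [← pow_mul, show 2 * 4 = 4 * 2 by norm_num]) hb
  have hsp := not_special_of_pow_four hn hq hq4
  rintro Φ x y y' hy hy' hne ⟨hΦy, hΦy'⟩
  obtain ⟨L, v, d, a, hd0, hd1, ha, h⟩ := exists_walk_fork hn h3 hr hy hy' hne
    ((adj_iff (by norm_num)).2 (Or.inl hy)).symm
  obtain ⟨p, hp⟩ : ∃ p, p = walk 4 2 n r L v altDir (fun _ => a 0) := ⟨_, rfl⟩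
  have hpre : ∀ j ≤ 2, p j = arc3 y' x y x j := by
    intro j hj
    rw [h, hp]
    refine walk_congr L v (l := 2) ?_ j hj
    intro j hj
    interval_cases j
    · exact ⟨by rw [hd0]; rfl, rfl⟩
    · exact ⟨by rw [hd1]; rfl, ha.symm⟩
  have hadj : ∀ i, (fullGraph 4 2 n r).Adj (p i) (p (i + 1)) := by
    rw [hp]
    exact walk_adj (by norm_num) hr L v altDir _
  -- the image of the alternating path `p`
  obtain ⟨M, u, hM⟩ := exists_pt (Φ (p 0))
  obtain ⟨D, A, hDA⟩ := exists_eq_walk (w := fun i => Φ (p i)) (by norm_num) hr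
    (fun i => Φ.map_adj_iff.2 (hadj i)) hM
  have hD0 : D 0 = 1 := by
    rw [← (fwd_walk_iff h3 hr M u D A 0).1, ← hDA, ← hDA, hpre 0 (by norm_num),
      hpre 1 (by norm_num)]
    exact hΦy'
  have hD1 : D 1 = 1 := by
    rw [← (fwd_walk_iff h3 hr M u D A 1).1, ← hDA, ← hDA, hpre 2 (by norm_num),
      hpre 1 (by norm_num), arc3_two]
    exact hΦy
  have hup := up_of_not_onClosedWalk hn hr hrel (L := M) (v := u) hD0 hD1
    (fun j => by
      rw [← walk_nb_iff (r := r) hn h3 M u D A j, ← hDA, ← hDA]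
      refine Φ.injective.ne ?_
      rw [hp, walk_nb_iff hn h3]
      exact fun _ => rfl)
    (fun j => by
      have h1 := not_onClosedWalk_altDir hn hr hq hsp L v (fun _ => a 0) j
      rw [← hp, ← onClosedWalk_map_iff Φ] at h1
      rwa [funext fun i => hDA (j + i)] at h1)
  have hD : D = fun _ => 1 := funext fun j => (hup j).1
  -- `p` returns after an even number of steps that is divisible by `n`, and so does its image
  have hret : ∀ N, Even N → n ∣ N → 8 ∣ N ∧
      ∑ i ∈ Finset.range N, ((A i : ℤ) : ZMod n) * e 2 n r i = 0 := by
    intro N hN hnN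
    have h1 : walk 4 2 n r M u D A N = walk 4 2 n r M u D A 0 := by
      rw [← hDA, ← hDA, hp, walk_altDir_period L v (a 0) hN hnN]
    rw [walk_zero, hD] at h1
    have hfst := congrArg Prod.fst h1
    have hsnd : ∑ i ∈ Finset.range N, A i • E 2 n r (M + edgeLevel (fun _ => 1) i) = 0 := by
      simpa [walk] using congrArg Prod.snd h1
    constructor
    · have : ((N : ℕ) : ZMod (4 * 2)) = 0 := by simpa [walk] using hfst
      exact (ZMod.natCast_eq_zero_iff _ _).1 this
    · have h2 := (sum_smul_E_eq_zero_iff M (fun _ => 1) A N).1 hsnd 0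
      simpa [edgeLevel, edgeShift_one] using h2
  have h2n := (hret (2 * n) (even_two_mul n) (Dvd.intro_left 2 rfl)).1
  obtain ⟨⟨t, ht⟩, hsum⟩ := hret n (by rw [Nat.even_iff]; omega) dvd_rfl
  exact sum_ne_zero_of_recursion ht (by omega) hq4 hrel (fun j => (hup j).2) hsum

/-! ### The main result -/

theorem noMixing (hs : 2 ≤ s) (hm : 1 ≤ m) (hn : 3 ≤ n)
    (hr : (r : ZMod n) ^ (m * s) = 1 ∨ (r : ZMod n) ^ (m * s) = -1)
    (hc1 : 2 * ((r : ZMod n) ^ (2 * s) + 1) ≠ 0) (hc2 : 2 * ((r : ZMod n) ^ (2 * s) - 1) ≠ 0) :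
    NoMixing m s n r := by
  have : NeZero s := ⟨by omega⟩
  have : NeZero (m * s) := ⟨by positivity⟩
  rw [mul_comm 2 s, pow_mul] at hc1 hc2
  rw [mul_comm m s, pow_mul] at hr
  -- for `m = 1` and `m = 2` the assumption on `r^{m s}` gives `r^{2s} = ±1`
  have hm3 : 3 ≤ m := by
    by_contra hlt
    obtain rfl | rfl : m = 1 ∨ m = 2 := by omega
    · rw [pow_one] at hr
      apply hc2
      rcases hr with h | h <;> rw [h] <;> ring
    · rcases hr with h | h
      · exact hc2 (by rw [h]; ring)
      · exact hc1 (by rw [h]; ring)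
  rw [← pow_mul, mul_comm s m] at hr
  have hms : m = 3 ∧ s = 2 ∨ m = 4 ∧ s = 2 ∨ 9 ≤ m * s := by
    by_cases h : s = 2
    · subst h; omega
    · exact Or.inr (Or.inr (Nat.mul_le_mul hm3 (show 3 ≤ s by omega)))
  by_cases hrel : HasWindingRelation m s n r
  · rcases hrel with ⟨rfl, rfl, b, hb⟩ | ⟨rfl, rfl, b, hb⟩
    · exact noMixing_of_three hn hr hc2 hb
    · exact noMixing_of_four hn hr hc2 hb
  · exact noMixing_of_not_hasWindingRelation hn hs hr hms hc2 hrel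

end CPM

theorem mainTheorem2 (m s n : ℕ) (hm : 1 ≤ m) (hs : 2 ≤ s) (hn : 3 ≤ n) (r : (ZMod n)ˣ)
    (hr : (r : ZMod n) ^ (m * s) = 1 ∨ (r : ZMod n) ^ (m * s) = -1) :
    ((CPM.graph m s n r).IsHalfArcTransitive ↔
      (2 * ((r : ZMod n) ^ (2 * s) + 1) ≠ 0 ∧ 2 * ((r : ZMod n) ^ (2 * s) - 1) ≠ 0)) ∧
    ((CPM.graph m s n r).IsHalfArcTransitive →
      (∀ π : Equiv.Perm (CPM.vertexSet m s n r), π ∈ CPM.group m s n r ↔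
        ∃ φ : CPM.graph m s n r ≃g CPM.graph m s n r, φ.toEquiv = π) ∧
      ∀ x : CPM.vertexSet m s n r,
        Nonempty (MulAction.stabilizer (CPM.graph m s n r ≃g CPM.graph m s n r) x ≃*
          Multiplicative (Fin s → ZMod 2))) :=
  CPM.main_of_noMixing hs hm hn hr (CPM.noMixing hs hm hn hr)
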